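/- Let $T>0$, $\alpha\in(1/2,1]$, let $f:\mathbb{R}\to\mathbb{R}$ be continuous and $F(\xi):=\int_0^\xi f(s)\,ds$. For $\gamma>0$ let ${}_0D_t^{-\gamma}u(t)=\frac1{\Gamma(\gamma)}\int_0^t(t-s)^{\gamma-1}u(s)\,ds$ and ${}_tD_T^{-\gamma}u(t)=\frac1{\Gamma(\gamma)}\int_t^T(s-t)^{\gamma-1}u(s)\,ds$ be the left and right Riemann–Liouville fractional integrals (for order $0$: the identity), and let ${}_0^cD_t^{\alpha}u={}_0D_t^{\alpha-1}u'$ and ${}_t^cD_T^{\alpha}u=-\,{}_tD_T^{\alpha-1}u'$ be the left and right Caputo derivatives. Let $E_0^\alpha$ be the closure of $C_0^\infty([0,T])=\{g\in C^\infty([0,T]): g(0)=g(T)=0\}$ with respect to the norm $\|u\|=\big(\int_0^T|{}_0^cD_t^\alpha u|^2dt+\int_0^T|u|^2dt\big)^{1/2}$; on $E_0^\alpha$ the Caputo derivatives are understood as the $L^2$-extensions (by closure) of those on $C_0^\infty([0,T])$. Put $$\kappa_\alpha=\frac{T^{2\alpha}}{\Gamma(\alpha)^2|\cos(\pi\alpha)|(2\alpha-1)},\qquad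 c=\frac{T^{\alpha-1/2}}{\Gamma(\alpha)\sqrt{2\alpha-1}},$$ and, for $u\in E_0^\alpha$, $$\Phi(u)=-\int_0^T{}_0^cD_t^\alpha u(t)\cdot{}_t^cD_T^\alpha u(t)\,dt,\qquad \Psi(u)=\int_0^TF(u(t))\,dt,\qquad J_\mu=\Phi-\mu\Psi .$$ Then for every $$\mu\in\Big(0,\ \frac1{\kappa_\alpha}\sup_{\gamma>0}\frac{\gamma^2}{\max_{|\xi|\le\gamma}F(\xi)}\Big)$$ (with the convention $\gamma^2/0=+\infty$) there is $u_\mu\in E_0^\alpha$ such that: 1. $u_\mu$ is a solution of $$\frac{d}{dt}\Big({}_0D_t^{\alpha-1}({}_0^cD_t^\alpha u(t))-{}_tD_T^{\alpha-1}({}_t^cD_T^\alpha u(t))\Big)+\mu f(u(t))=0\ \text{ for a.e. }t\in[0,T],\qquad u(0)=u(T)=0,$$ that is, $u_\mu$ is absolutely continuous on $[0,T]$, the function in the large brackets (formed with the Caputo derivatives of the absolutely continuous function $u_\mu$) is differentiable in the classical sense at almost every $t\in[0,T]$, and the equation and the boundary conditions hold; 2. $u_\mu$ is a local minimum of $J_\mu$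 on $E_0^\alpha$; 3. there is $\gamma>0$ with $\kappa_\alpha\,\mu\,\max_{|\xi|\le\gamma}F(\xi)<\gamma^2$ such that $\Phi(u_\mu)<\dfrac{|\cos(\pi\alpha)|}{c^2}\,\gamma^2$. -/

import Mathlib

open scoped ENNReal ContDiff

noncomputable section

namespace FracBVP

open MeasureTheory Set

/-- Left Riemann–Liouville fractional integral of order `γ ≥ 0` with base point `a`
(the integral of order `0` is the identity). -/
def leftRL (γ a : ℝ) (u : ℝ → ℝ) (t : ℝ) : ℝ :=
  if γ = 0 then u t
  else (1 / Real.Gamma γ) * ∫ s in a..t, (t - s) ^ (γ - 1) * u s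

/-- Right Riemann–Liouville fractional integral of order `γ ≥ 0` with base point `b`
(the integral of order `0` is the identity). -/
def rightRL (γ b : ℝ) (u : ℝ → ℝ) (t : ℝ) : ℝ :=
  if γ = 0 then u t
  else (1 / Real.Gamma γ) * ∫ s in t..b, (s - t) ^ (γ - 1) * u s

/-- Left Caputo derivative of order `α ∈ (0, 1]`:
`(1 / Γ(1 - α)) ∫_a^t (t - s)^(-α) u'(s) ds` for `α < 1`, and `u'` for `α = 1`. -/
def leftCaputo (α a : ℝ) (u : ℝ → ℝ) : ℝ → ℝ :=
  leftRL (1 - α) a (deriv u)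

/-- Right Caputo derivative of order `α ∈ (0, 1]`:
`-(1 / Γ(1 - α)) ∫_t^b (s - t)^(-α) u'(s) ds` for `α < 1`, and `-u'` for `α = 1`. -/
def rightCaputo (α b : ℝ) (u : ℝ → ℝ) (t : ℝ) : ℝ :=
  - rightRL (1 - α) b (deriv u) t

/-- The map `t ↦ ₀D_t^(α-1)(₀ᶜD_t^α u(t)) - ₜD_T^(α-1)(ₜᶜD_T^α u(t))`. -/
def flux (α T : ℝ) (u : ℝ → ℝ) (t : ℝ) : ℝ :=
  leftRL (1 - α) 0 (leftCaputo α 0 u) t - rightRL (1 - α) T (rightCaputo α T u) t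

/-- `u` is a solution of `d/dt (flux u)(t) + f (u t) = 0` for a.e. `t ∈ [0, T]`,
`u(0) = u(T) = 0`: it is absolutely continuous on `[0, T]`, its flux is differentiable in the
classical sense at almost every `t`, and the equation and the boundary conditions hold. -/
structure IsSolution (α T : ℝ) (f u : ℝ → ℝ) : Prop where
  ac : AbsolutelyContinuousOnInterval u 0 T
  differentiable : ∀ᵐ t ∂(volume.restrict (Icc 0 T)), DifferentiableAt ℝ (flux α T u) t
  equation : ∀ᵐ t ∂(volume.restrict (Icc 0 T)), deriv (flux α T u) t + f (u t) = 0
  left_bc : u 0 = 0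
  right_bc : u T = 0

/-- The real Hilbert space `L²([0, T])`. -/
abbrev L2 (T : ℝ) : Type := Lp ℝ 2 (volume.restrict (Icc (0 : ℝ) T))

/-- `C₀^∞([0, T])`: smooth functions on the closed interval vanishing at both endpoints. -/
def smoothZero (T : ℝ) : Set (ℝ → ℝ) :=
  {φ | ContDiffOn ℝ ∞ φ (Icc 0 T) ∧ φ 0 = 0 ∧ φ T = 0}

/-- The pairs `(φ, ₀ᶜD_t^α φ)` with `φ ∈ C₀^∞([0, T])`, inside `L² × L²`. The norm of the pair is
`(∫ |₀ᶜD_t^α φ|² + ∫ |φ|²)^(1/2)`. -/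
def leftGraph (α T : ℝ) : Set (WithLp 2 (L2 T × L2 T)) :=
  {p | ∃ φ ∈ smoothZero T, p.fst =ᵐ[volume.restrict (Icc 0 T)] φ ∧
    p.snd =ᵐ[volume.restrict (Icc 0 T)] leftCaputo α 0 φ}

/-- The pairs `(φ, ₜᶜD_T^α φ)` with `φ ∈ C₀^∞([0, T])`, inside `L² × L²`. -/
def rightGraph (α T : ℝ) : Set (WithLp 2 (L2 T × L2 T)) :=
  {p | ∃ φ ∈ smoothZero T, p.fst =ᵐ[volume.restrict (Icc 0 T)] φ ∧
    p.snd =ᵐ[volume.restrict (Icc 0 T)] rightCaputo α T φ}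

/-- The fractional derivative space `E₀^α`: the closure of `C₀^∞([0, T])` in the norm
`(∫ |₀ᶜD_t^α u|² + ∫ |u|²)^(1/2)`. An element is stored as the pair `(u, ₀ᶜD_t^α u)`: the first
component is the function, the second one its left Caputo derivative (extended by closure), which
the first one determines. -/
def E0 (α T : ℝ) : Set (WithLp 2 (L2 T × L2 T)) :=
  closure (leftGraph α T)

/-- The right Caputo derivative on `E₀^α`, extended from `C₀^∞([0, T])` by closing its graph in
`L² × L²` (the closure is again the graph of a function, so the choice is the only one). -/
def rightCaputoL2 (α T : ℝ) (u : L2 T) : L2 T :=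
  Classical.epsilon fun w : L2 T => WithLp.toLp 2 (u, w) ∈ closure (rightGraph α T)

/-- `Φ(u) = - ∫₀^T ₀ᶜD_t^α u(t) · ₜᶜD_T^α u(t) dt`. -/
def Phi (α T : ℝ) (e : WithLp 2 (L2 T × L2 T)) : ℝ :=
  - ∫ t in Icc 0 T, e.snd t * rightCaputoL2 α T e.fst t

/-- The potential `F(ξ) = ∫₀^ξ f(s) ds`. -/
def potential (f : ℝ → ℝ) (ξ : ℝ) : ℝ := ∫ s in (0 : ℝ)..ξ, f s

/-- `Ψ(u) = ∫₀^T F(u(t)) dt`. -/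
def Psi (T : ℝ) (f : ℝ → ℝ) (e : WithLp 2 (L2 T × L2 T)) : ℝ :=
  ∫ t in Icc 0 T, potential f (e.fst t)

/-- The energy `J_μ = Φ - μ Ψ`. -/
def energy (α T μ : ℝ) (f : ℝ → ℝ) (e : WithLp 2 (L2 T × L2 T)) : ℝ :=
  Phi α T e - μ * Psi T f e

/-- `max_{|ξ| ≤ γ} F(ξ)` (for continuous `f` and `γ ≥ 0` this supremum is a maximum, and it is
at least `F(0) = 0`). -/
def maxPotential (f : ℝ → ℝ) (γ : ℝ) : ℝ := sSup (potential f '' Icc (-γ) γ)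

/-- `κ_α = T^(2α) / (Γ(α)² |cos(πα)| (2α - 1))`. -/
def kappa (α T : ℝ) : ℝ :=
  T ^ (2 * α) / (Real.Gamma α ^ 2 * |Real.cos (Real.pi * α)| * (2 * α - 1))

/-- The constant `c = T^(α - 1/2) / (Γ(α) √(2α - 1))`. -/
def embConst (α T : ℝ) : ℝ :=
  T ^ (α - 1 / 2) / (Real.Gamma α * Real.sqrt (2 * α - 1))

/-- `(1/κ_α) sup_{γ > 0} γ² / max_{|ξ| ≤ γ} F(ξ)` as an extended nonnegative number, with
`γ² / 0 = +∞`. -/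
def muStar (α T : ℝ) (f : ℝ → ℝ) : ℝ≥0∞ :=
  ENNReal.ofReal (1 / kappa α T) *
    ⨆ γ : ℝ, ⨆ _ : 0 < γ, ENNReal.ofReal (γ ^ 2) / ENNReal.ofReal (maxPotential f γ)

end FracBVP

end

open scoped ENNReal ContDiff

noncomputable section

namespace FracBVP

open MeasureTheory Set

/-! ### Power kernels and the Beta integrals -/

/-! Put `β = 1 - α ∈ [0, 1/2)` and let `L`, `R` be the left and right fractional integrals of order
`β` on `L²`, which are adjoint to each other. The space `E₀^α` is parametrised by the closure
`derivPairs` of the pairs `(Lφ', Rφ')`: the function is the order-`α` integral of the first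
component, and `Φ` becomes the quadratic form `⟨y.fst, y.snd⟩`. Its coercivity comes from
`fractional_energy_identity`: `⟨Lv, Rv⟩` equals `cos(πβ)` times the squared norm of either potential
of `v` over the whole line.

Since `α > 1/2`, point evaluation is bounded with constant `c`. On the sublevel set `Φ ≤ r =
|cos(πα)| γ²/c²` one therefore has `|u| ≤ γ`, and `μΨ ≤ μ T max F < r` by the choice of `γ`. The
form is weakly lower semicontinuous and `Ψ` is weakly continuous, so `J_μ` has a minimiser there.
Comparison with `0` gives `Φ ≤ μΨ < r`, so the minimiser is interior, is a local minimum, and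
satisfies a weak Euler–Lagrange identity (`exists_minimizer`, `isLocalMinOn_energy`,
`euler_lagrange`).

The remaining difficulty is regularity: the weak identity only knows `Lφ'`-type limits, while
absolute continuity needs an actual derivative in `L¹`. The right-hand side `h = μ f(u)` is frozen
and the linear equation `L²v + R²v = A - ∫₀ᵗ h` is solved explicitly with `v ∈ L²` of mean zero
(`exists_solution_linear`). Its kernel is the Riesz kernel `|t - r|^(2β-1)`, which factorises into a
left Abel integral, a power weight and a right Abel integral (`rlKernel_factorisation`). Both Abel
equations are inverted: the left one through the primitive of `h`, the right one by the Marchaud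
derivative of a Hölder-`1/2` function (`abel_inversion`). Coercivity makes the weak solution unique,
so `u = ∫₀ᵗ v`, and the equation holds classically. -/

/-- The Riemann–Liouville kernel `x ↦ x₊^(γ-1) / Γ(γ)`. -/
def rlKernel (γ x : ℝ) : ℝ := if 0 < x then x ^ (γ - 1) / Real.Gamma γ else 0

lemma rlKernel_of_pos {γ x : ℝ} (hx : 0 < x) : rlKernel γ x = x ^ (γ - 1) / Real.Gamma γ :=
  if_pos hx

lemma rlKernel_of_nonpos {γ x : ℝ} (hx : x ≤ 0) : rlKernel γ x = 0 :=
  if_neg hx.not_gt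

lemma rlKernel_nonneg {γ : ℝ} (hγ : 0 < γ) (x : ℝ) : 0 ≤ rlKernel γ x := by
  unfold rlKernel
  split_ifs with h
  · have := Real.Gamma_pos_of_pos hγ
    positivity
  · exact le_rfl

@[fun_prop]
lemma measurable_rlKernel (γ : ℝ) : Measurable (rlKernel γ) :=
  Measurable.ite measurableSet_Ioi (by fun_prop) (by fun_prop)

lemma rlKernel_one_of_pos {x : ℝ} (hx : 0 < x) : rlKernel 1 x = 1 := by
  simp [rlKernel_of_pos hx]

open ProbabilityTheory in
lemma integrableOn_beta {a b : ℝ} (ha : 0 < a) (hb : 0 < b) :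
    IntegrableOn (fun x : ℝ => x ^ (a - 1) * (1 - x) ^ (b - 1)) (Ioo 0 1) ∧
      ∫ x in Ioo (0 : ℝ) 1, x ^ (a - 1) * (1 - x) ^ (b - 1) = beta a b := by
  have h1 : ∫ x in Ioo (0 : ℝ) 1, x ^ (a - 1) * (1 - x) ^ (b - 1) = beta a b := by
    have hp := beta_pos ha hb
    have h := lintegral_betaPDF_eq_one ha hb
    rw [lintegral_betaPDF, ← ENNReal.toReal_eq_one_iff, ← integral_eq_lintegral_of_nonneg_ae] at h
    · simp_rw [mul_assoc, integral_const_mul] at h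
      field_simp at h
      exact h
    · refine ae_restrict_of_forall_mem measurableSet_Ioo (fun x hx ↦ ?_)
      have h1 : 0 < x := hx.1
      have h2 : 0 < 1 - x := by linarith [hx.2]
      simp only [Pi.zero_apply]
      positivity
    · exact Measurable.aestronglyMeasurable (by fun_prop)
  refine ⟨?_, h1⟩
  -- A non-integrable function has Bochner integral `0`, whereas the Beta value is positive.
  by_contra h
  rw [integral_undef h] at h1
  exact (beta_pos ha hb).ne h1

open ProbabilityTheory in
/-- The Beta integral after a bijective change of variables `ρ : I → (0, 1)`. -/
lemma beta_change_of_variables {a b : ℝ} (ha : 0 < a) (hb : 0 < b) {I : Set ℝ}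
    (hI : MeasurableSet I) {ρ ρ' σ : ℝ → ℝ} (hd : ∀ x ∈ I, HasDerivAt ρ (ρ' x) x)
    (h1 : MapsTo ρ I (Ioo 0 1)) (h2 : MapsTo σ (Ioo 0 1) I) (h : InvOn σ ρ I (Ioo 0 1)) :
    IntegrableOn (fun x => |ρ' x| * (ρ x ^ (a - 1) * (1 - ρ x) ^ (b - 1))) I ∧
      ∫ x in I, |ρ' x| * (ρ x ^ (a - 1) * (1 - ρ x) ^ (b - 1)) = beta a b := by
  have hbij := h.bijOn h1 h2
  have e1 := integrableOn_image_iff_integrableOn_abs_deriv_smul hI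
    (fun x hx => (hd x hx).hasDerivWithinAt) hbij.injOn
    (fun x : ℝ => x ^ (a - 1) * (1 - x) ^ (b - 1))
  have e2 := integral_image_eq_integral_abs_deriv_smul hI
    (fun x hx => (hd x hx).hasDerivWithinAt) hbij.injOn
    (fun x : ℝ => x ^ (a - 1) * (1 - x) ^ (b - 1))
  rw [hbij.image_eq] at e1 e2
  obtain ⟨g1, g2⟩ := integrableOn_beta ha hb
  exact ⟨e1.1 g1, e2.symm.trans g2⟩

-- Formulated for a function on the whole line vanishing off `I`, because `rlKernel` is extended by
-- zero. The three kernel identities below are instances.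
open ProbabilityTheory in
lemma beta_change_of_variables_indicator {a b : ℝ} (ha : 0 < a) (hb : 0 < b) {I : Set ℝ}
    (hI : MeasurableSet I) {ρ ρ' σ : ℝ → ℝ} (hd : ∀ x ∈ I, HasDerivAt ρ (ρ' x) x)
    (h1 : MapsTo ρ I (Ioo 0 1)) (h2 : MapsTo σ (Ioo 0 1) I) (h : InvOn σ ρ I (Ioo 0 1))
    {G : ℝ → ℝ} (c : ℝ) (hG0 : ∀ x ∉ I, G x = 0)
    (hG : ∀ x ∈ I, G x = c * (|ρ' x| * (ρ x ^ (a - 1) * (1 - ρ x) ^ (b - 1)))) :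
    Integrable G ∧ ∫ x, G x = c * beta a b := by
  obtain ⟨g1, g2⟩ := beta_change_of_variables ha hb hI hd h1 h2 h
  have e : G = I.indicator
      (fun x => c * (|ρ' x| * (ρ x ^ (a - 1) * (1 - ρ x) ^ (b - 1)))) := by
    funext x
    by_cases hx : x ∈ I
    · rw [indicator_of_mem hx, hG x hx]
    · rw [indicator_of_notMem hx, hG0 x hx]
  rw [e, integrable_indicator_iff hI, integral_indicator hI]
  refine ⟨g1.const_mul c, ?_⟩
  rw [integral_const_mul, g2]

/-- Orders of fractional integrals add: `s = r + x(t - r)` turns the convolution into the Beta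
integral `B(δ, γ)`. For `t ≤ r` the two supports do not meet. -/
lemma rlKernel_semigroup {γ δ : ℝ} (hγ : 0 < γ) (hδ : 0 < δ) (t r : ℝ) :
    Integrable (fun s => rlKernel γ (t - s) * rlKernel δ (s - r)) ∧
      ∫ s, rlKernel γ (t - s) * rlKernel δ (s - r) = rlKernel (γ + δ) (t - r) := by
  rcases le_or_gt t r with htr | htr
  · have : (fun s => rlKernel γ (t - s) * rlKernel δ (s - r)) = fun _ => 0 := by
      funext s
      rcases le_or_gt s r with h | h
      · rw [rlKernel_of_nonpos (γ := δ) (by linarith), mul_zero]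
      · rw [rlKernel_of_nonpos (γ := γ) (by linarith), zero_mul]
    rw [this, rlKernel_of_nonpos (by linarith)]
    simp
  have hL : 0 < t - r := by linarith
  have key := beta_change_of_variables_indicator (a := δ) (b := γ) hδ hγ
    (I := Ioo r t) measurableSet_Ioo
    (ρ := fun s => (s - r) / (t - r)) (ρ' := fun _ => 1 / (t - r))
    (σ := fun x => r + x * (t - r))
    (fun x _ => ((hasDerivAt_id x).sub_const r).div_const _)
    (fun x hx => ⟨div_pos (by linarith [hx.1]) hL, by
      rw [div_lt_one hL]; linarith [hx.2]⟩)
    (fun x hx => ⟨by nlinarith [hx.1], by nlinarith [hx.2]⟩)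
    ⟨fun x _ => by field_simp; ring, fun x _ => by field_simp; ring⟩
    (G := fun s => rlKernel γ (t - s) * rlKernel δ (s - r))
    ((t - r) ^ (γ + δ - 1) / (Real.Gamma γ * Real.Gamma δ))
    (fun x hx => by
      rcases le_or_gt x r with h | h
      · simp [rlKernel_of_nonpos (γ := δ) (sub_nonpos.2 h)]
      · have : t ≤ x := by
          by_contra h'
          exact hx ⟨h, not_le.1 h'⟩
        simp [rlKernel_of_nonpos (γ := γ) (sub_nonpos.2 this)])
    (fun x hx => by
      have h1 : 0 < x - r := by linarith [hx.1]
      have h2 : 0 < t - x := by linarith [hx.2]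
      have e : 1 - (x - r) / (t - r) = (t - x) / (t - r) := by field_simp; ring
      have e3 : (t - r) ^ (γ + δ - 1) = (t - r) ^ (γ - 1) * (t - r) ^ (δ - 1) * (t - r) := by
        rw [← Real.rpow_add hL, ← Real.rpow_add_one hL.ne']
        congr 1; ring
      rw [rlKernel_of_pos h1, rlKernel_of_pos h2, e, Real.div_rpow h1.le hL.le,
        Real.div_rpow h2.le hL.le, abs_of_pos (by positivity), e3]
      have := Real.Gamma_pos_of_pos hγ
      have := Real.Gamma_pos_of_pos hδ
      have := Real.rpow_pos_of_pos hL (γ - 1)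
      have := Real.rpow_pos_of_pos hL (δ - 1)
      field_simp)
  refine ⟨key.1, key.2.trans ?_⟩
  have := Real.Gamma_pos_of_pos hγ
  have := Real.Gamma_pos_of_pos hδ
  rw [rlKernel_of_pos hL, ProbabilityTheory.beta, add_comm δ γ]
  field_simp

/-- The constant `Γ(1-2β) / (Γ(β) Γ(1-β))`. -/
def tailConst (β : ℝ) : ℝ := Real.Gamma (1 - 2 * β) / (Real.Gamma β * Real.Gamma (1 - β))

/-- The reflection formula at `β` and at `2β`, combined with the double-angle formula. This is the
source of the cosine in the coercivity constant. -/
lemma tailConst_mul_cos {β : ℝ} (h0 : 0 < β) (h1 : β < 1 / 2) :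
    2 * (tailConst β * Real.cos (Real.pi * β)) * Real.Gamma (2 * β) = 1 := by
  have g1 := Real.Gamma_mul_Gamma_one_sub β
  have g2 := Real.Gamma_mul_Gamma_one_sub (2 * β)
  have e : Real.pi * (2 * β) = 2 * (Real.pi * β) := by ring
  rw [e, Real.sin_two_mul] at g2
  have hs : 0 < Real.sin (Real.pi * β) :=
    Real.sin_pos_of_pos_of_lt_pi (by positivity) (by nlinarith [Real.pi_pos])
  have hc : 0 < Real.cos (Real.pi * β) :=
    Real.cos_pos_of_mem_Ioo ⟨by nlinarith [Real.pi_pos], by nlinarith [Real.pi_pos]⟩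
  have hpi := Real.pi_pos
  unfold tailConst
  rw [g1]
  have : Real.Gamma (1 - 2 * β) = Real.pi / (2 * Real.sin (Real.pi * β) * Real.cos (Real.pi * β))
      / Real.Gamma (2 * β) := by
    rw [← g2]
    field_simp [(Real.Gamma_pos_of_pos (s := 2 * β) (by linarith)).ne']
  rw [this]
  have := Real.Gamma_pos_of_pos (s := 2 * β) (by linarith)
  field_simp

/-- The two supports overlap on the half-line `(r, ∞)`, and `β < 1/2` gives convergence at infinity.
The ratio `(t - r)/(t - s)` maps that half-line onto `(0, 1)` and produces `B(β, 1 - 2β)`. -/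
lemma rlKernel_correlation_aux {β : ℝ} (h0 : 0 < β) (h1 : β < 1 / 2) {s r : ℝ} (hsr : s < r) :
    Integrable (fun t => rlKernel β (t - s) * rlKernel β (t - r)) ∧
      ∫ t, rlKernel β (t - s) * rlKernel β (t - r) = tailConst β * |s - r| ^ (2 * β - 1) := by
  have hL : 0 < r - s := by linarith
  have key := beta_change_of_variables_indicator (a := β) (b := 1 - 2 * β) h0 (by linarith)
    (I := Ioi r) measurableSet_Ioi
    (ρ := fun t => (t - r) / (t - s)) (ρ' := fun t => (r - s) / (t - s) ^ 2)
    (σ := fun x => (r - s * x) / (1 - x))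
    (fun x hx => by
      have hx' : r < x := hx
      have := ((hasDerivAt_id x).sub_const r).div ((hasDerivAt_id x).sub_const s)
        (by simp; linarith)
      refine this.congr_deriv ?_
      simp)
    (fun x hx => by
      have hx' : r < x := hx
      exact ⟨div_pos (by linarith) (by linarith), by rw [div_lt_one] <;> linarith⟩)
    (fun x hx => by
      have : 0 < 1 - x := by linarith [hx.2]
      simp only [mem_Ioi]
      rw [lt_div_iff₀ this]
      nlinarith [hx.1])
    ⟨fun x hx => by
      have hx' : r < x := hx
      have : x - s ≠ 0 := by linarith
      have h3 : 1 - (x - r) / (x - s) = (r - s) / (x - s) := by field_simp; ring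
      simp only
      rw [h3]
      field_simp
      ring, fun x hx => by
      have : 1 - x ≠ 0 := by linarith [hx.2]
      have h3 : (r - s * x) / (1 - x) - s = (r - s) / (1 - x) := by field_simp; ring
      have h4 : (r - s * x) / (1 - x) - r = (r - s) * x / (1 - x) := by field_simp; ring
      simp only
      rw [h3, h4]
      field_simp⟩
    (G := fun t => rlKernel β (t - s) * rlKernel β (t - r))
    ((r - s) ^ (2 * β - 1) / (Real.Gamma β * Real.Gamma β))
    (fun x hx => by
      have : x ≤ r := not_lt.1 hx
      simp [rlKernel_of_nonpos (γ := β) (sub_nonpos.2 this)])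
    (fun x hx => by
      have hx' : r < x := hx
      have p1 : 0 < x - r := by linarith
      have p2 : 0 < x - s := by linarith
      have h3 : 1 - (x - r) / (x - s) = (r - s) / (x - s) := by field_simp; ring
      rw [rlKernel_of_pos p1, rlKernel_of_pos p2, h3, Real.div_rpow p1.le p2.le,
        Real.div_rpow hL.le p2.le, abs_of_pos (by positivity)]
      have e1 : (r - s) ^ (1 - 2 * β - 1) = ((r - s) ^ (2 * β - 1))⁻¹ * (r - s)⁻¹ := by
        rw [← Real.rpow_neg hL.le, ← Real.rpow_neg_one (r - s), ← Real.rpow_add hL]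
        congr 1; ring
      have e2 : (x - s) ^ (1 - 2 * β - 1) = ((x - s) ^ (β - 1))⁻¹ * ((x - s) ^ (β - 1))⁻¹
          * ((x - s) ^ 2)⁻¹ := by
        rw [← Real.rpow_natCast (x - s) 2, ← Real.rpow_neg p2.le, ← Real.rpow_neg p2.le,
          ← Real.rpow_add p2, ← Real.rpow_add p2]
        congr 1; push_cast; ring
      rw [e1, e2]
      have := Real.Gamma_pos_of_pos h0
      have := Real.rpow_pos_of_pos p2 (β - 1)
      have := Real.rpow_pos_of_pos hL (2 * β - 1)
      field_simp)
  refine ⟨key.1, key.2.trans ?_⟩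
  have := Real.Gamma_pos_of_pos h0
  rw [abs_sub_comm, abs_of_pos hL, ProbabilityTheory.beta, tailConst]
  have : β + (1 - 2 * β) = 1 - β := by ring
  rw [this]
  field_simp

lemma rlKernel_correlation {β : ℝ} (h0 : 0 < β) (h1 : β < 1 / 2) {s r : ℝ} (hsr : s ≠ r) :
    Integrable (fun t => rlKernel β (t - s) * rlKernel β (t - r)) ∧
      ∫ t, rlKernel β (t - s) * rlKernel β (t - r) = tailConst β * |s - r| ^ (2 * β - 1) := by
  rcases lt_or_gt_of_ne hsr with h | h
  · exact rlKernel_correlation_aux h0 h1 h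
  · have := rlKernel_correlation_aux h0 h1 h
    rw [abs_sub_comm]
    simpa only [mul_comm (rlKernel β (_ - s))] using this

lemma rlKernel_correlation_right {β : ℝ} (h0 : 0 < β) (h1 : β < 1 / 2) {s r : ℝ} (hsr : s ≠ r) :
    Integrable (fun t => rlKernel β (s - t) * rlKernel β (r - t)) ∧
      ∫ t, rlKernel β (s - t) * rlKernel β (r - t) = tailConst β * |s - r| ^ (2 * β - 1) := by
  have h := rlKernel_correlation h0 h1 (s := -s) (r := -r) (by simpa using hsr)
  have e : (fun t => rlKernel β (s - t) * rlKernel β (r - t)) =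
      fun t => (fun t => rlKernel β (t - -s) * rlKernel β (t - -r)) (-t) := by
    funext t; simp only; congr 2 <;> ring
  rw [e]
  refine ⟨h.1.comp_neg, ?_⟩
  rw [integral_neg_eq_self (fun t => rlKernel β (t - -s) * rlKernel β (t - -r)), h.2,
    abs_sub_comm]
  congr 3; ring

/-- The weighted product kernel that factorises the Riesz kernel on a half-line. -/
lemma rlKernel_factorisation_aux {β : ℝ} (h0 : 0 < β) (h1 : β < 1 / 2) {x y : ℝ} (hx0 : 0 < x)
    (hxy : x < y) :
    Integrable (fun s => rlKernel (1 - 2 * β) s * (rlKernel β (x - s) * rlKernel β (y - s))) ∧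
      ∫ s, rlKernel (1 - 2 * β) s * (rlKernel β (x - s) * rlKernel β (y - s)) =
        (x ^ (-β) * y ^ (-β) * |x - y| ^ (2 * β - 1)) / (Real.Gamma β * Real.Gamma (1 - β)) := by
  have hy0 : 0 < y := hx0.trans hxy
  have hL : 0 < y - x := by linarith
  have key := beta_change_of_variables_indicator (a := 1 - 2 * β) (b := β) (by linarith) h0
    (I := Ioo 0 x) measurableSet_Ioo
    -- The Möbius map with `0 ↦ 0`, `x ↦ 1` and pole at `y`; it reduces the three power factors to
    -- the two factors of `B(1 - 2β, β)`.
    (ρ := fun s => s * (y - x) / (x * (y - s)))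
    (ρ' := fun s => (y - x) * y / (x * (y - s) ^ 2))
    (σ := fun ρ => ρ * x * y / (y - x + ρ * x))
    (fun s hs => by
      have hs' : 0 < y - s := by linarith [hs.2]
      have := ((hasDerivAt_id s).mul_const (y - x)).div (((hasDerivAt_id s).const_sub y).const_mul x)
        (by simp only [id]; positivity)
      refine this.congr_deriv ?_
      simp only [id]
      field_simp
      ring)
    (fun s hs => by
      have hs' : 0 < y - s := by linarith [hs.2]
      have hs0 := hs.1
      refine ⟨by positivity, ?_⟩
      rw [div_lt_one (by positivity)]
      nlinarith [hs.2])
    (fun ρ hρ => by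
      have hρ0 := hρ.1
      refine ⟨by positivity, ?_⟩
      rw [div_lt_iff₀ (by positivity)]
      nlinarith [hρ.2, mul_pos hx0 hL])
    ⟨fun s hs => by
      have hs' : 0 < y - s := by linarith [hs.2]
      have hs0 := hs.1
      have h3 : y - x + s * (y - x) / (x * (y - s)) * x = (y - x) * y / (y - s) := by
        field_simp; ring
      simp only
      rw [h3]
      field_simp, fun ρ hρ => by
      have hρ0 := hρ.1
      have h5 : 0 < y - x + ρ * x := by positivity
      have h3 : y - ρ * x * y / (y - x + ρ * x) = (y - x) * y / (y - x + ρ * x) := by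
        field_simp; ring
      simp only
      rw [h3]
      field_simp⟩
    (G := fun s => rlKernel (1 - 2 * β) s * (rlKernel β (x - s) * rlKernel β (y - s)))
    (x ^ (-β) * y ^ (-β) * (y - x) ^ (2 * β - 1) /
      (Real.Gamma β * Real.Gamma β * Real.Gamma (1 - 2 * β)))
    (fun s hs => by
      rcases le_or_gt s 0 with h | h
      · simp [rlKernel_of_nonpos h]
      · have : x ≤ s := by
          by_contra h'
          exact hs ⟨h, not_le.1 h'⟩
        simp [rlKernel_of_nonpos (γ := β) (sub_nonpos.2 this)])
    (fun s hs => by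
      have p0 : 0 < s := hs.1
      have p1 : 0 < x - s := by linarith [hs.2]
      have p2 : 0 < y - s := by linarith [hs.2]
      have h3 : 1 - s * (y - x) / (x * (y - s)) = y * (x - s) / (x * (y - s)) := by
        field_simp; ring
      rw [rlKernel_of_pos p0, rlKernel_of_pos p1, rlKernel_of_pos p2, h3,
        Real.div_rpow (by positivity) (by positivity),
        Real.div_rpow (by positivity) (by positivity), abs_of_pos (by positivity),
        Real.mul_rpow p0.le hL.le, Real.mul_rpow hx0.le p2.le, Real.mul_rpow hy0.le p1.le,
        Real.mul_rpow hx0.le p2.le]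
      have e1 : (y - x) ^ (1 - 2 * β - 1) = ((y - x) ^ (2 * β - 1))⁻¹ * (y - x)⁻¹ := by
        rw [← Real.rpow_neg hL.le, ← Real.rpow_neg_one (y - x), ← Real.rpow_add hL]
        congr 1; ring
      have e2 : (y - s) ^ (1 - 2 * β - 1) = ((y - s) ^ (β - 1))⁻¹ * ((y - s) ^ (β - 1))⁻¹
          * ((y - s) ^ 2)⁻¹ := by
        rw [← Real.rpow_natCast (y - s) 2, ← Real.rpow_neg p2.le, ← Real.rpow_neg p2.le,
          ← Real.rpow_add p2, ← Real.rpow_add p2]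
        congr 1; push_cast; ring
      have e3 : x ^ (1 - 2 * β - 1) = x ^ (-β) * x ^ (-β) := by
        rw [← Real.rpow_add hx0]; congr 1; ring
      have e4 : x ^ (β - 1) = (x ^ (-β))⁻¹ * x⁻¹ := by
        rw [← Real.rpow_neg hx0.le, ← Real.rpow_neg_one x, ← Real.rpow_add hx0]; congr 1; ring
      have e5 : y ^ (β - 1) = (y ^ (-β))⁻¹ * y⁻¹ := by
        rw [← Real.rpow_neg hy0.le, ← Real.rpow_neg_one y, ← Real.rpow_add hy0]; congr 1; ring
      rw [e1, e2, e3, e4, e5]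
      have := Real.Gamma_pos_of_pos h0
      have := Real.rpow_pos_of_pos p2 (β - 1)
      have := Real.rpow_pos_of_pos hL (2 * β - 1)
      have := Real.rpow_pos_of_pos hx0 (-β)
      have := Real.rpow_pos_of_pos hy0 (-β)
      field_simp)
  refine ⟨key.1, key.2.trans ?_⟩
  have := Real.Gamma_pos_of_pos h0
  have := Real.Gamma_pos_of_pos (s := 1 - 2 * β) (by linarith)
  rw [abs_sub_comm, abs_of_pos hL, ProbabilityTheory.beta]
  have : 1 - 2 * β + β = 1 - β := by ring
  rw [this]
  generalize Real.Gamma (1 - 2 * β) = G at *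
  field_simp

lemma rlKernel_factorisation {β : ℝ} (h0 : 0 < β) (h1 : β < 1 / 2) {x y : ℝ} (hx0 : 0 < x)
    (hy0 : 0 < y) (hxy : x ≠ y) :
    Integrable (fun s => rlKernel (1 - 2 * β) s * (rlKernel β (x - s) * rlKernel β (y - s))) ∧
      ∫ s, rlKernel (1 - 2 * β) s * (rlKernel β (x - s) * rlKernel β (y - s)) =
        (x ^ (-β) * y ^ (-β) * |x - y| ^ (2 * β - 1)) / (Real.Gamma β * Real.Gamma (1 - β)) := by
  rcases lt_or_gt_of_ne hxy with h | h
  · exact rlKernel_factorisation_aux h0 h1 hx0 h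
  · have := rlKernel_factorisation_aux h0 h1 hy0 h
    rw [abs_sub_comm, mul_comm (x ^ (-β))]
    simpa only [mul_comm (rlKernel β (x - _))] using this

end FracBVP

namespace FracBVP

open MeasureTheory Set

/-! ### Integral operators satisfying the Schur test -/

/-- The integral operator with kernel `κ`. -/
def kernelInt (μ : Measure ℝ) (κ : ℝ → ℝ → ℝ) (f : ℝ → ℝ) (t : ℝ) : ℝ := ∫ s, κ t s * f s ∂μ

/-- The hypotheses of the Schur test with constant `C`. -/
structure IsSchurKernel (μ : Measure ℝ) (κ : ℝ → ℝ → ℝ) (C : NNReal) : Prop where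
  meas : Measurable (Function.uncurry κ)
  left : ∀ᵐ t ∂μ, ∫⁻ s, ‖κ t s‖ₑ ∂μ ≤ C
  right : ∀ᵐ s ∂μ, ∫⁻ t, ‖κ t s‖ₑ ∂μ ≤ C

/-- Cauchy–Schwarz with `a` as weight, from the splitting `a g = a^(1/2) · (a^(1/2) g)`. -/
lemma sq_lintegral_mul_le {Ω : Type*} [MeasurableSpace Ω] (μ : Measure Ω) {a g : Ω → ℝ≥0∞}
    (ha : AEMeasurable a μ) (hg : AEMeasurable g μ) :
    (∫⁻ x, a x * g x ∂μ) ^ 2 ≤ (∫⁻ x, a x ∂μ) * ∫⁻ x, a x * g x ^ 2 ∂μ := by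
  have h := ENNReal.lintegral_mul_le_Lp_mul_Lq μ Real.HolderConjugate.two_two
    (f := fun x => a x ^ (1 / 2 : ℝ)) (g := fun x => a x ^ (1 / 2 : ℝ) * g x)
    (ha.pow_const _) ((ha.pow_const _).mul hg)
  have e1 : ∀ x, a x ^ (1 / 2 : ℝ) * (a x ^ (1 / 2 : ℝ) * g x) = a x * g x := by
    intro x
    rw [← mul_assoc, ← ENNReal.rpow_add_of_nonneg _ _ (by norm_num) (by norm_num)]
    norm_num
  have e2 : ∀ x, (a x ^ (1 / 2 : ℝ)) ^ (2 : ℝ) = a x := by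
    intro x; rw [← ENNReal.rpow_mul]; norm_num
  have e3 : ∀ x, (a x ^ (1 / 2 : ℝ) * g x) ^ (2 : ℝ) = a x * g x ^ 2 := by
    intro x
    rw [ENNReal.mul_rpow_of_nonneg _ _ (by norm_num), e2, ENNReal.rpow_two]
  simp only [Pi.mul_apply, e1, e2, e3] at h
  calc (∫⁻ x, a x * g x ∂μ) ^ 2
      ≤ ((∫⁻ x, a x ∂μ) ^ (1 / 2 : ℝ) * (∫⁻ x, a x * g x ^ 2 ∂μ) ^ (1 / 2 : ℝ)) ^ 2 := by gcongr
    _ = _ := by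
      rw [mul_pow, ← ENNReal.rpow_two, ← ENNReal.rpow_two, ← ENNReal.rpow_mul, ← ENNReal.rpow_mul]
      norm_num

section Schur

set_option linter.unusedSectionVars false

variable {μ : Measure ℝ} [SFinite μ] {κ : ℝ → ℝ → ℝ} {C : NNReal}

lemma IsSchurKernel.swap (h : IsSchurKernel μ κ C) :
    IsSchurKernel μ (fun t s => κ s t) C :=
  ⟨h.meas.comp measurable_swap, h.right, h.left⟩

lemma IsSchurKernel.norm (h : IsSchurKernel μ κ C) :
    IsSchurKernel μ (fun t s => ‖κ t s‖) C :=
  ⟨h.meas.norm, by simpa using h.left, by simpa using h.right⟩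

/-- The Schur test: Cauchy–Schwarz weighted by `|κ t s|` uses the row bound, and Tonelli followed by
the column bound gives the second factor `C`. -/
lemma IsSchurKernel.lintegral_sq_le (h : IsSchurKernel μ κ C) {f : ℝ → ℝ}
    (hf : AEStronglyMeasurable f μ) :
    ∫⁻ t, (∫⁻ s, ‖κ t s‖ₑ * ‖f s‖ₑ ∂μ) ^ 2 ∂μ ≤ (C : ℝ≥0∞) ^ 2 * ∫⁻ s, ‖f s‖ₑ ^ 2 ∂μ := by
  have hm : ∀ t, AEMeasurable (fun s => ‖κ t s‖ₑ) μ := fun t =>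
    (h.meas.comp measurable_prodMk_left).enorm.aemeasurable
  have hm2 : AEMeasurable (fun p : ℝ × ℝ => ‖κ p.1 p.2‖ₑ * ‖f p.2‖ₑ ^ 2) (μ.prod μ) :=
    (Measurable.enorm h.meas).aemeasurable.mul
      ((hf.comp_snd.enorm).pow_const _)
  calc ∫⁻ t, (∫⁻ s, ‖κ t s‖ₑ * ‖f s‖ₑ ∂μ) ^ 2 ∂μ
      ≤ ∫⁻ t, C * ∫⁻ s, ‖κ t s‖ₑ * ‖f s‖ₑ ^ 2 ∂μ ∂μ := by
        refine lintegral_mono_ae ?_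
        filter_upwards [h.left] with t ht
        refine (sq_lintegral_mul_le μ (hm t) hf.enorm).trans ?_
        gcongr
    _ = C * ∫⁻ s, ∫⁻ t, ‖κ t s‖ₑ * ‖f s‖ₑ ^ 2 ∂μ ∂μ := by
        rw [lintegral_const_mul' _ _ ENNReal.coe_ne_top, lintegral_lintegral_swap hm2]
    _ ≤ C * ∫⁻ s, C * ‖f s‖ₑ ^ 2 ∂μ := by
        gcongr 1
        refine lintegral_mono_ae ?_
        filter_upwards [h.right] with s hs
        rw [lintegral_mul_const' _ _ (by simp)]
        gcongr
    _ = _ := by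
        rw [lintegral_const_mul' _ _ ENNReal.coe_ne_top, ← mul_assoc, sq]

lemma IsSchurKernel.aestronglyMeasurable_prod (h : IsSchurKernel μ κ C) {f : ℝ → ℝ}
    (hf : AEStronglyMeasurable f μ) :
    AEStronglyMeasurable (fun p : ℝ × ℝ => κ p.1 p.2 * f p.2) (μ.prod μ) :=
  (Measurable.aestronglyMeasurable h.meas).mul hf.comp_snd

lemma IsSchurKernel.aestronglyMeasurable (h : IsSchurKernel μ κ C) {f : ℝ → ℝ}
    (hf : AEStronglyMeasurable f μ) : AEStronglyMeasurable (kernelInt μ κ f) μ :=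
  (h.aestronglyMeasurable_prod hf).integral_prod_right'

lemma lintegral_enorm_sq_lt_top {f : ℝ → ℝ} (hf : MemLp f 2 μ) :
    ∫⁻ s, ‖f s‖ₑ ^ 2 ∂μ < ⊤ := by
  have := (eLpNorm_lt_top_iff_lintegral_rpow_enorm_lt_top (p := 2) (f := f) (μ := μ)
    (by norm_num) (by norm_num)).1 hf.2
  simpa using this

lemma IsSchurKernel.ae_integrable (h : IsSchurKernel μ κ C) {f : ℝ → ℝ} (hf : MemLp f 2 μ) :
    ∀ᵐ t ∂μ, Integrable (fun s => κ t s * f s) μ := by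
  have h1 := h.lintegral_sq_le hf.1
  have hfin := lintegral_enorm_sq_lt_top hf
  have h2 : ∫⁻ t, (∫⁻ s, ‖κ t s‖ₑ * ‖f s‖ₑ ∂μ) ^ 2 ∂μ ≠ ⊤ :=
    (h1.trans_lt (ENNReal.mul_lt_top (by simp) hfin)).ne
  have hm : AEMeasurable (fun t => (∫⁻ s, ‖κ t s‖ₑ * ‖f s‖ₑ ∂μ) ^ 2) μ := by
    have := (h.aestronglyMeasurable_prod hf.1).enorm.lintegral_prod_right'
    simp only [enorm_mul] at this
    exact this.pow_const _
  filter_upwards [ae_lt_top' hm h2] with t ht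
  refine ⟨((h.meas.comp measurable_prodMk_left).aestronglyMeasurable).mul hf.1, ?_⟩
  simp only [HasFiniteIntegral, enorm_mul]
  by_contra hc
  simp only [not_lt, top_le_iff] at hc
  rw [hc] at ht
  simp at ht

lemma IsSchurKernel.eLpNorm_le (h : IsSchurKernel μ κ C) {f : ℝ → ℝ}
    (hf : AEStronglyMeasurable f μ) :
    eLpNorm (kernelInt μ κ f) 2 μ ≤ C * eLpNorm f 2 μ := by
  have h1 := h.lintegral_sq_le hf
  have h2 : ∫⁻ t, ‖kernelInt μ κ f t‖ₑ ^ 2 ∂μ ≤ (C : ℝ≥0∞) ^ 2 * ∫⁻ s, ‖f s‖ₑ ^ 2 ∂μ := by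
    refine le_trans (lintegral_mono fun t => ?_) h1
    gcongr
    refine (enorm_integral_le_lintegral_enorm _).trans ?_
    simp only [enorm_mul, le_refl]
  rw [eLpNorm_eq_lintegral_rpow_enorm_toReal (by norm_num) (by norm_num),
    eLpNorm_eq_lintegral_rpow_enorm_toReal (by norm_num) (by norm_num)]
  simp only [ENNReal.toReal_ofNat, ENNReal.rpow_two]
  calc (∫⁻ t, ‖kernelInt μ κ f t‖ₑ ^ 2 ∂μ) ^ (1 / 2 : ℝ)
      ≤ ((C : ℝ≥0∞) ^ 2 * ∫⁻ s, ‖f s‖ₑ ^ 2 ∂μ) ^ (1 / 2 : ℝ) := by gcongr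
    _ = _ := by
      rw [ENNReal.mul_rpow_of_nonneg _ _ (by norm_num), ← ENNReal.rpow_two, ← ENNReal.rpow_mul]
      norm_num

lemma IsSchurKernel.memLp (h : IsSchurKernel μ κ C) {f : ℝ → ℝ} (hf : MemLp f 2 μ) :
    MemLp (kernelInt μ κ f) 2 μ :=
  ⟨h.aestronglyMeasurable hf.1,
    (h.eLpNorm_le hf.1).trans_lt (ENNReal.mul_lt_top ENNReal.coe_lt_top hf.2)⟩

lemma kernelInt_congr_ae {f g : ℝ → ℝ} (hfg : f =ᵐ[μ] g) (t : ℝ) :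
    kernelInt μ κ f t = kernelInt μ κ g t :=
  integral_congr_ae (by filter_upwards [hfg] with s hs; rw [hs])

/-- The bounded operator on `L²` given by a Schur kernel. -/
def IsSchurKernel.op (h : IsSchurKernel μ κ C) : Lp ℝ 2 μ →L[ℝ] Lp ℝ 2 μ :=
  LinearMap.mkContinuous
    { toFun := fun f => (h.memLp (Lp.memLp f)).toLp
      map_add' := fun f g => by
        rw [← MemLp.toLp_add]
        refine MemLp.toLp_congr _ _ ?_
        filter_upwards [h.ae_integrable (Lp.memLp f), h.ae_integrable (Lp.memLp g)] with t h1 h2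
        rw [kernelInt_congr_ae (Lp.coeFn_add f g)]
        simp only [kernelInt, Pi.add_apply, mul_add]
        exact integral_add h1 h2
      map_smul' := fun c f => by
        rw [RingHom.id_apply, ← MemLp.toLp_const_smul]
        refine MemLp.toLp_congr _ _ ?_
        refine Filter.Eventually.of_forall fun t => ?_
        rw [kernelInt_congr_ae (Lp.coeFn_smul c f)]
        simp only [kernelInt, Pi.smul_apply, smul_eq_mul, mul_left_comm _ c]
        exact integral_const_mul _ _ }
    C (fun f => by
      simp only [LinearMap.coe_mk, AddHom.coe_mk]
      rw [Lp.norm_toLp, Lp.norm_def]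
      have := ENNReal.toReal_mono (ENNReal.mul_ne_top ENNReal.coe_ne_top (Lp.eLpNorm_ne_top f))
        (h.eLpNorm_le (Lp.aestronglyMeasurable f))
      simpa using this)

lemma IsSchurKernel.op_coeFn (h : IsSchurKernel μ κ C) (f : Lp ℝ 2 μ) :
    h.op f =ᵐ[μ] kernelInt μ κ f :=
  (h.memLp (Lp.memLp f)).coeFn_toLp

lemma IsSchurKernel.integrable_bilinear (h : IsSchurKernel μ κ C) {f g : ℝ → ℝ}
    (hf : MemLp f 2 μ) (hg : MemLp g 2 μ) :
    Integrable (fun p : ℝ × ℝ => κ p.1 p.2 * f p.2 * g p.1) (μ.prod μ) := by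
  have hm : AEStronglyMeasurable (fun p : ℝ × ℝ => κ p.1 p.2 * f p.2 * g p.1) (μ.prod μ) :=
    (h.aestronglyMeasurable_prod hf.1).mul hg.1.comp_fst
  rw [integrable_prod_iff hm]
  constructor
  · filter_upwards [h.ae_integrable hf] with t ht
    exact ht.mul_const _
  · have : (fun t => ∫ s, ‖κ t s * f s * g t‖ ∂μ) =
        fun t => kernelInt μ (fun t s => ‖κ t s‖) (fun s => ‖f s‖) t * ‖g t‖ := by
      funext t
      simp only [norm_mul, kernelInt]
      exact integral_mul_const _ _
    rw [this]
    exact (h.norm.memLp hf.norm).integrable_mul hg.norm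

lemma IsSchurKernel.integral_kernelInt_mul (h : IsSchurKernel μ κ C) {f g : ℝ → ℝ}
    (hf : MemLp f 2 μ) (hg : MemLp g 2 μ) :
    ∫ t, kernelInt μ κ f t * g t ∂μ = ∫ s, f s * kernelInt μ (fun t s => κ s t) g s ∂μ := by
  have h1 := integral_integral_swap (f := fun t s => κ t s * f s * g t)
    (h.integrable_bilinear hf hg)
  have e1 : ∀ t, ∫ s, κ t s * f s * g t ∂μ = kernelInt μ κ f t * g t := fun t =>
    integral_mul_const _ _
  have e2 : ∀ s, ∫ t, κ t s * f s * g t ∂μ = f s * kernelInt μ (fun t s => κ s t) g s := by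
    intro s
    rw [kernelInt, ← integral_const_mul]
    refine integral_congr_ae (Filter.Eventually.of_forall fun t => ?_)
    simp only; ring
  simpa only [e1, e2] using h1

lemma IsSchurKernel.inner_op (h : IsSchurKernel μ κ C) (f g : Lp ℝ 2 μ) :
    inner ℝ (h.op f) g = inner ℝ f (h.swap.op g) := by
  rw [L2.inner_def, L2.inner_def]
  have e1 : ∫ t, inner ℝ (h.op f t) (g t) ∂μ = ∫ t, kernelInt μ κ f t * g t ∂μ := by
    refine integral_congr_ae ?_
    filter_upwards [h.op_coeFn f] with t ht
    rw [ht]; simp [mul_comm]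
  have e2 : ∫ t, inner ℝ (f t) (h.swap.op g t) ∂μ =
      ∫ s, f s * kernelInt μ (fun t s => κ s t) g s ∂μ := by
    refine integral_congr_ae ?_
    filter_upwards [h.swap.op_coeFn g] with t ht
    rw [ht]; simp [mul_comm]
  rw [e1, e2, h.integral_kernelInt_mul (Lp.memLp f) (Lp.memLp g)]

/-- Composition of two integral operators with nonnegative kernels, at a single point. -/
lemma kernelInt_comp {κ₁ κ₂ : ℝ → ℝ → ℝ} {κ₃ : ℝ → ℝ} (h₁ : Measurable (Function.uncurry κ₁))
    (h₂ : Measurable (Function.uncurry κ₂)) {f : ℝ → ℝ} (hf : AEStronglyMeasurable f μ) {t : ℝ}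
    (n₁ : ∀ s, 0 ≤ κ₁ t s) (n₂ : ∀ s r, 0 ≤ κ₂ s r)
    (hi : ∀ᵐ r ∂μ, Integrable (fun s => κ₁ t s * κ₂ s r) μ)
    (he : ∀ᵐ r ∂μ, ∫ s, κ₁ t s * κ₂ s r ∂μ = κ₃ r)
    (h₃ : Integrable (fun r => κ₃ r * f r) μ) :
    Integrable (fun p : ℝ × ℝ => κ₁ t p.1 * (κ₂ p.1 p.2 * f p.2)) (μ.prod μ) ∧
    kernelInt μ κ₁ (kernelInt μ κ₂ f) t = ∫ r, κ₃ r * f r ∂μ := by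
  have m1 : Measurable (κ₁ t) := h₁.comp measurable_prodMk_left
  have hm : AEStronglyMeasurable (fun p : ℝ × ℝ => κ₁ t p.1 * (κ₂ p.1 p.2 * f p.2))
      (μ.prod μ) :=
    (m1.comp measurable_fst).aestronglyMeasurable.mul
      ((Measurable.aestronglyMeasurable h₂).mul hf.comp_snd)
  have e0 : ∀ s r, κ₁ t s * (κ₂ s r * f r) = (κ₁ t s * κ₂ s r) * f r := fun s r => by ring
  have h_int : Integrable (fun p : ℝ × ℝ => κ₁ t p.1 * (κ₂ p.1 p.2 * f p.2)) (μ.prod μ) := by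
    rw [integrable_prod_iff' hm]
    constructor
    · filter_upwards [hi] with r hr
      simp only [e0]
      exact hr.mul_const _
    -- As the kernels are nonnegative, the absolute value falls on `f` alone, and the `s`-integral
    -- of the norm is `κ₃ r * |f r|`. Fubini's hypothesis thus reduces to `h₃`.
    · refine h₃.norm.congr ?_
      filter_upwards [he] with r hr
      simp only [e0, norm_mul (_ * _) (f r)]
      rw [integral_mul_const]
      have : ∀ s, ‖κ₁ t s * κ₂ s r‖ = κ₁ t s * κ₂ s r := fun s =>
        Real.norm_of_nonneg (mul_nonneg (n₁ s) (n₂ s r))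
      simp only [this, hr, norm_mul]
      rw [Real.norm_of_nonneg (r := κ₃ r)]
      rw [← hr]
      exact integral_nonneg fun s => mul_nonneg (n₁ s) (n₂ s r)
  refine ⟨h_int, ?_⟩
  have h1 := integral_integral_swap (f := fun s r => κ₁ t s * (κ₂ s r * f r)) h_int
  have e1 : ∀ s, ∫ r, κ₁ t s * (κ₂ s r * f r) ∂μ = κ₁ t s * kernelInt μ κ₂ f s := fun s =>
    integral_const_mul _ _
  simp only [e1] at h1
  refine h1.trans (integral_congr_ae ?_)
  filter_upwards [he] with r hr
  simp only [e0]
  rw [integral_mul_const, hr]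

end Schur

end FracBVP

namespace FracBVP

open MeasureTheory Set

/-! ### Riemann–Liouville integrals as bounded operators on `L²` -/

/-- The kernel of the left Riemann–Liouville integral. -/
def leftKernel (γ t s : ℝ) : ℝ := rlKernel γ (t - s)

/-- The kernel of the right Riemann–Liouville integral. -/
def rightKernel (γ t s : ℝ) : ℝ := rlKernel γ (s - t)

lemma measurable_leftKernel (γ : ℝ) : Measurable (Function.uncurry (leftKernel γ)) :=
  (measurable_rlKernel γ).comp (measurable_fst.sub measurable_snd)

lemma measurable_rightKernel (γ : ℝ) : Measurable (Function.uncurry (rightKernel γ)) :=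
  (measurable_rlKernel γ).comp (measurable_snd.sub measurable_fst)

lemma leftRL_eq_kernelInt {γ T t : ℝ} (hγ : 0 < γ) (ht : t ∈ Icc 0 T) (v : ℝ → ℝ) :
    leftRL γ 0 v t = kernelInt (volume.restrict (Icc 0 T)) (leftKernel γ) v t := by
  -- The endpoint `s = t` must be dropped: `rlKernel` vanishes at `0`, while the real power `0 ^ (γ
  -- - 1)` is `1` for `γ = 1`.
  rw [leftRL, if_neg hγ.ne', intervalIntegral.integral_of_le ht.1, kernelInt,
    ← setIntegral_congr_set Ico_ae_eq_Ioc, ← integral_const_mul]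
  rw [setIntegral_eq_of_subset_of_forall_sdiff_eq_zero (s := Ico 0 t) measurableSet_Icc]
  · refine setIntegral_congr_fun measurableSet_Ico fun s hs => ?_
    simp only [leftKernel]
    rw [rlKernel_of_pos (by linarith [hs.2])]
    ring
  · exact fun s hs => ⟨hs.1, hs.2.le.trans ht.2⟩
  · intro s hs
    have : t ≤ s := by
      by_contra h
      exact hs.2 ⟨hs.1.1, not_le.1 h⟩
    rw [leftKernel, rlKernel_of_nonpos (by linarith), zero_mul]

lemma rightRL_eq_kernelInt {γ T t : ℝ} (hγ : 0 < γ) (ht : t ∈ Icc 0 T) (v : ℝ → ℝ) :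
    rightRL γ T v t = kernelInt (volume.restrict (Icc 0 T)) (rightKernel γ) v t := by
  rw [rightRL, if_neg hγ.ne', intervalIntegral.integral_of_le ht.2, kernelInt,
    ← integral_const_mul]
  rw [setIntegral_eq_of_subset_of_forall_sdiff_eq_zero (s := Ioc t T) measurableSet_Icc]
  · refine setIntegral_congr_fun measurableSet_Ioc fun s hs => ?_
    simp only [rightKernel]
    rw [rlKernel_of_pos (by linarith [hs.1])]
    ring
  · exact fun s hs => ⟨ht.1.trans hs.1.le, hs.2⟩
  · intro s hs
    have : s ≤ t := by
      by_contra h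
      exact hs.2 ⟨not_le.1 h, hs.1.2⟩
    rw [rightKernel, rlKernel_of_nonpos (by linarith), zero_mul]

/-- The integrand lives between `r` and `t`, both in `[0, T]`, so the semigroup identity survives
restriction to the interval. -/
lemma rlKernel_integral_restrict {γ δ T t r : ℝ} (hγ : 0 < γ) (hδ : 0 < δ) (ht : t ∈ Icc 0 T)
    (hr : r ∈ Icc 0 T) :
    Integrable (fun s => rlKernel γ (t - s) * rlKernel δ (s - r)) (volume.restrict (Icc 0 T)) ∧
      ∫ s in Icc 0 T, rlKernel γ (t - s) * rlKernel δ (s - r) = rlKernel (γ + δ) (t - r) := by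
  obtain ⟨h1, h2⟩ := rlKernel_semigroup hγ hδ t r
  refine ⟨h1.integrableOn, ?_⟩
  rw [setIntegral_eq_integral_of_forall_compl_eq_zero, h2]
  intro s hs
  rcases lt_or_ge s 0 with h | h
  · rw [rlKernel_of_nonpos (γ := δ) (by linarith [hr.1]), mul_zero]
  · have : T < s := by
      by_contra h'
      exact hs ⟨h, not_lt.1 h'⟩
    rw [rlKernel_of_nonpos (γ := γ) (by linarith [ht.2]), zero_mul]

/-- `rlKernel 1` is the indicator of the positive half-line, so this is the semigroup identity with
`δ = 1` and `r = 0`. -/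
lemma integrable_rlKernel_left {γ T t : ℝ} (hγ : 0 < γ) (ht : t ∈ Icc 0 T) :
    Integrable (fun s => rlKernel γ (t - s)) (volume.restrict (Icc 0 T)) ∧
      ∫ s in Icc 0 T, rlKernel γ (t - s) = rlKernel (γ + 1) t := by
  have h := rlKernel_integral_restrict (T := T) (t := t) (r := 0) hγ one_pos ht
    ⟨le_rfl, ht.1.trans ht.2⟩
  have e : (fun s => rlKernel γ (t - s) * rlKernel 1 (s - 0)) =ᵐ[volume.restrict (Icc 0 T)]
      fun s => rlKernel γ (t - s) := by
    rw [← restrict_Ioc_eq_restrict_Icc]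
    refine ae_restrict_of_forall_mem measurableSet_Ioc fun s hs => ?_
    have : 0 < s - 0 := by linarith [hs.1]
    simp only [rlKernel_one_of_pos this, mul_one]
  rw [integral_congr_ae e, sub_zero] at h
  exact ⟨h.1.congr e, h.2⟩

lemma integrable_rlKernel_right {γ T s : ℝ} (hγ : 0 < γ) (hs : s ∈ Icc 0 T) :
    Integrable (fun t => rlKernel γ (t - s)) (volume.restrict (Icc 0 T)) ∧
      ∫ t in Icc 0 T, rlKernel γ (t - s) = rlKernel (γ + 1) (T - s) := by
  have h := rlKernel_integral_restrict (T := T) (t := T) (r := s) one_pos hγ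
    ⟨hs.1.trans hs.2, le_rfl⟩ hs
  have e : (fun t => rlKernel 1 (T - t) * rlKernel γ (t - s)) =ᵐ[volume.restrict (Icc 0 T)]
      fun t => rlKernel γ (t - s) := by
    rw [← restrict_Ico_eq_restrict_Icc]
    refine ae_restrict_of_forall_mem measurableSet_Ico fun t ht => ?_
    have : 0 < T - t := by linarith [ht.2]
    simp only [rlKernel_one_of_pos this, one_mul]
  rw [integral_congr_ae e, add_comm 1 γ] at h
  exact ⟨h.1.congr e, h.2⟩

lemma rlKernel_mono {γ x y : ℝ} (hγ : 1 ≤ γ) (hxy : x ≤ y) : rlKernel γ x ≤ rlKernel γ y := by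
  rcases le_or_gt x 0 with h | h
  · rw [rlKernel_of_nonpos h]
    exact rlKernel_nonneg (by linarith) _
  · rw [rlKernel_of_pos h, rlKernel_of_pos (h.trans_le hxy)]
    have := Real.Gamma_pos_of_pos (s := γ) (by linarith)
    gcongr

lemma lintegral_enorm_eq_of_nonneg {μ : Measure ℝ} {g : ℝ → ℝ} (hg : Integrable g μ)
    (h0 : ∀ x, 0 ≤ g x) : ∫⁻ x, ‖g x‖ₑ ∂μ = ENNReal.ofReal (∫ x, g x ∂μ) := by
  rw [ofReal_integral_eq_lintegral_ofReal hg (Filter.Eventually.of_forall h0)]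
  refine lintegral_congr fun x => ?_
  rw [Real.enorm_eq_ofReal (h0 x)]

lemma isSchurKernel_left {γ : ℝ} (hγ : 0 < γ) (T : ℝ) :
    IsSchurKernel (volume.restrict (Icc 0 T)) (leftKernel γ) (rlKernel (γ + 1) T).toNNReal where
  meas := measurable_leftKernel γ
  left := by
    refine ae_restrict_of_forall_mem measurableSet_Icc fun t ht => ?_
    obtain ⟨h1, h2⟩ := integrable_rlKernel_left hγ ht
    simp only [leftKernel]
    rw [lintegral_enorm_eq_of_nonneg h1 fun s => rlKernel_nonneg hγ _, h2]
    exact ENNReal.ofReal_le_ofReal (rlKernel_mono (by linarith) ht.2)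
  right := by
    refine ae_restrict_of_forall_mem measurableSet_Icc fun t ht => ?_
    obtain ⟨h1, h2⟩ := integrable_rlKernel_right hγ ht
    simp only [leftKernel]
    rw [lintegral_enorm_eq_of_nonneg h1 fun s => rlKernel_nonneg hγ _, h2]
    exact ENNReal.ofReal_le_ofReal (rlKernel_mono (by linarith) (by linarith [ht.1]))

lemma isSchurKernel_right {γ : ℝ} (hγ : 0 < γ) (T : ℝ) :
    IsSchurKernel (volume.restrict (Icc 0 T)) (rightKernel γ) (rlKernel (γ + 1) T).toNNReal :=
  (isSchurKernel_left hγ T).swap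

open Classical in
/-- The left Riemann–Liouville integral on `L²([0, T])`. -/
def leftOp (γ T : ℝ) : L2 T →L[ℝ] L2 T :=
  if h : 0 < γ then (isSchurKernel_left h T).op else ContinuousLinearMap.id ℝ _

open Classical in
/-- The right Riemann–Liouville integral on `L²([0, T])`. -/
def rightOp (γ T : ℝ) : L2 T →L[ℝ] L2 T :=
  if h : 0 < γ then (isSchurKernel_right h T).op else ContinuousLinearMap.id ℝ _

lemma leftOp_zero (T : ℝ) : leftOp 0 T = ContinuousLinearMap.id ℝ _ := dif_neg (lt_irrefl _)

lemma rightOp_zero (T : ℝ) : rightOp 0 T = ContinuousLinearMap.id ℝ _ := dif_neg (lt_irrefl _)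

lemma leftOp_coeFn {γ T : ℝ} (hγ : 0 ≤ γ) (v : L2 T) :
    leftOp γ T v =ᵐ[volume.restrict (Icc 0 T)] leftRL γ 0 v := by
  rcases hγ.eq_or_lt with rfl | h
  · rw [leftOp_zero]
    exact Filter.Eventually.of_forall fun t => by simp [leftRL]
  · rw [leftOp, dif_pos h]
    filter_upwards [(isSchurKernel_left h T).op_coeFn v,
      ae_restrict_mem measurableSet_Icc] with t ht ht2
    rw [ht, leftRL_eq_kernelInt h ht2]

lemma rightOp_coeFn {γ T : ℝ} (hγ : 0 ≤ γ) (v : L2 T) :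
    rightOp γ T v =ᵐ[volume.restrict (Icc 0 T)] rightRL γ T v := by
  rcases hγ.eq_or_lt with rfl | h
  · rw [rightOp_zero]
    exact Filter.Eventually.of_forall fun t => by simp [rightRL]
  · rw [rightOp, dif_pos h]
    filter_upwards [(isSchurKernel_right h T).op_coeFn v,
      ae_restrict_mem measurableSet_Icc] with t ht ht2
    rw [ht, rightRL_eq_kernelInt h ht2]

lemma leftRL_congr_ae {γ T : ℝ} (hγ : 0 ≤ γ) {v w : ℝ → ℝ}
    (h : v =ᵐ[volume.restrict (Icc 0 T)] w) :
    leftRL γ 0 v =ᵐ[volume.restrict (Icc 0 T)] leftRL γ 0 w := by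
  rcases hγ.eq_or_lt with rfl | h0
  · simpa [leftRL, Filter.EventuallyEq] using h
  · filter_upwards [ae_restrict_mem measurableSet_Icc] with t ht
    rw [leftRL_eq_kernelInt h0 ht, leftRL_eq_kernelInt h0 ht, kernelInt_congr_ae h]

lemma rightRL_congr_ae {γ T : ℝ} (hγ : 0 ≤ γ) {v w : ℝ → ℝ}
    (h : v =ᵐ[volume.restrict (Icc 0 T)] w) :
    rightRL γ T v =ᵐ[volume.restrict (Icc 0 T)] rightRL γ T w := by
  rcases hγ.eq_or_lt with rfl | h0
  · simpa [rightRL, Filter.EventuallyEq] using h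
  · filter_upwards [ae_restrict_mem measurableSet_Icc] with t ht
    rw [rightRL_eq_kernelInt h0 ht, rightRL_eq_kernelInt h0 ht, kernelInt_congr_ae h]

/-- Fractional integration by parts: the left and right kernels are transposes of each other. -/
lemma inner_leftOp (γ T : ℝ) (v w : L2 T) :
    inner ℝ (leftOp γ T v) w = inner ℝ v (rightOp γ T w) := by
  by_cases h : 0 < γ
  · rw [leftOp, dif_pos h, rightOp, dif_pos h]
    exact (isSchurKernel_left h T).inner_op v w
  · rw [leftOp, dif_neg h, rightOp, dif_neg h]
    rfl

lemma leftRL_comp {γ δ T t : ℝ} (hγ : 0 < γ) (hδ : 0 < δ) (ht : t ∈ Icc 0 T) {v : ℝ → ℝ}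
    (hv : AEStronglyMeasurable v (volume.restrict (Icc 0 T)))
    (hi : Integrable (fun s => rlKernel (γ + δ) (t - s) * v s) (volume.restrict (Icc 0 T))) :
    leftRL γ 0 (leftRL δ 0 v) t = ∫ s in Icc 0 T, rlKernel (γ + δ) (t - s) * v s := by
  rw [leftRL_eq_kernelInt hγ ht, kernelInt_congr_ae
    (g := kernelInt (volume.restrict (Icc 0 T)) (leftKernel δ) v)
    (ae_restrict_of_forall_mem measurableSet_Icc fun s hs => leftRL_eq_kernelInt hδ hs v)]
  exact (kernelInt_comp (measurable_leftKernel γ) (measurable_leftKernel δ) hv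
    (fun s => rlKernel_nonneg hγ _) (fun s r => rlKernel_nonneg hδ _)
    (ae_restrict_of_forall_mem measurableSet_Icc fun r hr =>
      (rlKernel_integral_restrict hγ hδ ht hr).1)
    (ae_restrict_of_forall_mem measurableSet_Icc fun r hr =>
      (rlKernel_integral_restrict hγ hδ ht hr).2) hi).2

lemma rightRL_comp {γ δ T t : ℝ} (hγ : 0 < γ) (hδ : 0 < δ) (ht : t ∈ Icc 0 T) {v : ℝ → ℝ}
    (hv : AEStronglyMeasurable v (volume.restrict (Icc 0 T)))
    (hi : Integrable (fun s => rlKernel (γ + δ) (s - t) * v s) (volume.restrict (Icc 0 T))) :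
    rightRL γ T (rightRL δ T v) t = ∫ s in Icc 0 T, rlKernel (γ + δ) (s - t) * v s := by
  rw [rightRL_eq_kernelInt hγ ht, kernelInt_congr_ae
    (g := kernelInt (volume.restrict (Icc 0 T)) (rightKernel δ) v)
    (ae_restrict_of_forall_mem measurableSet_Icc fun s hs => rightRL_eq_kernelInt hδ hs v)]
  refine (kernelInt_comp (κ₃ := fun s => rlKernel (γ + δ) (s - t)) (measurable_rightKernel γ)
    (measurable_rightKernel δ) hv
    (fun s => rlKernel_nonneg hγ _) (fun s r => rlKernel_nonneg hδ _)
    (ae_restrict_of_forall_mem measurableSet_Icc fun r hr => ?_)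
    (ae_restrict_of_forall_mem measurableSet_Icc fun r hr => ?_) hi).2
  · have := (rlKernel_integral_restrict hδ hγ hr ht).1
    simpa only [rightKernel, mul_comm] using this
  · have := (rlKernel_integral_restrict hδ hγ hr ht).2
    simpa only [rightKernel, mul_comm, add_comm γ δ] using this

lemma memLp_two_integrable {T : ℝ} {v : ℝ → ℝ} (hv : MemLp v 2 (volume.restrict (Icc 0 T))) :
    Integrable v (volume.restrict (Icc 0 T)) :=
  hv.integrable (by norm_num)

lemma integrable_rlKernel_one_mul {T : ℝ} {v : ℝ → ℝ} {φ : ℝ → ℝ} (hφ : Measurable φ)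
    (hv : Integrable v (volume.restrict (Icc 0 T))) :
    Integrable (fun s => rlKernel 1 (φ s) * v s) (volume.restrict (Icc 0 T)) := by
  refine hv.bdd_mul (c := 1) ((measurable_rlKernel 1).comp hφ).aestronglyMeasurable
    (Filter.Eventually.of_forall fun s => ?_)
  rcases le_or_gt (φ s) 0 with h | h
  · simp [rlKernel_of_nonpos h]
  · simp [rlKernel_one_of_pos h]

lemma leftOp_comp {γ δ T : ℝ} (hγ : 0 ≤ γ) (hδ : 0 ≤ δ) (h1 : γ + δ = 1) (v : L2 T) :
    leftOp γ T (leftOp δ T v) = leftOp 1 T v := by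
  rcases hγ.eq_or_lt with rfl | hγ'
  · rw [leftOp_zero, ← h1, zero_add]; rfl
  rcases hδ.eq_or_lt with rfl | hδ'
  · rw [leftOp_zero, ← h1, add_zero]; rfl
  refine Lp.ext ?_
  filter_upwards [leftOp_coeFn hγ (leftOp δ T v), leftRL_congr_ae hγ (leftOp_coeFn hδ v),
    leftOp_coeFn zero_le_one v, ae_restrict_mem measurableSet_Icc] with t e1 e2 e3 ht
  rw [e1, e2, e3, leftRL_comp hγ' hδ' ht (Lp.aestronglyMeasurable v), h1,
    leftRL_eq_kernelInt one_pos ht]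
  · rfl
  · rw [h1]
    exact integrable_rlKernel_one_mul (by fun_prop) (memLp_two_integrable (Lp.memLp v))

lemma rightOp_comp {γ δ T : ℝ} (hγ : 0 ≤ γ) (hδ : 0 ≤ δ) (h1 : γ + δ = 1) (v : L2 T) :
    rightOp γ T (rightOp δ T v) = rightOp 1 T v := by
  rcases hγ.eq_or_lt with rfl | hγ'
  · rw [rightOp_zero, ← h1, zero_add]; rfl
  rcases hδ.eq_or_lt with rfl | hδ'
  · rw [rightOp_zero, ← h1, add_zero]; rfl
  refine Lp.ext ?_
  filter_upwards [rightOp_coeFn hγ (rightOp δ T v), rightRL_congr_ae hγ (rightOp_coeFn hδ v),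
    rightOp_coeFn zero_le_one v, ae_restrict_mem measurableSet_Icc] with t e1 e2 e3 ht
  rw [e1, e2, e3, rightRL_comp hγ' hδ' ht (Lp.aestronglyMeasurable v), h1,
    rightRL_eq_kernelInt one_pos ht]
  · rfl
  · rw [h1]
    exact integrable_rlKernel_one_mul (by fun_prop) (memLp_two_integrable (Lp.memLp v))

lemma leftRL_one (u : ℝ → ℝ) (t : ℝ) : leftRL 1 0 u t = ∫ s in (0 : ℝ)..t, u s := by
  simp [leftRL]

lemma rightRL_one (T : ℝ) (u : ℝ → ℝ) (t : ℝ) : rightRL 1 T u t = ∫ s in t..T, u s := by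
  simp [rightRL]

lemma intervalIntegrable_of_restrict_Icc {T : ℝ} {v : ℝ → ℝ}
    (hv : Integrable v (volume.restrict (Icc 0 T))) {a b : ℝ} (ha : a ∈ Icc 0 T)
    (hb : b ∈ Icc 0 T) : IntervalIntegrable v volume a b := by
  rw [intervalIntegrable_iff]
  refine IntegrableOn.mono_set (show IntegrableOn v (Icc 0 T) volume from hv) ?_
  exact uIoc_subset_uIcc.trans (Set.ordConnected_Icc.uIcc_subset ha hb)

/-- A primitive that vanishes almost everywhere vanishes identically by continuity, and Lebesgue
differentiation recovers its density. -/
lemma rightOp_one_injective {T : ℝ} (hT : 0 < T) {z : L2 T} (hz : rightOp 1 T z = 0) : z = 0 := by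
  have hi := memLp_two_integrable (Lp.memLp z)
  have h0 : (fun t => ∫ s in T..t, z s) =ᵐ[volume.restrict (Icc 0 T)] fun _ => 0 := by
    have h1 := rightOp_coeFn zero_le_one z
    rw [hz] at h1
    filter_upwards [h1, Lp.coeFn_zero ℝ 2 (volume.restrict (Icc 0 T))] with t e1 e2
    rw [intervalIntegral.integral_symm, ← rightRL_one, ← e1, e2]
    simp
  have hT1 : (0 : ℝ) ∈ Icc 0 T := ⟨le_rfl, hT.le⟩
  have hT2 : T ∈ Icc 0 T := ⟨hT.le, le_rfl⟩
  have hc : ContinuousOn (fun t => ∫ s in T..t, z s) (Icc 0 T) := by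
    have := intervalIntegral.continuousOn_primitive_interval' (a := T) (μ := volume)
      (intervalIntegrable_of_restrict_Icc hi hT1 hT2) (by simp)
    rwa [uIcc_of_le hT.le] at this
  have h2 : EqOn (fun t => ∫ s in T..t, z s) (fun _ => 0) (Icc 0 T) :=
    Measure.eqOn_Icc_of_ae_eq volume hT.ne h0 hc continuousOn_const
  refine Lp.ext ?_
  have h3 := (intervalIntegrable_of_restrict_Icc hi hT1 hT2).ae_hasDerivAt_integral
  rw [uIcc_of_le hT.le] at h3
  have h4 : ∀ᵐ t ∂volume.restrict (Icc 0 T), t ∈ Ioo 0 T := by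
    rw [← restrict_Ioo_eq_restrict_Icc]
    exact ae_restrict_mem measurableSet_Ioo
  filter_upwards [ae_restrict_of_ae h3, h4, Lp.coeFn_zero ℝ 2 (volume.restrict (Icc 0 T))]
    with t h3 h4 h5
  have h6 := h3 ⟨h4.1.le, h4.2.le⟩ T hT2
  have h7 : (fun x => ∫ s in T..x, z s) =ᶠ[nhds t] fun _ => 0 := by
    filter_upwards [Ioo_mem_nhds h4.1 h4.2] with x hx
    exact h2 ⟨hx.1.le, hx.2.le⟩
  rw [h5]
  exact (h6.congr_of_eventuallyEq h7.symm).unique (hasDerivAt_const t 0)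

/-- Completing the order to `1` by composing with the integral of order `1 - α` reduces to the
ordinary primitive. -/
lemma rightOp_injective {α T : ℝ} (hT : 0 < T) (h0 : 0 ≤ α) (h1 : α ≤ 1) {z : L2 T}
    (hz : rightOp α T z = 0) : z = 0 := by
  refine rightOp_one_injective hT ?_
  rw [← rightOp_comp (γ := 1 - α) (δ := α) (by linarith) h0 (by ring), hz, map_zero]

end FracBVP

namespace FracBVP

open MeasureTheory Set

/-! ### Coercivity of the quadratic form -/

lemma ae_ne_prod (μ : Measure ℝ) [SFinite μ] [NullSingletonClass μ] :
    ∀ᵐ p ∂(μ.prod μ), (p : ℝ × ℝ).1 ≠ p.2 := by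
  have h : (μ.prod μ) {p : ℝ × ℝ | p.1 = p.2} = 0 := by
    rw [Measure.measure_prod_null (measurableSet_eq_fun measurable_fst measurable_snd)]
    refine Filter.Eventually.of_forall fun x => ?_
    have : Prod.mk x ⁻¹' {p : ℝ × ℝ | p.1 = p.2} = {x} := by
      ext y; simp [eq_comm]
    simp [this]
  rw [ae_iff]
  simpa using h

/-- The variable `t` runs over the whole line while the density is integrated against `μ`. Fubini
turns the product of two potentials into a double integral against their correlation kernel `c`.
Correlations are only asked for off the diagonal, where they may diverge; the diagonal is a null
set. -/
lemma integral_kernelInt_mul_kernelInt {μ : Measure ℝ} [SFinite μ] [NullSingletonClass μ]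
    {κ₁ κ₂ c : ℝ → ℝ → ℝ} {v : ℝ → ℝ} (m₁ : Measurable (Function.uncurry κ₁))
    (m₂ : Measurable (Function.uncurry κ₂)) (n₁ : ∀ t s, 0 ≤ κ₁ t s) (n₂ : ∀ t s, 0 ≤ κ₂ t s)
    (hv : AEStronglyMeasurable v μ)
    (hi : ∀ s r, s ≠ r → Integrable (fun t => κ₁ t s * κ₂ t r) ∧
      ∫ t, κ₁ t s * κ₂ t r = c s r)
    (hc : Integrable (fun p : ℝ × ℝ => c p.1 p.2 * (v p.1 * v p.2)) (μ.prod μ)) :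
    Integrable (fun t => kernelInt μ κ₁ v t * kernelInt μ κ₂ v t) ∧
      ∫ t, kernelInt μ κ₁ v t * kernelInt μ κ₂ v t =
        ∫ p : ℝ × ℝ, c p.1 p.2 * (v p.1 * v p.2) ∂(μ.prod μ) := by
  set G : ℝ × (ℝ × ℝ) → ℝ := fun q => κ₁ q.1 q.2.1 * κ₂ q.1 q.2.2 * (v q.2.1 * v q.2.2) with hG
  have hGm : AEStronglyMeasurable G (volume.prod (μ.prod μ)) := by
    refine AEStronglyMeasurable.mul (Measurable.aestronglyMeasurable ?_) ?_
    · exact (m₁.comp (measurable_fst.prodMk (measurable_fst.comp measurable_snd))).mul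
        (m₂.comp (measurable_fst.prodMk (measurable_snd.comp measurable_snd)))
    · exact (hv.comp_fst.mul hv.comp_snd).comp_snd
  have hGi : Integrable G (volume.prod (μ.prod μ)) := by
    rw [integrable_prod_iff' hGm]
    constructor
    · filter_upwards [ae_ne_prod μ] with p hp
      exact (hi p.1 p.2 hp).1.mul_const (v p.1 * v p.2)
    · refine hc.norm.congr ?_
      filter_upwards [ae_ne_prod μ] with p hp
      simp only [hG, norm_mul _ (v p.1 * v p.2)]
      rw [integral_mul_const]
      have : ∀ t, ‖κ₁ t p.1 * κ₂ t p.2‖ = κ₁ t p.1 * κ₂ t p.2 := fun t =>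
        Real.norm_of_nonneg (mul_nonneg (n₁ _ _) (n₂ _ _))
      simp only [this, (hi p.1 p.2 hp).2]
      rw [Real.norm_of_nonneg (r := c p.1 p.2)]
      rw [← (hi p.1 p.2 hp).2]
      exact integral_nonneg fun t => mul_nonneg (n₁ _ _) (n₂ _ _)
  have e1 : ∀ t, ∫ p, G (t, p) ∂(μ.prod μ) = kernelInt μ κ₁ v t * kernelInt μ κ₂ v t := by
    intro t
    rw [kernelInt, kernelInt, ← integral_prod_mul]
    refine integral_congr_ae (Filter.Eventually.of_forall fun p => ?_)
    simp only [hG]; ring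
  have e2 : ∀ᵐ p ∂(μ.prod μ), ∫ t, G (t, p) = c p.1 p.2 * (v p.1 * v p.2) := by
    filter_upwards [ae_ne_prod μ] with p hp
    simp only [hG]
    rw [integral_mul_const, (hi p.1 p.2 hp).2]
  constructor
  · simpa only [e1] using hGi.integral_prod_left
  · have := integral_integral_swap (f := fun t p => G (t, p)) hGi
    simp only [e1] at this
    rw [this, integral_congr_ae e2]

lemma rlKernel_add_swap {γ s r : ℝ} (hγ : 0 < γ) (h : s ≠ r) :
    Real.Gamma γ * (rlKernel γ (s - r) + rlKernel γ (r - s)) = |s - r| ^ (γ - 1) := by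
  have hG := Real.Gamma_pos_of_pos hγ
  rcases lt_or_gt_of_ne h with h | h
  · rw [rlKernel_of_nonpos (x := s - r) (by linarith), rlKernel_of_pos (x := r - s) (by linarith),
      abs_sub_comm, abs_of_pos (by linarith)]
    field_simp
    simp
  · rw [rlKernel_of_nonpos (x := r - s) (by linarith), rlKernel_of_pos (x := s - r) (by linarith),
      abs_of_pos (by linarith)]
    field_simp
    simp

/-- `N` is the squared norm of a potential of `v` over the whole line. Left and right potentials
have the same autocorrelation, a multiple of `|s - r|^(2β-1)`, and their cross-correlation
symmetrises to a multiple of the same kernel; `tailConst_mul_cos` compares the multiples. -/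
lemma fractional_energy_identity {β T : ℝ} (h0 : 0 < β) (h1 : β < 1 / 2) (v : L2 T) :
    ∃ N : ℝ, Real.cos (Real.pi * β) * N = inner ℝ (leftOp β T v) (rightOp β T v) ∧
      ‖leftOp β T v‖ ^ 2 ≤ N ∧ ‖rightOp β T v‖ ^ 2 ≤ N := by
  set ν : Measure ℝ := volume.restrict (Icc 0 T) with hν
  set Lf := kernelInt ν (leftKernel β) v with hLf
  set Rf := kernelInt ν (rightKernel β) v with hRf
  have hv := Lp.aestronglyMeasurable v
  have h2 : (0 : ℝ) < 2 * β := by linarith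
  have hq := (isSchurKernel_left h2 T).integrable_bilinear (Lp.memLp v) (Lp.memLp v)
  have hq' := (isSchurKernel_right h2 T).integrable_bilinear (Lp.memLp v) (Lp.memLp v)
  have hsw : ∫ p : ℝ × ℝ, leftKernel (2 * β) p.1 p.2 * v p.2 * v p.1 ∂(ν.prod ν) =
      ∫ p : ℝ × ℝ, rightKernel (2 * β) p.1 p.2 * v p.2 * v p.1 ∂(ν.prod ν) := by
    rw [← integral_prod_swap]
    refine integral_congr_ae (Filter.Eventually.of_forall fun p => ?_)
    simp only [Prod.fst_swap, Prod.snd_swap, leftKernel, rightKernel]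
    ring
  set q := ∫ p : ℝ × ℝ, rightKernel (2 * β) p.1 p.2 * v p.2 * v p.1 ∂(ν.prod ν) with hqdef
  set A := tailConst β * Real.Gamma (2 * β) with hA
  -- the cross term
  have hcross := integral_kernelInt_mul_kernelInt (μ := ν) (κ₁ := leftKernel β)
    (κ₂ := rightKernel β) (c := rightKernel (2 * β)) (measurable_leftKernel β)
    (measurable_rightKernel β)
    (fun _ _ => rlKernel_nonneg h0 _) (fun _ _ => rlKernel_nonneg h0 _) hv
    (fun s r _ => by
      have := rlKernel_semigroup h0 h0 r s
      rw [← two_mul] at this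
      simpa only [leftKernel, rightKernel, mul_comm] using this)
    (hq'.congr (Filter.Eventually.of_forall fun p => by simp only; ring))
  have hc1 : ∫ p : ℝ × ℝ, rightKernel (2 * β) p.1 p.2 * (v p.1 * v p.2) ∂(ν.prod ν) = q := by
    refine integral_congr_ae (Filter.Eventually.of_forall fun p => by simp only; ring)
  -- the diagonal terms
  have hci : Integrable (fun p : ℝ × ℝ => (A * (leftKernel (2 * β) p.1 p.2 +
      rightKernel (2 * β) p.1 p.2)) * (v p.1 * v p.2)) (ν.prod ν) :=
    ((hq.add hq').const_mul A).congr (Filter.Eventually.of_forall fun p => by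
      simp only [Pi.add_apply]; ring)
  have hc2 : ∫ p : ℝ × ℝ, (A * (leftKernel (2 * β) p.1 p.2 +
      rightKernel (2 * β) p.1 p.2)) * (v p.1 * v p.2) ∂(ν.prod ν) = 2 * A * q := by
    have : ∀ p : ℝ × ℝ, (A * (leftKernel (2 * β) p.1 p.2 +
      rightKernel (2 * β) p.1 p.2)) * (v p.1 * v p.2) =
      A * (leftKernel (2 * β) p.1 p.2 * v p.2 * v p.1 +
        rightKernel (2 * β) p.1 p.2 * v p.2 * v p.1) := fun p => by ring
    simp only [this]
    rw [integral_const_mul, integral_add hq hq', hsw]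
    ring
  have hcor : ∀ s r, s ≠ r → tailConst β * |s - r| ^ (2 * β - 1) =
      A * (leftKernel (2 * β) s r + rightKernel (2 * β) s r) := fun s r h => by
    rw [← rlKernel_add_swap h2 h, hA, leftKernel, rightKernel]; ring
  have hL := integral_kernelInt_mul_kernelInt (μ := ν) (κ₁ := leftKernel β) (κ₂ := leftKernel β)
    (c := fun s r => A * (leftKernel (2 * β) s r + rightKernel (2 * β) s r))
    (measurable_leftKernel β) (measurable_leftKernel β)
    (fun _ _ => rlKernel_nonneg h0 _) (fun _ _ => rlKernel_nonneg h0 _) hv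
    (fun s r h => by
      rw [← hcor s r h]
      exact rlKernel_correlation h0 h1 h) hci
  have hR := integral_kernelInt_mul_kernelInt (μ := ν) (κ₁ := rightKernel β) (κ₂ := rightKernel β)
    (c := fun s r => A * (leftKernel (2 * β) s r + rightKernel (2 * β) s r))
    (measurable_rightKernel β) (measurable_rightKernel β)
    (fun _ _ => rlKernel_nonneg h0 _) (fun _ _ => rlKernel_nonneg h0 _) hv
    (fun s r h => by
      rw [← hcor s r h]
      exact rlKernel_correlation_right h0 h1 h) hci
  rw [hc2] at hL hR
  rw [hc1] at hcross
  have eL : leftOp β T v =ᵐ[ν] Lf := by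
    rw [leftOp, dif_pos h0]; exact (isSchurKernel_left h0 T).op_coeFn v
  have eR : rightOp β T v =ᵐ[ν] Rf := by
    rw [rightOp, dif_pos h0]; exact (isSchurKernel_right h0 T).op_coeFn v
  refine ⟨2 * A * q, ?_, ?_, ?_⟩
  · have hin : inner ℝ (leftOp β T v) (rightOp β T v) = ∫ t in Icc 0 T, Lf t * Rf t := by
      rw [L2.inner_def]
      refine integral_congr_ae ?_
      filter_upwards [eL, eR] with t e1 e2
      rw [e1, e2]; simp [mul_comm]
    -- The left potential vanishes for `t < 0` and the right one for `t > T`, so the cross integral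
    -- over the line loses nothing. The squares do have tails outside `[0, T]`, hence only
    -- inequalities for them.
    rw [hin, setIntegral_eq_integral_of_forall_compl_eq_zero, hcross.2, hA]
    · linear_combination q * tailConst_mul_cos h0 h1
    · intro t ht
      rcases lt_or_ge t 0 with h | h
      · have : Lf t = 0 := by
          refine integral_eq_zero_of_ae (ae_restrict_of_forall_mem measurableSet_Icc fun s hs => ?_)
          simp [leftKernel, rlKernel_of_nonpos (x := t - s) (by linarith [hs.1])]
        rw [this, zero_mul]
      · have hT : T < t := by
          by_contra h'
          exact ht ⟨h, not_lt.1 h'⟩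
        have : Rf t = 0 := by
          refine integral_eq_zero_of_ae (ae_restrict_of_forall_mem measurableSet_Icc fun s hs => ?_)
          simp [rightKernel, rlKernel_of_nonpos (x := s - t) (by linarith [hs.2])]
        rw [this, mul_zero]
  · rw [← hL.2, ← real_inner_self_eq_norm_sq, L2.inner_def]
    have : ∫ t, inner ℝ (leftOp β T v t) (leftOp β T v t) ∂ν = ∫ t in Icc 0 T, Lf t * Lf t := by
      refine integral_congr_ae ?_
      filter_upwards [eL] with t e1
      rw [e1]; simp [sq]
    rw [this]
    exact setIntegral_le_integral hL.1 (Filter.Eventually.of_forall fun t => mul_self_nonneg _)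
  · rw [← hR.2, ← real_inner_self_eq_norm_sq, L2.inner_def]
    have : ∫ t, inner ℝ (rightOp β T v t) (rightOp β T v t) ∂ν = ∫ t in Icc 0 T, Rf t * Rf t := by
      refine integral_congr_ae ?_
      filter_upwards [eR] with t e1
      rw [e1]; simp [sq]
    rw [this]
    exact setIntegral_le_integral hR.1 (Filter.Eventually.of_forall fun t => mul_self_nonneg _)

lemma cos_pi_mul_pos {β : ℝ} (h0 : 0 ≤ β) (h1 : β < 1 / 2) : 0 < Real.cos (Real.pi * β) :=
  Real.cos_pos_of_mem_Ioo ⟨by nlinarith [Real.pi_pos], by nlinarith [Real.pi_pos]⟩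

lemma fractional_energy_identity' {β T : ℝ} (h0 : 0 ≤ β) (h1 : β < 1 / 2) (v : L2 T) :
    ∃ N : ℝ, Real.cos (Real.pi * β) * N = inner ℝ (leftOp β T v) (rightOp β T v) ∧
      ‖leftOp β T v‖ ^ 2 ≤ N ∧ ‖rightOp β T v‖ ^ 2 ≤ N := by
  rcases h0.eq_or_lt with rfl | h
  · refine ⟨‖v‖ ^ 2, ?_, ?_, ?_⟩ <;> simp [leftOp_zero, rightOp_zero]
  · exact fractional_energy_identity h h1 v

lemma cos_mul_sq_norm_leftOp_le {β T : ℝ} (h0 : 0 ≤ β) (h1 : β < 1 / 2) (v : L2 T) :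
    Real.cos (Real.pi * β) * ‖leftOp β T v‖ ^ 2 ≤ inner ℝ (leftOp β T v) (rightOp β T v) := by
  obtain ⟨N, e, hL, -⟩ := fractional_energy_identity' h0 h1 v
  rw [← e]
  exact mul_le_mul_of_nonneg_left hL (cos_pi_mul_pos h0 h1).le

/-- Cauchy–Schwarz in the energy identity. It lets the left derivative control the right one, so
that a closure taken in the left norm carries the right derivative along. -/
lemma cos_mul_norm_rightOp_le {β T : ℝ} (h0 : 0 ≤ β) (h1 : β < 1 / 2) (v : L2 T) :
    Real.cos (Real.pi * β) * ‖rightOp β T v‖ ≤ ‖leftOp β T v‖ := by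
  obtain ⟨N, e, -, hR⟩ := fractional_energy_identity' h0 h1 v
  have hc := cos_pi_mul_pos h0 h1
  rcases (norm_nonneg (rightOp β T v)).eq_or_lt with h | h
  · rw [← h, mul_zero]; exact norm_nonneg _
  · have h3 := real_inner_le_norm (leftOp β T v) (rightOp β T v)
    have h4 : Real.cos (Real.pi * β) * ‖rightOp β T v‖ ^ 2 ≤
        ‖leftOp β T v‖ * ‖rightOp β T v‖ := by
      refine le_trans ?_ h3
      rw [← e]
      exact mul_le_mul_of_nonneg_left hR hc.le
    rw [sq, ← mul_assoc] at h4
    exact le_of_mul_le_mul_right h4 h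

end FracBVP

namespace FracBVP

open MeasureTheory Set

/-! ### Smooth functions and the closures of the graphs -/

lemma ae_mem_Ioo (T : ℝ) : ∀ᵐ t ∂volume.restrict (Icc 0 T), t ∈ Ioo 0 T := by
  rw [← restrict_Ioo_eq_restrict_Icc]
  exact ae_restrict_mem measurableSet_Ioo

/-- Smoothness is only assumed on the closed interval, so the two-sided `deriv` is meaningful in the
interior; the endpoints are null. -/
lemma smoothZero_deriv_eq {T : ℝ} {φ : ℝ → ℝ} :
    deriv φ =ᵐ[volume.restrict (Icc 0 T)] derivWithin φ (Icc 0 T) := by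
  filter_upwards [ae_mem_Ioo T] with t ht
  exact (derivWithin_of_mem_nhds (Icc_mem_nhds ht.1 ht.2)).symm

lemma smoothZero_continuousOn_derivWithin {T : ℝ} (hT : 0 < T) {φ : ℝ → ℝ}
    (hφ : φ ∈ smoothZero T) : ContinuousOn (derivWithin φ (Icc 0 T)) (Icc 0 T) :=
  hφ.1.continuousOn_derivWithin (uniqueDiffOn_Icc hT) (by simp)

lemma memLp_of_continuousOn {T : ℝ} {g : ℝ → ℝ} (hg : ContinuousOn g (Icc 0 T)) (p : ℝ≥0∞) :
    MemLp g p (volume.restrict (Icc 0 T)) := by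
  obtain ⟨C, hC⟩ := isCompact_Icc.exists_bound_of_continuousOn hg
  exact MemLp.of_bound (hg.aestronglyMeasurable measurableSet_Icc) C
    (ae_restrict_of_forall_mem measurableSet_Icc hC)

lemma smoothZero_memLp_deriv {T : ℝ} (hT : 0 < T) {φ : ℝ → ℝ} (hφ : φ ∈ smoothZero T) :
    MemLp (deriv φ) 2 (volume.restrict (Icc 0 T)) :=
  (memLp_of_continuousOn (smoothZero_continuousOn_derivWithin hT hφ) 2).ae_eq
    smoothZero_deriv_eq.symm

lemma smoothZero_differentiableAt {T : ℝ} {φ : ℝ → ℝ} (hφ : φ ∈ smoothZero T) {t : ℝ}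
    (ht : t ∈ Ioo 0 T) : DifferentiableAt ℝ φ t :=
  ((hφ.1.differentiableOn (by simp)) t ⟨ht.1.le, ht.2.le⟩).differentiableAt
    (Icc_mem_nhds ht.1 ht.2)

lemma smoothZero_integral_deriv {T : ℝ} (hT : 0 < T) {φ : ℝ → ℝ} (hφ : φ ∈ smoothZero T) {t : ℝ}
    (ht : t ∈ Icc 0 T) : ∫ s in (0 : ℝ)..t, deriv φ s = φ t := by
  have hsub : Icc 0 t ⊆ Icc 0 T := Icc_subset_Icc_right ht.2
  rw [intervalIntegral.integral_eq_sub_of_hasDerivAt_of_le ht.1 (hφ.1.continuousOn.mono hsub)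
    (fun x hx => (smoothZero_differentiableAt hφ ⟨hx.1, hx.2.trans_le ht.2⟩).hasDerivAt)
    (intervalIntegrable_of_restrict_Icc (memLp_two_integrable (smoothZero_memLp_deriv hT hφ))
      ⟨le_rfl, hT.le⟩ ht), hφ.2.1, sub_zero]

/-- The constant function `1` in `L²([0, T])`. -/
def oneL2 (T : ℝ) : L2 T := (memLp_const (1 : ℝ)).toLp

lemma oneL2_coeFn (T : ℝ) : oneL2 T =ᵐ[volume.restrict (Icc 0 T)] fun _ => (1 : ℝ) :=
  MemLp.coeFn_toLp _

lemma inner_oneL2 {T : ℝ} (v : L2 T) : inner ℝ (oneL2 T) v = ∫ t in Icc 0 T, v t := by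
  rw [L2.inner_def]
  refine integral_congr_ae ?_
  filter_upwards [oneL2_coeFn T] with t ht
  rw [ht]; simp

/-- The classes in `L²([0, T])` of the derivatives of functions in `C₀^∞([0, T])`. -/
def smoothDeriv (T : ℝ) : Submodule ℝ (L2 T) where
  carrier := {v | ∃ φ ∈ smoothZero T, v =ᵐ[volume.restrict (Icc 0 T)] deriv φ}
  add_mem' := by
    rintro v w ⟨φ, hφ, hv⟩ ⟨ψ, hψ, hw⟩
    refine ⟨φ + ψ, ⟨hφ.1.add hψ.1, by simp [hφ.2.1, hψ.2.1], by simp [hφ.2.2, hψ.2.2]⟩, ?_⟩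
    filter_upwards [hv, hw, Lp.coeFn_add v w, ae_mem_Ioo T] with t h1 h2 h3 h4
    rw [h3, Pi.add_apply, h1, h2, deriv_add (smoothZero_differentiableAt hφ h4)
      (smoothZero_differentiableAt hψ h4)]
  zero_mem' := by
    refine ⟨0, ⟨contDiffOn_const, rfl, rfl⟩, ?_⟩
    filter_upwards [Lp.coeFn_zero ℝ 2 (volume.restrict (Icc 0 T))] with t h
    rw [h]; simp
  smul_mem' := by
    rintro c v ⟨φ, hφ, hv⟩
    refine ⟨c • φ, ⟨hφ.1.const_smul c, by simp [hφ.2.1], by simp [hφ.2.2]⟩, ?_⟩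
    filter_upwards [hv, Lp.coeFn_smul c v, ae_mem_Ioo T] with t h1 h3 h4
    rw [h3, Pi.smul_apply, h1, deriv_const_smul c (smoothZero_differentiableAt hφ h4)]

lemma integral_Icc_smoothDeriv {T : ℝ} (hT : 0 < T) {v : L2 T} (hv : v ∈ smoothDeriv T) :
    ∫ t in Icc 0 T, v t = 0 := by
  obtain ⟨φ, hφ, hv⟩ := hv
  rw [integral_congr_ae hv, integral_Icc_eq_integral_Ioc,
    ← intervalIntegral.integral_of_le hT.le, smoothZero_integral_deriv hT hφ ⟨hT.le, le_rfl⟩,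
    hφ.2.2]

lemma rightOp_one_eq_neg {T : ℝ} (hT : 0 < T) {v : L2 T} (hv : ∫ t in Icc 0 T, v t = 0) :
    rightOp 1 T v = -leftOp 1 T v := by
  refine Lp.ext ?_
  have hi := memLp_two_integrable (Lp.memLp v)
  filter_upwards [rightOp_coeFn zero_le_one v, leftOp_coeFn zero_le_one v,
    Lp.coeFn_neg (leftOp 1 T v), ae_restrict_mem measurableSet_Icc] with t h1 h2 h3 ht
  rw [h1, h3, Pi.neg_apply, h2, leftRL_one, rightRL_one]
  have h4 := intervalIntegral.integral_add_adjacent_intervals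
    (intervalIntegrable_of_restrict_Icc hi ⟨le_rfl, hT.le⟩ ht)
    (intervalIntegrable_of_restrict_Icc hi ht ⟨hT.le, le_rfl⟩)
  rw [intervalIntegral.integral_of_le hT.le, ← integral_Icc_eq_integral_Ioc, hv] at h4
  linarith

lemma leftOp_one_smooth {T : ℝ} (hT : 0 < T) {v : L2 T} {φ : ℝ → ℝ} (hφ : φ ∈ smoothZero T)
    (hv : v =ᵐ[volume.restrict (Icc 0 T)] deriv φ) :
    leftOp 1 T v =ᵐ[volume.restrict (Icc 0 T)] φ := by
  filter_upwards [leftOp_coeFn zero_le_one v, leftRL_congr_ae zero_le_one hv,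
    ae_restrict_mem measurableSet_Icc] with t h1 h2 ht
  rw [h1, h2, leftRL_one, smoothZero_integral_deriv hT hφ ht]

lemma exists_smoothDeriv {T : ℝ} (hT : 0 < T) {φ : ℝ → ℝ} (hφ : φ ∈ smoothZero T) :
    ∃ v ∈ smoothDeriv T, v =ᵐ[volume.restrict (Icc 0 T)] deriv φ :=
  ⟨(smoothZero_memLp_deriv hT hφ).toLp, ⟨φ, hφ, MemLp.coeFn_toLp _⟩, MemLp.coeFn_toLp _⟩

lemma leftOp_smooth {α T : ℝ} (h1 : α ≤ 1) {v : L2 T} {φ : ℝ → ℝ}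
    (hv : v =ᵐ[volume.restrict (Icc 0 T)] deriv φ) :
    leftOp (1 - α) T v =ᵐ[volume.restrict (Icc 0 T)] leftCaputo α 0 φ :=
  (leftOp_coeFn (by linarith) v).trans (leftRL_congr_ae (by linarith) hv)

lemma rightOp_smooth {α T : ℝ} (h1 : α ≤ 1) {v : L2 T} {φ : ℝ → ℝ}
    (hv : v =ᵐ[volume.restrict (Icc 0 T)] deriv φ) :
    (-rightOp (1 - α) T v : L2 T) =ᵐ[volume.restrict (Icc 0 T)] rightCaputo α T φ := by
  filter_upwards [Lp.coeFn_neg (rightOp (1 - α) T v), rightOp_coeFn (γ := 1 - α) (by linarith) v,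
    rightRL_congr_ae (γ := 1 - α) (by linarith) hv] with t e1 e2 e3
  rw [e1, Pi.neg_apply, e2, e3, rightCaputo]

/-- Since `φ 0 = 0`, a test function is the primitive of `φ'`, and the graph is a linear image of
the derivatives. -/
lemma mem_leftGraph_iff {α T : ℝ} (hT : 0 < T) (h1 : α ≤ 1) {p : WithLp 2 (L2 T × L2 T)} :
    p ∈ leftGraph α T ↔
      ∃ v ∈ smoothDeriv T, p = WithLp.toLp 2 (leftOp 1 T v, leftOp (1 - α) T v) := by
  constructor
  · rintro ⟨φ, hφ, e1, e2⟩
    obtain ⟨v, hv, hv'⟩ := exists_smoothDeriv hT hφ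
    refine ⟨v, hv, ?_⟩
    have f1 : p.fst = leftOp 1 T v := Lp.ext (e1.trans (leftOp_one_smooth hT hφ hv').symm)
    have f2 : p.snd = leftOp (1 - α) T v := Lp.ext (e2.trans (leftOp_smooth h1 hv').symm)
    rw [← f1, ← f2]; rfl
  · rintro ⟨v, ⟨φ, hφ, hv⟩, rfl⟩
    exact ⟨φ, hφ, leftOp_one_smooth hT hφ hv, leftOp_smooth h1 hv⟩

lemma mem_rightGraph_iff {α T : ℝ} (hT : 0 < T) (h1 : α ≤ 1) {p : WithLp 2 (L2 T × L2 T)} :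
    p ∈ rightGraph α T ↔
      ∃ v ∈ smoothDeriv T, p = WithLp.toLp 2 (leftOp 1 T v, -rightOp (1 - α) T v) := by
  constructor
  · rintro ⟨φ, hφ, e1, e2⟩
    obtain ⟨v, hv, hv'⟩ := exists_smoothDeriv hT hφ
    refine ⟨v, hv, ?_⟩
    have f1 : p.fst = leftOp 1 T v := Lp.ext (e1.trans (leftOp_one_smooth hT hφ hv').symm)
    have f2 : p.snd = -rightOp (1 - α) T v := Lp.ext (e2.trans (rightOp_smooth h1 hv').symm)
    rw [← f1, ← f2]; rfl
  · rintro ⟨v, ⟨φ, hφ, hv⟩, rfl⟩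
    exact ⟨φ, hφ, leftOp_one_smooth hT hφ hv, rightOp_smooth h1 hv⟩

/-- The map `v ↦ (L v, R v)` with `L`, `R` the Riemann–Liouville integrals of order `1 - α`. -/
def pairMap (α T : ℝ) : L2 T →ₗ[ℝ] WithLp 2 (L2 T × L2 T) where
  toFun v := WithLp.toLp 2 (leftOp (1 - α) T v, rightOp (1 - α) T v)
  map_add' v w := by simp only [map_add]; rfl
  map_smul' c v := by simp only [map_smul]; rfl

lemma continuous_pairMap (α T : ℝ) : Continuous (pairMap α T) := by
  change Continuous fun v => WithLp.toLp 2 (leftOp (1 - α) T v, rightOp (1 - α) T v)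
  fun_prop

/-- The closure of the pairs `(L φ', R φ')`, `φ ∈ C₀^∞([0, T])`: the pairs formed by the left
Caputo derivative and the negative of the right one, on `E₀^α`. -/
def derivPairs (α T : ℝ) : Submodule ℝ (WithLp 2 (L2 T × L2 T)) :=
  ((smoothDeriv T).map (pairMap α T)).topologicalClosure

lemma isClosed_derivPairs (α T : ℝ) : IsClosed (derivPairs α T : Set (WithLp 2 (L2 T × L2 T))) :=
  Submodule.isClosed_topologicalClosure _

lemma pairMap_mem_derivPairs {α T : ℝ} {v : L2 T} (hv : v ∈ smoothDeriv T) :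
    pairMap α T v ∈ derivPairs α T :=
  Submodule.le_topologicalClosure _ (Submodule.mem_map_of_mem hv)

lemma derivPairs_induction {α T : ℝ} {P : WithLp 2 (L2 T × L2 T) → Prop}
    (hP : IsClosed {y | P y}) (h : ∀ v ∈ smoothDeriv T, P (pairMap α T v))
    {y : WithLp 2 (L2 T × L2 T)} (hy : y ∈ derivPairs α T) : P y := by
  have : y ∈ closure ((smoothDeriv T).map (pairMap α T) : Set (WithLp 2 (L2 T × L2 T))) := hy
  refine hP.closure_subset_iff.2 ?_ this
  rintro _ ⟨v, hv, rfl⟩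
  exact h v hv

section Exponent

variable {α T : ℝ}

lemma cos_mul_sq_norm_le_of_mem_derivPairs (h0 : 1 / 2 < α) (h1 : α ≤ 1)
    {y : WithLp 2 (L2 T × L2 T)} (hy : y ∈ derivPairs α T) :
    Real.cos (Real.pi * (1 - α)) * ‖y.fst‖ ^ 2 ≤ inner ℝ y.fst y.snd := by
  refine derivPairs_induction
    (P := fun y => Real.cos (Real.pi * (1 - α)) * ‖y.fst‖ ^ 2 ≤ inner ℝ y.fst y.snd)
    (isClosed_le (by fun_prop) (by fun_prop)) (fun v hv => ?_) hy
  exact cos_mul_sq_norm_leftOp_le (by linarith) (by linarith) v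

lemma cos_mul_norm_snd_le_of_mem_derivPairs (h0 : 1 / 2 < α) (h1 : α ≤ 1)
    {y : WithLp 2 (L2 T × L2 T)} (hy : y ∈ derivPairs α T) :
    Real.cos (Real.pi * (1 - α)) * ‖y.snd‖ ≤ ‖y.fst‖ := by
  refine derivPairs_induction
    (P := fun y => Real.cos (Real.pi * (1 - α)) * ‖y.snd‖ ≤ ‖y.fst‖)
    (isClosed_le (by fun_prop) (by fun_prop)) (fun v hv => ?_) hy
  exact cos_mul_norm_rightOp_le (by linarith) (by linarith) v

/-- The element of `E₀^α` with Caputo derivatives `y.fst` and `-y.snd`. -/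
def toSpace (α T : ℝ) (y : WithLp 2 (L2 T × L2 T)) : WithLp 2 (L2 T × L2 T) :=
  WithLp.toLp 2 (leftOp α T y.fst, y.fst)

lemma continuous_toSpace : Continuous (toSpace α T) := by
  unfold toSpace; fun_prop

lemma toSpace_pairMap (h0 : 0 ≤ α) (h1 : α ≤ 1) (v : L2 T) :
    toSpace α T (pairMap α T v) = WithLp.toLp 2 (leftOp 1 T v, leftOp (1 - α) T v) := by
  change WithLp.toLp 2 (leftOp α T (leftOp (1 - α) T v), leftOp (1 - α) T v) = _
  rw [leftOp_comp h0 (by linarith) (by ring)]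

lemma toSpace_mem_E0 (hT : 0 < T) (h0 : 0 ≤ α) (h1 : α ≤ 1)
    {y : WithLp 2 (L2 T × L2 T)} (hy : y ∈ derivPairs α T) : toSpace α T y ∈ E0 α T := by
  refine derivPairs_induction (P := fun y => toSpace α T y ∈ E0 α T)
    (isClosed_closure.preimage continuous_toSpace) (fun v hv => ?_) hy
  rw [toSpace_pairMap h0 h1]
  exact subset_closure ((mem_leftGraph_iff hT h1).2 ⟨v, hv, rfl⟩)

/-- Convergence of the left derivatives makes the right ones Cauchy, by `cos_mul_norm_rightOp_le`
applied to differences. The limit pair lies in `derivPairs`, so nothing of `E₀^α` escapes the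
parametrisation. -/
lemma exists_derivPairs_of_mem_E0 (hT : 0 < T) (h0 : 1 / 2 < α) (h1 : α ≤ 1)
    {e : WithLp 2 (L2 T × L2 T)} (he : e ∈ E0 α T) :
    ∃ y ∈ derivPairs α T, e = toSpace α T y := by
  obtain ⟨p, hp, hlim⟩ := mem_closure_iff_seq_limit.1 he
  choose v hv hpv using fun n => (mem_leftGraph_iff hT h1).1 (hp n)
  have hc := cos_pi_mul_pos (β := 1 - α) (by linarith) (by linarith)
  have hsnd : Filter.Tendsto (fun n => leftOp (1 - α) T (v n)) Filter.atTop (nhds e.snd) := by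
    have := ((WithLp.continuous_snd 2 (L2 T) (L2 T)).tendsto e).comp hlim
    refine this.congr fun n => ?_
    rw [Function.comp, hpv n]
    rfl
  have hcs : CauchySeq (fun n => rightOp (1 - α) T (v n)) := by
    rw [Metric.cauchySeq_iff']
    intro ε hε
    obtain ⟨N, hN⟩ := Metric.cauchySeq_iff'.1 hsnd.cauchySeq
      (Real.cos (Real.pi * (1 - α)) * ε) (by positivity)
    refine ⟨N, fun n hn => ?_⟩
    have h2 := hN n hn
    rw [dist_eq_norm, ← map_sub] at h2 ⊢
    have h3 := cos_mul_norm_rightOp_le (β := 1 - α) (by linarith) (by linarith) (v n - v N)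
    exact lt_of_mul_lt_mul_left (h3.trans_lt h2) hc.le
  obtain ⟨z, hz⟩ := cauchySeq_tendsto_of_complete hcs
  have hy : Filter.Tendsto (fun n => pairMap α T (v n)) Filter.atTop
      (nhds (WithLp.toLp 2 (e.snd, z))) :=
    ((WithLp.prod_continuous_toLp 2 (L2 T) (L2 T)).tendsto (e.snd, z)).comp
      (hsnd.prodMk_nhds hz)
  refine ⟨WithLp.toLp 2 (e.snd, z), (isClosed_derivPairs α T).mem_of_tendsto hy
    (Filter.Eventually.of_forall fun n => pairMap_mem_derivPairs (hv n)), ?_⟩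
  refine tendsto_nhds_unique hlim (((continuous_toSpace (α := α).tendsto _).comp hy).congr
    fun n => ?_)
  rw [Function.comp, toSpace_pairMap (by linarith) h1, hpv n]

/-- On smooth functions `φ` is the right integral of order `α` of its right Caputo derivative, and
this relation is closed. As that integral is injective, the closed graph is single-valued and
`Classical.epsilon` has no choice. -/
lemma rightCaputoL2_toSpace (hT : 0 < T) (h0 : 0 ≤ α) (h1 : α ≤ 1)
    {y : WithLp 2 (L2 T × L2 T)} (hy : y ∈ derivPairs α T) :
    rightCaputoL2 α T (leftOp α T y.fst) = -y.snd := by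
  have hex : WithLp.toLp 2 (leftOp α T y.fst, -y.snd) ∈ closure (rightGraph α T) := by
    refine derivPairs_induction
      (P := fun y => WithLp.toLp 2 (leftOp α T y.fst, -y.snd) ∈ closure (rightGraph α T))
      (isClosed_closure.preimage (by fun_prop)) (fun v hv => ?_) hy
    refine subset_closure ((mem_rightGraph_iff hT h1).2 ⟨v, hv, ?_⟩)
    change WithLp.toLp 2 (leftOp α T (leftOp (1 - α) T v), -rightOp (1 - α) T v) = _
    rw [leftOp_comp h0 (by linarith) (by ring)]
  have hu : ∀ p ∈ closure (rightGraph α T), p.fst = rightOp α T p.snd := by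
    intro p hp
    refine (isClosed_eq (f := fun p : WithLp 2 (L2 T × L2 T) => p.fst)
      (g := fun p => rightOp α T p.snd) (by fun_prop) (by fun_prop)).closure_subset_iff.2 ?_ hp
    intro p hp
    obtain ⟨v, hv, rfl⟩ := (mem_rightGraph_iff hT h1).1 hp
    change leftOp 1 T v = rightOp α T (-rightOp (1 - α) T v)
    rw [map_neg, rightOp_comp h0 (by linarith) (by ring),
      rightOp_one_eq_neg hT (integral_Icc_smoothDeriv hT hv), neg_neg]
  have hs : WithLp.toLp 2 (leftOp α T y.fst, rightCaputoL2 α T (leftOp α T y.fst)) ∈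
      closure (rightGraph α T) :=
    Classical.epsilon_spec (p := fun w : L2 T => WithLp.toLp 2 (leftOp α T y.fst, w) ∈
      closure (rightGraph α T)) ⟨_, hex⟩
  have e1 : leftOp α T y.fst = rightOp α T (rightCaputoL2 α T (leftOp α T y.fst)) := hu _ hs
  have e2 : leftOp α T y.fst = rightOp α T (-y.snd) := hu _ hex
  rw [← sub_eq_zero]
  refine rightOp_injective hT h0 h1 ?_
  rw [map_sub, ← e1, ← e2, sub_self]

lemma Phi_toSpace (hT : 0 < T) (h0 : 0 ≤ α) (h1 : α ≤ 1)
    {y : WithLp 2 (L2 T × L2 T)} (hy : y ∈ derivPairs α T) :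
    Phi α T (toSpace α T y) = inner ℝ y.fst y.snd := by
  have e := rightCaputoL2_toSpace hT h0 h1 hy
  rw [Phi, L2.inner_def, ← integral_neg]
  refine integral_congr_ae ?_
  filter_upwards [Lp.coeFn_neg y.snd] with t ht
  change -(y.fst t * rightCaputoL2 α T (leftOp α T y.fst) t) = _
  rw [e, ht]
  simp [mul_comm]

end Exponent

/-! ### Density of smooth derivatives among functions of zero mean -/

/-- Bounded continuous functions are dense in `L²`, and Weierstrass approximation is uniform on an
interval of finite measure. -/
lemma dense_polynomials (T : ℝ) :
    Dense {w : L2 T | ∃ p : Polynomial ℝ, w =ᵐ[volume.restrict (Icc 0 T)] fun t => p.eval t} := by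
  set D : Set (L2 T) :=
    {w : L2 T | ∃ p : Polynomial ℝ, w =ᵐ[volume.restrict (Icc 0 T)] fun t => p.eval t}
  have hd := Lp.boundedContinuousFunction_dense ℝ (volume.restrict (Icc 0 T)) (p := 2)
    (by norm_num)
  rw [← dense_closure]
  refine hd.mono ?_
  intro g hg
  obtain ⟨g₀, hg₀⟩ := (Lp.mem_boundedContinuousFunction_iff).1 hg
  have hgae : g =ᵐ[volume.restrict (Icc 0 T)] g₀ := by
    have := ContinuousMap.coeFn_toAEEqFun (volume.restrict (Icc 0 T)) g₀.toContinuousMap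
    rw [hg₀] at this
    exact this
  rw [Metric.mem_closure_iff]
  intro ε hε
  set K : ℝ := (measureUnivNNReal (volume.restrict (Icc (0 : ℝ) T)) : ℝ) ^ (2 : ℝ≥0∞).toReal⁻¹
  have hK : 0 ≤ K := by positivity
  -- The `+ 1` avoids division by `K`, which is zero when the interval is null.
  obtain ⟨p, hp⟩ := exists_polynomial_near_of_continuousOn 0 T g₀ g₀.continuous.continuousOn
    (ε / (K + 1)) (by positivity)
  have hpm := memLp_of_continuousOn (T := T) (g := fun t => p.eval t)
    p.continuous.continuousOn 2
  refine ⟨hpm.toLp, ⟨p, hpm.coeFn_toLp⟩, ?_⟩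
  rw [dist_eq_norm]
  have := Lp.norm_le_of_ae_bound (f := g - hpm.toLp) (C := ε / (K + 1)) (by positivity) (by
    filter_upwards [Lp.coeFn_sub g hpm.toLp, hpm.coeFn_toLp, hgae,
      ae_restrict_mem measurableSet_Icc] with t e1 e2 e3 ht
    rw [e1, Pi.sub_apply, e2, e3, Real.norm_eq_abs, abs_sub_comm]
    exact (hp t ht).le)
  refine this.trans_lt ?_
  change K * (ε / (K + 1)) < ε
  rw [mul_div_assoc', div_lt_iff₀ (by positivity)]
  nlinarith

/-- The primitive from `0` of a polynomial minus its mean also vanishes at `T`. -/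
lemma polynomial_sub_mean_mem_smoothDeriv {T : ℝ} (hT : 0 < T) {w : L2 T} {p : Polynomial ℝ}
    (hw : w =ᵐ[volume.restrict (Icc 0 T)] fun t => p.eval t) :
    w - ((1 / T) * inner ℝ (oneL2 T) w) • oneL2 T ∈ smoothDeriv T := by
  set m := (1 / T) * inner ℝ (oneL2 T) w with hm
  set q : Polynomial ℝ := p - Polynomial.C m with hq
  have hqc : Continuous fun t => q.eval t := q.continuous
  have hd : ∀ t, HasDerivAt (fun x => ∫ s in (0 : ℝ)..x, q.eval s) (q.eval t) t := fun t =>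
    intervalIntegral.integral_hasDerivAt_right (hqc.intervalIntegrable _ _)
      (hqc.stronglyMeasurableAtFilter _ _) hqc.continuousAt
  have hderiv : deriv (fun x => ∫ s in (0 : ℝ)..x, q.eval s) = fun t => q.eval t :=
    funext fun t => (hd t).deriv
  refine ⟨fun x => ∫ s in (0 : ℝ)..x, q.eval s, ⟨ContDiff.contDiffOn ?_, by simp, ?_⟩, ?_⟩
  · rw [contDiff_infty_iff_deriv, hderiv]
    exact ⟨fun t => (hd t).differentiableAt, by simpa using q.contDiff_aeval (𝕜 := ℝ) (n := ∞)⟩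
  · rw [inner_oneL2, integral_congr_ae hw, integral_Icc_eq_integral_Ioc,
      ← intervalIntegral.integral_of_le hT.le] at hm
    simp only [hq, Polynomial.eval_sub, Polynomial.eval_C]
    rw [intervalIntegral.integral_sub (p.continuous.intervalIntegrable _ _) (by simp)]
    simp only [intervalIntegral.integral_const, sub_zero, smul_eq_mul]
    rw [hm]
    field_simp
    ring
  · rw [hderiv]
    filter_upwards [hw, Lp.coeFn_sub w (m • oneL2 T), Lp.coeFn_smul m (oneL2 T), oneL2_coeFn T]
      with t e1 e2 e3 e4
    rw [e2, Pi.sub_apply, e3, Pi.smul_apply, e4, e1]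
    simp [hq]

/-- Subtracting the mean is continuous, sends the dense polynomials into `smoothDeriv T`, and fixes
`v`. -/
lemma mem_closure_smoothDeriv {T : ℝ} (hT : 0 < T) {v : L2 T} (hv : ∫ t in Icc 0 T, v t = 0) :
    v ∈ closure (smoothDeriv T : Set (L2 T)) := by
  have h := map_mem_closure (f := fun w : L2 T => w - ((1 / T) * inner ℝ (oneL2 T) w) • oneL2 T)
    (by fun_prop) (dense_polynomials T v) (t := (smoothDeriv T : Set (L2 T)))
    (fun w ⟨p, hp⟩ => polynomial_sub_mean_mem_smoothDeriv hT hp)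
  simpa [inner_oneL2, hv] using h

lemma pairMap_mem_derivPairs_of_integral_eq_zero {α T : ℝ} (hT : 0 < T) {v : L2 T}
    (hv : ∫ t in Icc 0 T, v t = 0) : pairMap α T v ∈ derivPairs α T :=
  map_mem_closure (s := (smoothDeriv T : Set (L2 T)))
    (t := ((smoothDeriv T).map (pairMap α T) : Set (WithLp 2 (L2 T × L2 T))))
    (continuous_pairMap α T) (mem_closure_smoothDeriv hT hv)
    (fun _ hw => Submodule.mem_map_of_mem hw)

end FracBVP

namespace FracBVP

open MeasureTheory Set

/-! ### Weak sequential compactness -/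

-- Sequential Banach–Alaoglu for a separable space, transported through the Riesz isomorphism.
open Filter Topology in
lemma exists_weakly_convergent_subseq {H : Type*} [NormedAddCommGroup H] [InnerProductSpace ℝ H]
    [CompleteSpace H] [TopologicalSpace.SeparableSpace H] {y : ℕ → H} {R : ℝ}
    (hy : ∀ n, ‖y n‖ ≤ R) :
    ∃ x : H, ∃ φ : ℕ → ℕ, StrictMono φ ∧
      ∀ z, Tendsto (fun n => inner ℝ (y (φ n)) z) atTop (𝓝 (inner ℝ x z)) := by
  have hc := WeakDual.isSeqCompact_closedBall ℝ H 0 R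
  set x : ℕ → WeakDual ℝ H := fun n => StrongDual.toWeakDual (InnerProductSpace.toDual ℝ H (y n))
    with hx
  obtain ⟨ℓ, -, φ, hφ, hlim⟩ := hc (x := x) (fun n => by
    simp only [hx, mem_preimage, mem_closedBall_zero_iff]
    change ‖InnerProductSpace.toDual ℝ H (y n)‖ ≤ R
    rw [LinearIsometryEquiv.norm_map]
    exact hy n)
  refine ⟨(InnerProductSpace.toDual ℝ H).symm (WeakDual.toStrongDual ℓ), φ, hφ, fun z => ?_⟩
  rw [InnerProductSpace.toDual_symm_apply]
  have := ((WeakDual.eval_continuous (𝕜 := ℝ) z).tendsto ℓ).comp hlim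
  exact this

-- A closed subspace is its own double orthogonal, and orthogonality to a fixed vector passes to
-- weak limits.
open Filter Topology in
lemma mem_of_weak_limit {H : Type*} [NormedAddCommGroup H] [InnerProductSpace ℝ H]
    [CompleteSpace H] {K : Submodule ℝ H} (hK : IsClosed (K : Set H)) {y : ℕ → H} {x : H}
    (hy : ∀ n, y n ∈ K) (h : ∀ z, Tendsto (fun n => inner ℝ (y n) z) atTop (𝓝 (inner ℝ x z))) :
    x ∈ K := by
  have : CompleteSpace K := hK.completeSpace_coe
  rw [← Submodule.orthogonal_orthogonal K, Submodule.mem_orthogonal']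
  intro z hz
  refine tendsto_nhds_unique (h z) (tendsto_const_nhds.congr fun n => ?_)
  exact ((Submodule.mem_orthogonal K z).1 hz (y n) (hy n)).symm

/-! ### Point evaluation on `E₀^α` -/

section Exponent

variable {α T : ℝ}

/-- This is where `α > 1/2` matters: the squared kernel has positive order `2α - 1`, hence is
locally integrable, and point evaluation of the order-`α` integral is bounded on `L²`. -/
lemma rlKernel_sq (h0 : 1 / 2 < α) (x : ℝ) : rlKernel α x ^ 2 =
    Real.Gamma (2 * α - 1) / Real.Gamma α ^ 2 * rlKernel (2 * α - 1) x := by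
  rcases le_or_gt x 0 with h | h
  · simp [rlKernel_of_nonpos h]
  · have := Real.Gamma_pos_of_pos (s := 2 * α - 1) (by linarith)
    have := Real.Gamma_pos_of_pos (s := α) (by linarith)
    rw [rlKernel_of_pos h, rlKernel_of_pos h, div_pow, ← Real.rpow_mul_natCast h.le]
    have : (α - 1) * (2 : ℕ) = 2 * α - 1 - 1 := by push_cast; ring
    rw [this]
    field_simp

lemma embConst_sq (hT : 0 < T) (h0 : 1 / 2 < α) : embConst α T ^ 2 =
    Real.Gamma (2 * α - 1) / Real.Gamma α ^ 2 * rlKernel (2 * α) T := by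
  have h1 := Real.Gamma_pos_of_pos (s := 2 * α - 1) (by linarith)
  have h2 := Real.Gamma_pos_of_pos (s := α) (by linarith)
  have h3 : 0 < 2 * α - 1 := by linarith
  have e : Real.Gamma (2 * α) = (2 * α - 1) * Real.Gamma (2 * α - 1) := by
    rw [← Real.Gamma_add_one h3.ne']; congr 1; ring
  rw [embConst, rlKernel_of_pos hT, div_pow, mul_pow, Real.sq_sqrt h3.le, e,
    ← Real.rpow_mul_natCast hT.le]
  have : (α - 1 / 2) * (2 : ℕ) = 2 * α - 1 := by push_cast; ring
  rw [this]
  field_simp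

lemma embConst_pos (hT : 0 < T) (h0 : 1 / 2 < α) : 0 < embConst α T := by
  have h2 := Real.Gamma_pos_of_pos (s := α) (by linarith)
  have h3 : 0 < 2 * α - 1 := by linarith
  have := Real.sqrt_pos.2 h3
  unfold embConst
  positivity

lemma memLp_evalKernel (h0 : 1 / 2 < α) {t : ℝ} (ht : t ∈ Icc 0 T) :
    MemLp (fun s => rlKernel α (t - s)) 2 (volume.restrict (Icc 0 T)) := by
  rw [memLp_two_iff_integrable_sq (Measurable.aestronglyMeasurable (by fun_prop))]
  simp only [rlKernel_sq h0]
  exact (integrable_rlKernel_left (by linarith) ht).1.const_mul _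

open Classical in
/-- The element of `L²` representing `w ↦ (I^α w)(t)`. -/
def evalVec (α T t : ℝ) : L2 T :=
  if h : MemLp (fun s => rlKernel α (t - s)) 2 (volume.restrict (Icc 0 T)) then h.toLp else 0

lemma inner_evalVec (h0 : 1 / 2 < α) {t : ℝ} (ht : t ∈ Icc 0 T) (w : L2 T) :
    inner ℝ (evalVec α T t) w = leftRL α 0 w t := by
  have hm := memLp_evalKernel h0 ht
  rw [evalVec, dif_pos hm, leftRL_eq_kernelInt (by linarith) ht, L2.inner_def]
  refine integral_congr_ae ?_
  filter_upwards [hm.coeFn_toLp] with s hs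
  rw [hs]
  simp [leftKernel, mul_comm]

/-- The norm of the evaluation kernel increases with `t`, and `embConst` is its value at `t = T`. -/
lemma norm_evalVec_le (hT : 0 < T) (h0 : 1 / 2 < α) {t : ℝ} (ht : t ∈ Icc 0 T) :
    ‖evalVec α T t‖ ≤ embConst α T := by
  have hm := memLp_evalKernel h0 ht
  refine (sq_le_sq₀ (norm_nonneg _) (embConst_pos hT h0).le).1 ?_
  rw [embConst_sq hT h0, ← real_inner_self_eq_norm_sq, evalVec, dif_pos hm, L2.inner_def]
  have e : ∫ s in Icc 0 T, inner ℝ ((hm.toLp _ : L2 T) s) ((hm.toLp _ : L2 T) s) =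
      ∫ s in Icc 0 T, Real.Gamma (2 * α - 1) / Real.Gamma α ^ 2 * rlKernel (2 * α - 1) (t - s) := by
    refine integral_congr_ae ?_
    filter_upwards [hm.coeFn_toLp] with s hs
    rw [hs, ← rlKernel_sq h0]
    simp [sq]
  rw [e, integral_const_mul, (integrable_rlKernel_left (by linarith) ht).2]
  have h1 := Real.Gamma_pos_of_pos (s := 2 * α - 1) (by linarith)
  have e2 : 2 * α - 1 + 1 = 2 * α := by ring
  rw [e2]
  exact mul_le_mul_of_nonneg_left (rlKernel_mono (by linarith) ht.2) (by positivity)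

lemma abs_leftRL_le (hT : 0 < T) (h0 : 1 / 2 < α) {t : ℝ} (ht : t ∈ Icc 0 T) (w : L2 T) :
    |leftRL α 0 w t| ≤ embConst α T * ‖w‖ := by
  rw [← inner_evalVec h0 ht]
  exact (abs_real_inner_le_norm _ _).trans
    (mul_le_mul_of_nonneg_right (norm_evalVec_le hT h0 ht) (norm_nonneg _))

lemma leftRL_add (h0 : 1 / 2 < α) {t : ℝ} (ht : t ∈ Icc 0 T) (w₁ w₂ : L2 T) :
    leftRL α 0 (w₁ + w₂ : L2 T) t = leftRL α 0 w₁ t + leftRL α 0 w₂ t := by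
  simp only [← inner_evalVec h0 ht, inner_add_right]

lemma leftRL_sub (h0 : 1 / 2 < α) {t : ℝ} (ht : t ∈ Icc 0 T) (w₁ w₂ : L2 T) :
    leftRL α 0 (w₁ - w₂ : L2 T) t = leftRL α 0 w₁ t - leftRL α 0 w₂ t := by
  simp only [← inner_evalVec h0 ht, inner_sub_right]

lemma leftRL_smul (h0 : 1 / 2 < α) {t : ℝ} (ht : t ∈ Icc 0 T) (c : ℝ) (w : L2 T) :
    leftRL α 0 (c • w : L2 T) t = c * leftRL α 0 w t := by
  simp only [← inner_evalVec h0 ht, inner_smul_right]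

lemma leftRL_leftOp (h0 : 0 < α) (h1 : α ≤ 1) {t : ℝ} (ht : t ∈ Icc 0 T) (v : L2 T) :
    leftRL α 0 (leftOp (1 - α) T v) t = ∫ s in (0 : ℝ)..t, v s := by
  rcases h1.eq_or_lt with rfl | h1
  · rw [sub_self, leftOp_zero, leftRL_one]; rfl
  · have h2 : 0 < 1 - α := by linarith
    have e : leftRL α 0 (leftOp (1 - α) T v) t = leftRL α 0 (leftRL (1 - α) 0 v) t := by
      rw [leftRL_eq_kernelInt h0 ht, leftRL_eq_kernelInt h0 ht,
        kernelInt_congr_ae (leftOp_coeFn h2.le v)]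
    have e1 : α + (1 - α) = 1 := by ring
    rw [e, leftRL_comp h0 h2 ht (Lp.aestronglyMeasurable v), e1, ← leftRL_one,
      leftRL_eq_kernelInt one_pos ht]
    · rfl
    · rw [e1]
      exact integrable_rlKernel_one_mul (by fun_prop) (memLp_two_integrable (Lp.memLp v))

-- On the dense set of pairs coming from smooth functions the integral is an ordinary primitive;
-- `abs_leftRL_le` makes the convergence uniform, so continuity passes to the closure.
open Filter Topology in
lemma continuousOn_leftRL (hT : 0 < T) (h0 : 1 / 2 < α) (h1 : α ≤ 1)
    {y : WithLp 2 (L2 T × L2 T)} (hy : y ∈ derivPairs α T) :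
    ContinuousOn (leftRL α 0 y.fst) (Icc 0 T) := by
  have hcl : IsClosed {y : WithLp 2 (L2 T × L2 T) |
      ContinuousOn (leftRL α 0 y.fst) (Icc 0 T)} := by
    refine IsSeqClosed.isClosed ?_
    intro x y hx hlim
    have h2 : Tendsto (fun n => embConst α T * ‖(x n).fst - y.fst‖) atTop (𝓝 0) := by
      have hc : Continuous fun z : WithLp 2 (L2 T × L2 T) => embConst α T * ‖z.fst - y.fst‖ := by
        fun_prop
      have := (hc.tendsto y).comp hlim
      simp only [sub_self, norm_zero, mul_zero] at this
      exact this
    refine TendstoUniformlyOn.continuousOn (F := fun n => leftRL α 0 (x n).fst) (p := atTop) ?_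
      (Eventually.of_forall hx).frequently
    rw [Metric.tendstoUniformlyOn_iff]
    intro ε hε
    filter_upwards [h2.eventually_lt_const hε] with n hn t ht
    rw [dist_comm, Real.dist_eq, ← leftRL_sub h0 ht]
    exact (abs_leftRL_le hT h0 ht _).trans_lt hn
  refine derivPairs_induction (P := fun y => ContinuousOn (leftRL α 0 y.fst) (Icc 0 T))
    hcl (fun v hv => ?_) hy
  have hi := memLp_two_integrable (Lp.memLp v)
  have hc : ContinuousOn (fun t => ∫ s in (0 : ℝ)..t, v s) (Icc 0 T) := by
    have := intervalIntegral.continuousOn_primitive_interval' (a := 0) (μ := volume)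
      (intervalIntegrable_of_restrict_Icc hi ⟨le_rfl, hT.le⟩ ⟨hT.le, le_rfl⟩) (by simp)
    rwa [uIcc_of_le hT.le] at this
  exact hc.congr fun t ht => leftRL_leftOp (by linarith) h1 ht v

/-! ### The nonlinear term -/

lemma hasDerivAt_potential {f : ℝ → ℝ} (hf : Continuous f) (x : ℝ) :
    HasDerivAt (potential f) (f x) x :=
  intervalIntegral.integral_hasDerivAt_right (hf.intervalIntegrable _ _)
    (hf.stronglyMeasurableAtFilter _ _) hf.continuousAt

lemma continuous_potential {f : ℝ → ℝ} (hf : Continuous f) : Continuous (potential f) :=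
  continuous_iff_continuousAt.2 fun x => (hasDerivAt_potential hf x).continuousAt

lemma potential_zero (f : ℝ → ℝ) : potential f 0 = 0 := by simp [potential]

lemma potential_le_maxPotential {f : ℝ → ℝ} (hf : Continuous f) {γ ξ : ℝ} (h : |ξ| ≤ γ) :
    potential f ξ ≤ maxPotential f γ :=
  le_csSup (isCompact_Icc.image (continuous_potential hf)).bddAbove
    ⟨ξ, abs_le.1 h, rfl⟩

lemma maxPotential_nonneg {f : ℝ → ℝ} (hf : Continuous f) {γ : ℝ} (h : 0 ≤ γ) :
    0 ≤ maxPotential f γ := by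
  rw [← potential_zero f]
  exact potential_le_maxPotential hf (by simpa using h)

lemma leftRL_aestronglyMeasurable (h0 : 0 ≤ α) (w : L2 T) :
    AEStronglyMeasurable (leftRL α 0 w) (volume.restrict (Icc 0 T)) :=
  (Lp.aestronglyMeasurable (leftOp α T w)).congr (leftOp_coeFn h0 w)

lemma Psi_toSpace {f : ℝ → ℝ} (h0 : 0 ≤ α) (y : WithLp 2 (L2 T × L2 T)) :
    Psi T f (toSpace α T y) = ∫ t in Icc 0 T, potential f (leftRL α 0 y.fst t) := by
  rw [Psi]
  refine integral_congr_ae ?_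
  filter_upwards [leftOp_coeFn h0 y.fst] with t ht
  rw [← ht]; rfl

lemma exists_bound_comp {g : ℝ → ℝ} (hg : Continuous g) (R : ℝ) :
    ∃ C, ∀ ξ, |ξ| ≤ R → ‖g ξ‖ ≤ C := by
  obtain ⟨C, hC⟩ := (isCompact_Icc (a := -R) (b := R)).exists_bound_of_continuousOn
    hg.continuousOn
  exact ⟨C, fun ξ h => hC ξ (abs_le.1 h)⟩

lemma integrable_comp_leftRL {g : ℝ → ℝ} (hg : Continuous g) (hT : 0 < T) (h0 : 1 / 2 < α)
    (w : L2 T) : Integrable (fun t => g (leftRL α 0 w t)) (volume.restrict (Icc 0 T)) := by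
  obtain ⟨C, hC⟩ := exists_bound_comp hg (embConst α T * ‖w‖)
  refine Integrable.of_bound
    (hg.comp_aestronglyMeasurable (leftRL_aestronglyMeasurable (by linarith) w)) C
    (ae_restrict_of_forall_mem measurableSet_Icc fun t ht => hC _ (abs_leftRL_le hT h0 ht w))

lemma Psi_toSpace_le {f : ℝ → ℝ} (hf : Continuous f) (hT : 0 < T) (h0 : 1 / 2 < α) {γ : ℝ}
    {y : WithLp 2 (L2 T × L2 T)} (hy : embConst α T * ‖y.fst‖ ≤ γ) :
    Psi T f (toSpace α T y) ≤ T * maxPotential f γ := by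
  rw [Psi_toSpace (by linarith)]
  have h := setIntegral_mono_on (integrable_comp_leftRL (continuous_potential hf) hT h0 y.fst)
    (g := fun _ => maxPotential f γ) (by simp) measurableSet_Icc
    (fun t ht => potential_le_maxPotential hf ((abs_leftRL_le hT h0 ht y.fst).trans hy))
  refine h.trans_eq ?_
  simp [hT.le]

-- Point evaluations are inner products with fixed vectors, so weak convergence gives pointwise
-- convergence of the functions. The uniform bound on them provides domination.
open Filter Topology in
lemma tendsto_Psi_of_weak_limit {f : ℝ → ℝ} (hf : Continuous f) (hT : 0 < T) (h0 : 1 / 2 < α)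
    {y : ℕ → WithLp 2 (L2 T × L2 T)} {x : WithLp 2 (L2 T × L2 T)} {R : ℝ}
    (hR : ∀ n, ‖(y n).fst‖ ≤ R)
    (h : ∀ z, Tendsto (fun n => inner ℝ (y n) z) atTop (𝓝 (inner ℝ x z))) :
    Tendsto (fun n => Psi T f (toSpace α T (y n))) atTop (𝓝 (Psi T f (toSpace α T x))) := by
  simp only [Psi_toSpace (show 0 ≤ α by linarith)]
  have hF := continuous_potential hf
  obtain ⟨C, hC⟩ := exists_bound_comp hF (embConst α T * R)
  have hpt : ∀ z : WithLp 2 (L2 T × L2 T), ∀ t ∈ Icc 0 T,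
      leftRL α 0 z.fst t = inner ℝ z (WithLp.toLp 2 (evalVec α T t, 0)) := by
    intro z t ht
    rw [WithLp.prod_inner_apply, ← inner_evalVec h0 ht, real_inner_comm]
    simp
  refine tendsto_integral_of_dominated_convergence (fun _ => C)
    (fun n => (integrable_comp_leftRL hF hT h0 _).1) (integrable_const C) (fun n => ?_) ?_
  · refine ae_restrict_of_forall_mem measurableSet_Icc fun t ht => hC _ ?_
    exact (abs_leftRL_le hT h0 ht _).trans
      (mul_le_mul_of_nonneg_left (hR n) (embConst_pos hT h0).le)
  · refine ae_restrict_of_forall_mem measurableSet_Icc fun t ht => ?_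
    refine (hF.tendsto _).comp ?_
    simp only [hpt _ t ht]
    exact h _

lemma hasDerivAt_Psi {f : ℝ → ℝ} (hf : Continuous f) (hT : 0 < T) (h0 : 1 / 2 < α)
    (y z : WithLp 2 (L2 T × L2 T)) :
    HasDerivAt (fun s : ℝ => Psi T f (toSpace α T (y + s • z)))
      (∫ t in Icc 0 T, f (leftRL α 0 y.fst t) * leftRL α 0 z.fst t) 0 := by
  simp only [Psi_toSpace (show 0 ≤ α by linarith)]
  have hF := continuous_potential hf
  set c := embConst α T
  have hc : 0 < c := embConst_pos hT h0
  have hb : ∀ s ∈ Metric.ball (0 : ℝ) 1, ∀ t ∈ Icc 0 T,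
      |leftRL α 0 (y + s • z).fst t| ≤ c * (‖y.fst‖ + ‖z.fst‖) := by
    intro s hs t ht
    refine (abs_leftRL_le hT h0 ht _).trans (mul_le_mul_of_nonneg_left ?_ hc.le)
    have hs' : ‖s‖ ≤ 1 := (mem_ball_zero_iff.1 hs).le
    calc ‖(y + s • z).fst‖ = ‖y.fst + s • z.fst‖ := rfl
      _ ≤ ‖y.fst‖ + ‖s‖ * ‖z.fst‖ := by rw [← norm_smul]; exact norm_add_le _ _
      _ ≤ ‖y.fst‖ + ‖z.fst‖ := by nlinarith [norm_nonneg z.fst]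
  obtain ⟨C, hC⟩ := exists_bound_comp hf (c * (‖y.fst‖ + ‖z.fst‖))
  have heq : ∀ s : ℝ, ∀ t ∈ Icc 0 T, leftRL α 0 (y + s • z).fst t =
      leftRL α 0 y.fst t + s * leftRL α 0 z.fst t := by
    intro s t ht
    have : (y + s • z).fst = y.fst + s • z.fst := rfl
    rw [this, leftRL_add h0 ht, leftRL_smul h0 ht]
  have key := hasDerivAt_integral_of_dominated_loc_of_deriv_le
    (μ := volume.restrict (Icc 0 T)) (x₀ := (0 : ℝ)) (s := Metric.ball 0 1)
    (F := fun s t => potential f (leftRL α 0 (y + s • z).fst t))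
    (F' := fun s t => f (leftRL α 0 (y + s • z).fst t) * leftRL α 0 z.fst t)
    (bound := fun _ => C * (c * ‖z.fst‖)) (Metric.ball_mem_nhds _ one_pos)
    (Filter.Eventually.of_forall fun s => (integrable_comp_leftRL hF hT h0 _).1)
    (integrable_comp_leftRL hF hT h0 _)
    ((hf.comp_aestronglyMeasurable (leftRL_aestronglyMeasurable (by linarith) _)).mul
      (leftRL_aestronglyMeasurable (by linarith) _))
    (ae_restrict_of_forall_mem measurableSet_Icc fun t ht s hs => by
      rw [norm_mul]
      have h1 := hC _ (hb s hs t ht)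
      have h2 := abs_leftRL_le hT h0 ht z.fst
      exact mul_le_mul h1 h2 (norm_nonneg _) ((norm_nonneg _).trans h1))
    (integrable_const _)
    (ae_restrict_of_forall_mem measurableSet_Icc fun t ht s hs => by
      simp only [heq _ t ht]
      have h1 : HasDerivAt (fun s : ℝ => leftRL α 0 y.fst t + s * leftRL α 0 z.fst t)
          (leftRL α 0 z.fst t) s := by
        simpa using ((hasDerivAt_id s).mul_const (leftRL α 0 z.fst t)).const_add
          (leftRL α 0 y.fst t)
      exact (hasDerivAt_potential hf _).comp s h1)
  simpa using key.2

end Exponent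

end FracBVP

namespace FracBVP

open MeasureTheory Set

/-! ### The minimisation problem -/

section Exponent

variable {α T : ℝ}

lemma cos_pi_mul_one_sub (α : ℝ) : Real.cos (Real.pi * (1 - α)) = -Real.cos (Real.pi * α) := by
  rw [mul_sub, mul_one, Real.cos_pi_sub]

lemma abs_cos_eq (h0 : 1 / 2 < α) (h1 : α ≤ 1) :
    |Real.cos (Real.pi * α)| = Real.cos (Real.pi * (1 - α)) := by
  have := cos_pi_mul_pos (β := 1 - α) (by linarith) (by linarith)
  rw [cos_pi_mul_one_sub] at this ⊢
  exact abs_of_neg (by linarith)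

/-- In this form the hypothesis `κ_α μ max F < γ²` reads `μ T max F < |cos(πα)| γ²/c²`, the radius
of the sublevel set. -/
lemma kappa_eq (hT : 0 < T) (h0 : 1 / 2 < α) :
    kappa α T = T * embConst α T ^ 2 / |Real.cos (Real.pi * α)| := by
  have h2 := Real.Gamma_pos_of_pos (s := α) (by linarith)
  have h3 : 0 < 2 * α - 1 := by linarith
  rw [kappa, embConst, div_pow, mul_pow, Real.sq_sqrt h3.le, ← Real.rpow_mul_natCast hT.le]
  have e : T ^ (2 * α) = T * T ^ ((α - 1 / 2) * (2 : ℕ)) := by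
    rw [← Real.rpow_one_add' hT.le (by push_cast; linarith)]
    congr 1; push_cast; ring
  rw [e]
  field_simp

/-- The quadratic form `⟨y.fst, y.snd⟩`, which is `Φ` on `E₀^α`. -/
def quadForm (y : WithLp 2 (L2 T × L2 T)) : ℝ := inner ℝ y.fst y.snd

/-- The symmetrised polar form of `quadForm`. -/
def polarForm (y z : WithLp 2 (L2 T × L2 T)) : ℝ := inner ℝ y.fst z.snd + inner ℝ z.fst y.snd

lemma quadForm_add (y z : WithLp 2 (L2 T × L2 T)) :
    quadForm (y + z) = quadForm y + polarForm y z + quadForm z := by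
  simp only [quadForm, polarForm, WithLp.add_fst, WithLp.add_snd, inner_add_left, inner_add_right]
  ring

lemma quadForm_smul (c : ℝ) (y : WithLp 2 (L2 T × L2 T)) :
    quadForm (c • y) = c ^ 2 * quadForm y := by
  simp only [quadForm, WithLp.smul_fst, WithLp.smul_snd, inner_smul_left, inner_smul_right]
  simp; ring

lemma polarForm_smul_right (c : ℝ) (y z : WithLp 2 (L2 T × L2 T)) :
    polarForm y (c • z) = c * polarForm y z := by
  simp only [polarForm, WithLp.smul_fst, WithLp.smul_snd, inner_smul_left, inner_smul_right]
  simp; ring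

lemma polarForm_self (y : WithLp 2 (L2 T × L2 T)) : polarForm y y = 2 * quadForm y := by
  simp only [polarForm, quadForm]; ring

lemma polarForm_eq_inner (y z : WithLp 2 (L2 T × L2 T)) :
    polarForm y z = inner ℝ y (WithLp.toLp 2 (z.snd, z.fst)) := by
  rw [WithLp.prod_inner_apply, polarForm, real_inner_comm z.fst]
  simp

lemma quadForm_nonneg (h0 : 1 / 2 < α) (h1 : α ≤ 1) {y : WithLp 2 (L2 T × L2 T)}
    (hy : y ∈ derivPairs α T) : 0 ≤ quadForm y := by
  have hc := cos_pi_mul_pos (β := 1 - α) (by linarith) (by linarith)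
  exact le_trans (by positivity) (cos_mul_sq_norm_le_of_mem_derivPairs h0 h1 hy)

lemma eq_zero_of_quadForm_eq_zero (h0 : 1 / 2 < α) (h1 : α ≤ 1) {y : WithLp 2 (L2 T × L2 T)}
    (hy : y ∈ derivPairs α T) (h : quadForm y = 0) : y.fst = 0 := by
  have hc := cos_pi_mul_pos (β := 1 - α) (by linarith) (by linarith)
  have h2 := cos_mul_sq_norm_le_of_mem_derivPairs h0 h1 hy
  rw [quadForm] at h
  rw [h] at h2
  have h3 : ‖y.fst‖ ^ 2 ≤ 0 := le_of_mul_le_mul_left (h2.trans_eq (mul_zero _).symm) hc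
  exact norm_eq_zero.1 (pow_eq_zero_iff two_ne_zero |>.1 (le_antisymm h3 (sq_nonneg _)))

/-- The functional `J_μ` transported to `derivPairs`. -/
def pairEnergy (α T μ : ℝ) (f : ℝ → ℝ) (y : WithLp 2 (L2 T × L2 T)) : ℝ :=
  quadForm y - μ * Psi T f (toSpace α T y)

lemma energy_toSpace (hT : 0 < T) (h0 : 0 ≤ α) (h1 : α ≤ 1) {μ : ℝ} {f : ℝ → ℝ}
    {y : WithLp 2 (L2 T × L2 T)} (hy : y ∈ derivPairs α T) :
    energy α T μ f (toSpace α T y) = pairEnergy α T μ f y := by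
  rw [energy, Phi_toSpace hT h0 h1 hy]; rfl

/-- The radius is tuned so that coercivity gives `‖y.fst‖ ≤ γ / c`; the embedding then keeps the
function inside `[-γ, γ]`, where `maxPotential f γ` bounds the potential. -/
lemma embConst_mul_norm_le (hT : 0 < T) (h0 : 1 / 2 < α) (h1 : α ≤ 1) {γ : ℝ} (hγ : 0 ≤ γ)
    {y : WithLp 2 (L2 T × L2 T)} (hy : y ∈ derivPairs α T)
    (h : quadForm y ≤ |Real.cos (Real.pi * α)| / embConst α T ^ 2 * γ ^ 2) :
    embConst α T * ‖y.fst‖ ≤ γ := by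
  have hc := cos_pi_mul_pos (β := 1 - α) (by linarith) (by linarith)
  have he := embConst_pos hT h0
  rw [abs_cos_eq h0 h1] at h
  have h2 := (cos_mul_sq_norm_le_of_mem_derivPairs h0 h1 hy).trans h
  refine (sq_le_sq₀ (by positivity) hγ).1 ?_
  rw [div_mul_eq_mul_div, mul_div_assoc] at h2
  have h3 := le_of_mul_le_mul_left h2 hc
  rw [le_div_iff₀ (by positivity)] at h3
  rw [mul_pow]
  linarith

lemma exists_ofReal_bound_derivPairs (h0 : 1 / 2 < α) (h1 : α ≤ 1) {R : ℝ}
    {y : WithLp 2 (L2 T × L2 T)} (hy : y ∈ derivPairs α T) (h : ‖y.fst‖ ≤ R) :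
    ‖y‖ ≤ R + R / Real.cos (Real.pi * (1 - α)) := by
  have hc := cos_pi_mul_pos (β := 1 - α) (by linarith) (by linarith)
  have hR : 0 ≤ R := (norm_nonneg _).trans h
  have h2 : ‖y.snd‖ ≤ R / Real.cos (Real.pi * (1 - α)) := by
    rw [le_div_iff₀ hc, mul_comm]
    exact (cos_mul_norm_snd_le_of_mem_derivPairs h0 h1 hy).trans h
  refine (sq_le_sq₀ (norm_nonneg _) (by positivity)).1 ?_
  rw [WithLp.prod_norm_sq_eq_of_L2]
  nlinarith [norm_nonneg y.fst, norm_nonneg y.snd]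

-- The direct method on a sublevel set. The strict inequality on the minimiser is the essential
-- output: it makes the constraint inactive.
open Filter Topology in
lemma exists_minimizer (hT : 0 < T) (h0 : 1 / 2 < α) (h1 : α ≤ 1) {f : ℝ → ℝ}
    (hf : Continuous f) {μ γ : ℝ} (hμ : 0 < μ) (hγ : 0 < γ)
    (hκ : kappa α T * μ * maxPotential f γ < γ ^ 2) :
    ∃ y ∈ derivPairs α T,
      quadForm y < |Real.cos (Real.pi * α)| / embConst α T ^ 2 * γ ^ 2 ∧
      ∀ z ∈ derivPairs α T,
        quadForm z ≤ |Real.cos (Real.pi * α)| / embConst α T ^ 2 * γ ^ 2 →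
        pairEnergy α T μ f y ≤ pairEnergy α T μ f z := by
  have hc := cos_pi_mul_pos (β := 1 - α) (by linarith) (by linarith)
  have he := embConst_pos hT h0
  set r := |Real.cos (Real.pi * α)| / embConst α T ^ 2 * γ ^ 2 with hr
  have hr0 : 0 < r := by
    rw [hr, abs_cos_eq h0 h1]; positivity
  have hPsi : ∀ z ∈ derivPairs α T, quadForm z ≤ r →
      Psi T f (toSpace α T z) ≤ T * maxPotential f γ := fun z hz hzr =>
    Psi_toSpace_le hf hT h0 (embConst_mul_norm_le hT h0 h1 hγ.le hz hzr)
  set S : Set ℝ := pairEnergy α T μ f '' {z | z ∈ derivPairs α T ∧ quadForm z ≤ r} with hS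
  have hz0 : quadForm (0 : WithLp 2 (L2 T × L2 T)) = 0 := by simp [quadForm]
  have h0mem : (0 : WithLp 2 (L2 T × L2 T)) ∈ {z | z ∈ derivPairs α T ∧ quadForm z ≤ r} :=
    ⟨Submodule.zero_mem _, by rw [hz0]; exact hr0.le⟩
  have hbdd : BddBelow S := by
    refine ⟨-(μ * (T * maxPotential f γ)), ?_⟩
    rintro _ ⟨z, ⟨hz, hzr⟩, rfl⟩
    have h2 := mul_le_mul_of_nonneg_left (hPsi z hz hzr) hμ.le
    have h3 := quadForm_nonneg h0 h1 hz
    unfold pairEnergy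
    linarith
  obtain ⟨a, -, ha, haS⟩ := exists_seq_tendsto_sInf ⟨_, mem_image_of_mem _ h0mem⟩ hbdd
  choose x hx hxa using haS
  have hxR : ∀ n, ‖(x n).fst‖ ≤ γ / embConst α T := fun n => by
    rw [le_div_iff₀ he, mul_comm]
    exact embConst_mul_norm_le hT h0 h1 hγ.le (hx n).1 (hx n).2
  -- Feeds the separability of `L²`, needed to extract a weakly convergent subsequence.
  have : Fact ((2 : ℝ≥0∞) ≠ ⊤) := ⟨by norm_num⟩
  obtain ⟨y, φ, hφ, hlim⟩ := exists_weakly_convergent_subseq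
    (fun n => exists_ofReal_bound_derivPairs h0 h1 (hx n).1 (hxR n))
  have hy : y ∈ derivPairs α T :=
    mem_of_weak_limit (isClosed_derivPairs α T) (fun n => (hx (φ n)).1) hlim
  have hpol : Tendsto (fun n => polarForm (x (φ n)) y - quadForm y) atTop (𝓝 (quadForm y)) := by
    have h2 := hlim (WithLp.toLp 2 (y.snd, y.fst))
    simp only [← polarForm_eq_inner, polarForm_self] at h2
    have := h2.sub_const (quadForm y)
    rwa [two_mul, add_sub_cancel_right] at this
  -- Expansion of `quadForm (x (φ n) - y) ≥ 0`; the left side is affine in `x (φ n)`, which yields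
  -- weak lower semicontinuity.
  have hlow : ∀ n, polarForm (x (φ n)) y - quadForm y ≤ quadForm (x (φ n)) := fun n => by
    have h2 := quadForm_nonneg h0 h1 (Submodule.add_mem _ (hx (φ n)).1
      (Submodule.smul_mem _ (-1) hy))
    rw [quadForm_add, quadForm_smul, polarForm_smul_right] at h2
    linarith
  have hyr : quadForm y ≤ r := le_of_tendsto hpol
    (Eventually.of_forall fun n => (hlow n).trans (hx (φ n)).2)
  have hPlim := tendsto_Psi_of_weak_limit hf hT h0 (fun n => hxR (φ n)) hlim
  have hmin : pairEnergy α T μ f y ≤ sInf S := by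
    refine le_of_tendsto_of_tendsto (hpol.sub (hPlim.const_mul μ)) (ha.comp hφ.tendsto_atTop)
      (Eventually.of_forall fun n => ?_)
    simp only [Function.comp, ← hxa]
    exact sub_le_sub_right (hlow n) _
  have hmin' : ∀ z ∈ derivPairs α T, quadForm z ≤ r →
      pairEnergy α T μ f y ≤ pairEnergy α T μ f z := fun z hz hzr =>
    hmin.trans (csInf_le hbdd (mem_image_of_mem _ ⟨hz, hzr⟩))
  refine ⟨y, hy, ?_, hmin'⟩
  -- The competitor `0` has zero energy, so `quadForm y ≤ μ Ψ(y) ≤ μ T max F < r`.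
  have h2 := hmin' 0 h0mem.1 h0mem.2
  have h3 : Psi T f (toSpace α T 0) = 0 := by
    rw [Psi_toSpace (by linarith)]
    refine integral_eq_zero_of_ae (ae_restrict_of_forall_mem measurableSet_Icc fun t ht => ?_)
    have : leftRL α 0 (0 : WithLp 2 (L2 T × L2 T)).fst t = 0 := by
      rw [← inner_evalVec h0 ht]; simp
    simp only [this, potential_zero]; rfl
  rw [pairEnergy, pairEnergy, hz0, h3] at h2
  have h4 := mul_le_mul_of_nonneg_left (hPsi y hy hyr) hμ.le
  have h5 : μ * (T * maxPotential f γ) < r := by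
    rw [kappa_eq hT h0] at hκ
    have hcos : 0 < |Real.cos (Real.pi * α)| := by rw [abs_cos_eq h0 h1]; exact hc
    rw [hr, div_mul_eq_mul_div, lt_div_iff₀ (by positivity)]
    have h6 := mul_lt_mul_of_pos_left hκ hcos
    field_simp at h6
    linarith
  linarith

-- The norm of `E₀^α` sees the left derivative directly. The right one is controlled through
-- `cos_mul_norm_snd_le_of_mem_derivPairs`, which bounds the form by a continuous function `G` of
-- the left derivative.
open Filter Topology in
lemma eventually_Phi_lt (hT : 0 < T) (h0 : 1 / 2 < α) (h1 : α ≤ 1) {r : ℝ}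
    {y : WithLp 2 (L2 T × L2 T)} (hy : y ∈ derivPairs α T) (hyr : quadForm y < r) :
    ∀ᶠ e in 𝓝[E0 α T] (toSpace α T y), ∃ z ∈ derivPairs α T, e = toSpace α T z ∧
      quadForm z < r := by
  have hc := cos_pi_mul_pos (β := 1 - α) (by linarith) (by linarith)
  set c := Real.cos (Real.pi * (1 - α))
  set G : WithLp 2 (L2 T × L2 T) → ℝ := fun e => quadForm y +
    (‖y.fst‖ * (‖e.snd - y.fst‖ / c) + ‖e.snd - y.fst‖ * ‖y.snd‖) +
      ‖e.snd - y.fst‖ * (‖e.snd - y.fst‖ / c) with hG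
  have hGc : Continuous G := by fun_prop
  have hG0 : G (toSpace α T y) < r := by
    have : (toSpace α T y).snd - y.fst = 0 := sub_self _
    simp only [hG, this]
    simpa using hyr
  have h2 : ∀ᶠ e in 𝓝 (toSpace α T y), G e < r := (hGc.tendsto _).eventually_lt_const hG0
  filter_upwards [mem_nhdsWithin_of_mem_nhds h2, self_mem_nhdsWithin] with e he heE
  obtain ⟨z, hz, rfl⟩ := exists_derivPairs_of_mem_E0 hT h0 h1 heE
  refine ⟨z, hz, rfl, lt_of_le_of_lt ?_ he⟩
  have hd := Submodule.sub_mem _ hz hy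
  have e1 : z = y + (z - y) := by abel
  have hsnd : ‖(z - y).snd‖ ≤ ‖(z - y).fst‖ / c := by
    rw [le_div_iff₀ hc, mul_comm]
    exact cos_mul_norm_snd_le_of_mem_derivPairs h0 h1 hd
  have e2 : (toSpace α T z).snd - y.fst = (z - y).fst := rfl
  rw [e1, quadForm_add, ← e1]
  simp only [hG, e2]
  gcongr
  · refine add_le_add ((real_inner_le_norm _ _).trans ?_) (real_inner_le_norm _ _)
    gcongr
  · refine (real_inner_le_norm _ _).trans ?_
    gcongr

open Filter Topology in
lemma isLocalMinOn_energy (hT : 0 < T) (h0 : 1 / 2 < α) (h1 : α ≤ 1) {r μ : ℝ} {f : ℝ → ℝ}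
    {y : WithLp 2 (L2 T × L2 T)} (hy : y ∈ derivPairs α T) (hyr : quadForm y < r)
    (hmin : ∀ z ∈ derivPairs α T, quadForm z ≤ r →
      pairEnergy α T μ f y ≤ pairEnergy α T μ f z) :
    IsLocalMinOn (energy α T μ f) (E0 α T) (toSpace α T y) := by
  filter_upwards [eventually_Phi_lt hT h0 h1 hy hyr] with e he
  obtain ⟨z, hz, rfl, hzr⟩ := he
  rw [energy_toSpace hT (by linarith) h1 hy, energy_toSpace hT (by linarith) h1 hz]
  exact hmin z hz hzr.le

open Filter Topology in
/-- The Euler–Lagrange equation of an interior minimiser. -/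
lemma euler_lagrange (hT : 0 < T) (h0 : 1 / 2 < α) {r μ : ℝ} {f : ℝ → ℝ}
    (hf : Continuous f)
    {y : WithLp 2 (L2 T × L2 T)} (hy : y ∈ derivPairs α T) (hyr : quadForm y < r)
    (hmin : ∀ z ∈ derivPairs α T, quadForm z ≤ r →
      pairEnergy α T μ f y ≤ pairEnergy α T μ f z)
    {z : WithLp 2 (L2 T × L2 T)} (hz : z ∈ derivPairs α T) :
    polarForm y z = μ * ∫ t in Icc 0 T, f (leftRL α 0 y.fst t) * leftRL α 0 z.fst t := by
  have hq : ∀ s : ℝ, quadForm (y + s • z) = quadForm y + s * polarForm y z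
      + s ^ 2 * quadForm z := fun s => by
    rw [quadForm_add, quadForm_smul, polarForm_smul_right]
  have hd1 : HasDerivAt (fun s : ℝ => quadForm (y + s • z)) (polarForm y z) 0 := by
    simp only [hq]
    have h2 := (((hasDerivAt_id (0 : ℝ)).mul_const (polarForm y z)).const_add (quadForm y)).add
      (((hasDerivAt_id (0 : ℝ)).pow 2).mul_const (quadForm z))
    refine h2.congr_deriv ?_
    simp
  have hd := hd1.sub ((hasDerivAt_Psi hf hT h0 y z).const_mul μ)
  have hloc : IsLocalMin (fun s : ℝ => pairEnergy α T μ f (y + s • z)) 0 := by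
    have h3 : ∀ᶠ s : ℝ in 𝓝 0, quadForm (y + s • z) < r := by
      refine hd1.continuousAt.eventually_lt_const ?_
      simpa using hyr
    filter_upwards [h3] with s hs
    simp only [zero_smul, add_zero]
    exact hmin _ (Submodule.add_mem _ hy (Submodule.smul_mem _ s hz)) hs.le
  have := hloc.hasDerivAt_eq_zero hd
  linarith

/-- Elements of `derivPairs` are determined by the symmetrised form. -/
lemma fst_eq_of_polarForm_eq (h0 : 1 / 2 < α) (h1 : α ≤ 1)
    {y₁ y₂ : WithLp 2 (L2 T × L2 T)} (hy₁ : y₁ ∈ derivPairs α T) (hy₂ : y₂ ∈ derivPairs α T)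
    (h : ∀ v ∈ smoothDeriv T, polarForm y₁ (pairMap α T v) = polarForm y₂ (pairMap α T v)) :
    y₁.fst = y₂.fst := by
  have hd := Submodule.sub_mem _ hy₁ hy₂
  have h2 : ∀ z ∈ derivPairs α T, polarForm y₁ z = polarForm y₂ z := fun z hz => by
    refine derivPairs_induction (P := fun z => polarForm y₁ z = polarForm y₂ z)
      (isClosed_eq ?_ ?_) h hz <;>
    · unfold polarForm; fun_prop
  have h3 := h2 _ hd
  have h4 : quadForm (y₁ - y₂) = 0 := by
    have : polarForm (y₁ - y₂) (y₁ - y₂) = 0 := by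
      have e : polarForm (y₁ - y₂) (y₁ - y₂) =
          polarForm y₁ (y₁ - y₂) - polarForm y₂ (y₁ - y₂) := by
        simp only [polarForm, WithLp.sub_fst, WithLp.sub_snd, inner_sub_left, inner_sub_right]
        ring
      rw [e, h3, sub_self]
    rw [polarForm_self] at this
    linarith
  exact sub_eq_zero.1 (eq_zero_of_quadForm_eq_zero h0 h1 hd h4)

end Exponent

end FracBVP

namespace FracBVP

open MeasureTheory Set

/-! ### Abel inversion for Hölder functions -/

section Frullani

variable {β L M : ℝ} {P : ℝ → ℝ}

lemma integrableOn_rpow_mul_rpow {a b L : ℝ} (ha : 0 < a) (hb : 0 < b) :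
    IntegrableOn (fun x => x ^ (a - 1) * (L - x) ^ (b - 1)) (Ioo 0 L) := by
  have h := (rlKernel_semigroup hb ha L 0).1.const_mul (Real.Gamma b * Real.Gamma a)
  refine (h.integrableOn (s := Ioo 0 L)).congr_fun (fun x hx => ?_) measurableSet_Ioo
  have := Real.Gamma_pos_of_pos ha
  have := Real.Gamma_pos_of_pos hb
  simp only
  rw [sub_zero, rlKernel_of_pos hx.1, rlKernel_of_pos (x := L - x) (by linarith [hx.2])]
  field_simp

lemma integrableOn_rpow {a L : ℝ} (ha : -1 < a) : IntegrableOn (fun x : ℝ => x ^ a) (Ioo 0 L) := by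
  have h := integrableOn_rpow_mul_rpow (a := a + 1) (b := 1) (L := L) (by linarith) one_pos
  simpa using h

lemma integral_rpow_Ioo {a L : ℝ} (ha : -1 < a) (hL : 0 ≤ L) :
    ∫ x in Ioo 0 L, x ^ a = L ^ (a + 1) / (a + 1) := by
  rw [← integral_Ioc_eq_integral_Ioo, ← intervalIntegral.integral_of_le hL,
    integral_rpow (Or.inl ha), Real.zero_rpow (by linarith), sub_zero]

/-- The integrand of the Frullani-type double integral. -/
def frullaniKernel (β L : ℝ) (P : ℝ → ℝ) (q : ℝ × ℝ) : ℝ :=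
  if 0 < q.1 ∧ 0 < q.2 ∧ q.1 * (1 + q.2) < L then
    (P q.1 - P (q.1 * (1 + q.2))) * (q.1⁻¹ * q.2 ^ (-β - 1)) else 0

lemma measurable_frullaniKernel (hP : Measurable P) : Measurable (frullaniKernel β L P) := by
  have h1 : MeasurableSet {q : ℝ × ℝ | 0 < q.1 ∧ 0 < q.2 ∧ q.1 * (1 + q.2) < L} := by
    refine (measurableSet_lt measurable_const measurable_fst).inter
      ((measurableSet_lt measurable_const measurable_snd).inter
        (measurableSet_lt (f := fun q : ℝ × ℝ => q.1 * (1 + q.2)) (by fun_prop)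
          measurable_const))
  refine Measurable.ite h1 ?_ measurable_const
  have h2 : Measurable fun q : ℝ × ℝ => P (q.1 * (1 + q.2)) := hP.comp (by fun_prop)
  have h3 : Measurable fun q : ℝ × ℝ => P q.1 := hP.comp measurable_fst
  exact (h3.sub h2).mul (by fun_prop)

lemma frullaniKernel_bound
    (hM : ∀ x ∈ Icc 0 L, ∀ y ∈ Icc 0 L, |P x - P y| ≤ M * |x - y| ^ (1 / 2 : ℝ))
    {x τ : ℝ} (hx : 0 < x) (hτ : 0 < τ) (h : x * (1 + τ) < L) :
    ‖frullaniKernel β L P (x, τ)‖ ≤ M * (x ^ (-(1 / 2) : ℝ) * τ ^ (-β - 1 / 2)) := by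
  have hxτ : 0 < x * τ := by positivity
  rw [frullaniKernel, if_pos ⟨hx, hτ, h⟩, norm_mul]
  have h1 := hM x ⟨hx.le, by nlinarith⟩ (x * (1 + τ)) ⟨by positivity, h.le⟩
  have e : |x - x * (1 + τ)| = x * τ := by
    rw [abs_sub_comm, abs_of_nonneg] <;> nlinarith
  rw [e, Real.mul_rpow hx.le hτ.le] at h1
  rw [Real.norm_eq_abs, Real.norm_of_nonneg (by positivity)]
  refine (mul_le_mul_of_nonneg_right h1 (by positivity)).trans_eq ?_
  have e1 : x ^ (-(1 / 2) : ℝ) = x ^ (1 / 2 : ℝ) * x⁻¹ := by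
    rw [← Real.rpow_neg_one x, ← Real.rpow_add hx]; norm_num
  have e2 : τ ^ (-β - 1 / 2) = τ ^ (1 / 2 : ℝ) * τ ^ (-β - 1) := by
    rw [← Real.rpow_add hτ]; congr 1; ring
  rw [e1, e2]; ring

lemma frullaniKernel_bound_Ioo
    (hM : ∀ x ∈ Icc 0 L, ∀ y ∈ Icc 0 L, |P x - P y| ≤ M * |x - y| ^ (1 / 2 : ℝ))
    {x : ℝ} (hx : x ∈ Ioo 0 L) (τ : ℝ) :
    ‖frullaniKernel β L P (x, τ)‖ ≤ (Ioo 0 (L / x - 1)).indicator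
      (fun τ => M * (x ^ (-(1 / 2) : ℝ) * τ ^ (-β - 1 / 2))) τ := by
  by_cases h : τ ∈ Ioo 0 (L / x - 1)
  · rw [indicator_of_mem h]
    refine frullaniKernel_bound hM hx.1 h.1 ?_
    have := h.2
    rw [lt_sub_iff_add_lt, lt_div_iff₀ hx.1] at this
    linarith
  · rw [indicator_of_notMem h, frullaniKernel, if_neg, norm_zero]
    rintro ⟨h1, h2, h3⟩
    refine h ⟨h2, ?_⟩
    rw [lt_sub_iff_add_lt, lt_div_iff₀ hx.1]
    simp only at h3
    linarith

/-- The Hölder condition weakens the singularity to `τ^(-β-1/2)`, integrable at `0` because `β <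
1/2`. Integrating up to `L/x - 1` leaves a multiple of `x^(β-1) (L - x)^(1/2-β)`, which is
integrable in `x`. -/
lemma integrable_frullaniKernel (h0 : 0 < β) (h1 : β < 1 / 2) (hP : Measurable P)
    (hM : ∀ x ∈ Icc 0 L, ∀ y ∈ Icc 0 L, |P x - P y| ≤ M * |x - y| ^ (1 / 2 : ℝ)) :
    Integrable (frullaniKernel β L P) ((volume.restrict (Ioo 0 L)).prod volume) := by
  have hm := measurable_frullaniKernel (β := β) (L := L) hP
  have hi : ∀ x : ℝ, Integrable ((Ioo 0 (L / x - 1)).indicator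
      (fun τ => M * (x ^ (-(1 / 2) : ℝ) * τ ^ (-β - 1 / 2)))) := fun x => by
    rw [integrable_indicator_iff measurableSet_Ioo]
    exact ((integrableOn_rpow (by linarith)).const_mul _).const_mul _
  rw [integrable_prod_iff hm.aestronglyMeasurable]
  constructor
  · refine ae_restrict_of_forall_mem measurableSet_Ioo fun x hx => ?_
    exact (hi x).mono' (hm.comp measurable_prodMk_left).aestronglyMeasurable
      (Filter.Eventually.of_forall fun τ => frullaniKernel_bound_Ioo hM hx τ)
  · have hb : Integrable (fun x : ℝ => M / (1 / 2 - β) * (x ^ (β - 1) * (L - x) ^ (3 / 2 - β - 1)))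
        (volume.restrict (Ioo 0 L)) :=
      (integrableOn_rpow_mul_rpow h0 (by linarith)).const_mul _
    refine hb.mono' hm.norm.aestronglyMeasurable.integral_prod_right'
      (ae_restrict_of_forall_mem measurableSet_Ioo fun x hx => ?_)
    have hx0 := hx.1
    have hxL : 0 < L - x := by linarith [hx.2]
    have hL : 0 ≤ L / x - 1 := by
      rw [sub_nonneg, one_le_div hx.1]; exact hx.2.le
    rw [Real.norm_of_nonneg (integral_nonneg fun _ => norm_nonneg _)]
    refine (integral_mono_of_nonneg (Filter.Eventually.of_forall fun _ => norm_nonneg _) (hi x)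
      (Filter.Eventually.of_forall fun τ => frullaniKernel_bound_Ioo hM hx τ)).trans_eq ?_
    rw [integral_indicator measurableSet_Ioo, integral_const_mul, integral_const_mul,
      integral_rpow_Ioo (by linarith) hL]
    have e1 : L / x - 1 = (L - x) / x := by field_simp
    have e2 : -β - 1 / 2 + 1 = 1 / 2 - β := by ring
    have e3 : (3 / 2 - β - 1 : ℝ) = 1 / 2 - β := by ring
    have e4 : x ^ (-(1 / 2) : ℝ) = x ^ (β - 1) * x ^ (1 / 2 - β) := by
      rw [← Real.rpow_add hx0]; congr 1; ring
    rw [e1, e2, e3, e4, Real.div_rpow hxL.le hx0.le]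
    have := Real.rpow_pos_of_pos hx0 (1 / 2 - β)
    have : (0 : ℝ) < 1 / 2 - β := by linarith
    field_simp

/-- Inner integral of the kernel in the first variable. -/
lemma integral_frullaniKernel_fst (hP : Measurable P) (h : P 0 = 0)
    (hM : ∀ x ∈ Icc 0 L, ∀ y ∈ Icc 0 L, |P x - P y| ≤ M * |x - y| ^ (1 / 2 : ℝ)) {τ : ℝ}
    (hτ : 0 < τ) :
    IntegrableOn (fun x => P x / x) (Ioo 0 L) ∧
    ∫ x in Ioo 0 L, frullaniKernel β L P (x, τ) =
      -∫ x in Ioo 0 L, if L ≤ x * (1 + τ) then τ ^ (-β - 1) * (P x / x) else 0 := by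
  have hQ : IntegrableOn (fun x => P x / x) (Ioo 0 L) := by
    refine (((integrableOn_rpow (a := -(1 / 2)) (L := L) (by norm_num)).const_mul M)).mono'
      (Measurable.aestronglyMeasurable (by fun_prop))
      (ae_restrict_of_forall_mem measurableSet_Ioo fun x hx => ?_)
    have hx0 := hx.1
    have h1 := hM x ⟨hx.1.le, hx.2.le⟩ 0 ⟨le_rfl, hx.1.le.trans hx.2.le⟩
    rw [h, sub_zero, sub_zero, abs_of_pos hx0] at h1
    rw [norm_div, Real.norm_eq_abs, Real.norm_of_nonneg hx0.le, div_le_iff₀ hx0]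
    refine h1.trans_eq ?_
    rw [mul_assoc, ← Real.rpow_add_one hx0.ne']
    norm_num
  refine ⟨hQ, ?_⟩
  -- The measure `dx/x` is scale invariant, so the rescaled term integrates to the full integral of
  -- `Q`. Against the truncated first term, only minus the part over `L/(1+τ) ≤ x < L` survives.
  set Q : ℝ → ℝ := (Ioo 0 L).indicator fun x => P x / x with hQdef
  have hQi : Integrable Q := by rwa [integrable_indicator_iff measurableSet_Ioo]
  have h1τ : 0 < 1 + τ := by linarith
  have hQs : Integrable fun x => Q ((1 + τ) * x) := hQi.comp_mul_left' h1τ.ne'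
  have hQsi : ∫ x, (1 + τ) * Q ((1 + τ) * x) = ∫ x, Q x := by
    rw [integral_const_mul, Measure.integral_comp_mul_left, abs_of_pos (by positivity)]
    simp; field_simp
  have hE : Integrable fun x => (Iio (L / (1 + τ))).indicator Q x :=
    hQi.indicator measurableSet_Iio
  have e1 : ∫ x in Ioo 0 L, frullaniKernel β L P (x, τ) =
      ∫ x, τ ^ (-β - 1) * ((Iio (L / (1 + τ))).indicator Q x - (1 + τ) * Q ((1 + τ) * x)) := by
    rw [setIntegral_eq_integral_of_forall_compl_eq_zero]
    · refine integral_congr_ae (Filter.Eventually.of_forall fun x => ?_)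
      simp only [frullaniKernel]
      by_cases hx : 0 < x ∧ x * (1 + τ) < L
      · have hxL : x < L := by nlinarith [hx.1, hx.2, mul_pos hx.1 hτ]
        have m1 : x ∈ Iio (L / (1 + τ)) := by
          rw [mem_Iio, lt_div_iff₀ h1τ]; exact hx.2
        have m2 : x ∈ Ioo 0 L := ⟨hx.1, hxL⟩
        have m3 : (1 + τ) * x ∈ Ioo 0 L := ⟨by nlinarith [mul_pos h1τ hx.1], by linarith [hx.2]⟩
        rw [if_pos ⟨hx.1, hτ, hx.2⟩, indicator_of_mem m1, hQdef, indicator_of_mem m2,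
          indicator_of_mem m3, mul_comm x (1 + τ)]
        have := hx.1
        field_simp
      · rw [if_neg (fun h => hx ⟨h.1, h.2.2⟩)]
        have m3 : (1 + τ) * x ∉ Ioo 0 L := fun h => hx ⟨by
          have := h.1
          exact (mul_pos_iff_of_pos_left h1τ).1 this, by linarith [h.2]⟩
        have m4 : (Iio (L / (1 + τ))).indicator Q x = 0 := by
          by_cases m1 : x ∈ Iio (L / (1 + τ))
          · rw [indicator_of_mem m1, hQdef, indicator_of_notMem]
            intro m2
            rw [mem_Iio, lt_div_iff₀ h1τ] at m1
            exact hx ⟨m2.1, m1⟩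
          · rw [indicator_of_notMem m1]
        rw [m4, hQdef, indicator_of_notMem m3]
        simp
    · intro x hx
      rw [frullaniKernel, if_neg]
      rintro ⟨h1, h2, h3⟩
      simp only at h1 h3
      exact hx ⟨h1, by nlinarith [mul_pos h1 h2]⟩
  have e2 : (∫ x in Ioo 0 L, if L ≤ x * (1 + τ) then τ ^ (-β - 1) * (P x / x) else 0) =
      ∫ x, τ ^ (-β - 1) * (Q x - (Iio (L / (1 + τ))).indicator Q x) := by
    rw [← integral_indicator measurableSet_Ioo]
    refine integral_congr_ae (Filter.Eventually.of_forall fun x => ?_)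
    simp only [hQdef]
    by_cases hx : x ∈ Ioo 0 L
    · by_cases h2 : L ≤ x * (1 + τ)
      · have m1 : x ∉ Iio (L / (1 + τ)) := by
          rw [mem_Iio, not_lt, div_le_iff₀ h1τ]; exact h2
        rw [indicator_of_mem hx, if_pos h2, indicator_of_notMem m1, indicator_of_mem hx, sub_zero]
      · have m1 : x ∈ Iio (L / (1 + τ)) := by
          rw [mem_Iio, lt_div_iff₀ h1τ]; exact not_le.1 h2
        rw [indicator_of_mem hx, if_neg h2, indicator_of_mem m1, sub_self, mul_zero]
    · rw [indicator_of_notMem hx, indicator_of_notMem hx]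
      have : (Iio (L / (1 + τ))).indicator ((Ioo 0 L).indicator fun x => P x / x) x = 0 := by
        by_cases m1 : x ∈ Iio (L / (1 + τ))
        · rw [indicator_of_mem m1, indicator_of_notMem hx]
        · rw [indicator_of_notMem m1]
      rw [this]; simp
  rw [e1, e2, integral_const_mul, integral_const_mul, integral_sub hE (hQs.const_mul _), hQsi,
    integral_sub hQi hE]
  ring

/-- Inner integral of the kernel in the second variable. -/
lemma integral_frullaniKernel_snd {x : ℝ} (hx : x ∈ Ioo 0 L) :
    ∫ τ, frullaniKernel β L P (x, τ) =
      x ^ (β - 1) * ∫ s in Ioo x L, (P x - P s) * (s - x) ^ (-β - 1) := by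
  have hx0 := hx.1
  -- The substitution is `s = x(1 + τ)`.
  set g : ℝ → ℝ := (Ioo x L).indicator fun s => (P x - P s) * (s - x) ^ (-β - 1) with hg
  have e1 : ∫ s in Ioo x L, (P x - P s) * (s - x) ^ (-β - 1) = x * ∫ τ, g (x + x * τ) := by
    rw [Measure.integral_comp_mul_left (fun σ => g (x + σ)), integral_add_left_eq_self,
      abs_of_pos (by positivity), hg, integral_indicator measurableSet_Ioo]
    simp; field_simp
  rw [e1, ← mul_assoc, ← integral_const_mul]
  refine integral_congr_ae (Filter.Eventually.of_forall fun τ => ?_)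
  simp only [frullaniKernel, hg]
  by_cases h : 0 < τ ∧ x * (1 + τ) < L
  · have m : x + x * τ ∈ Ioo x L := ⟨by nlinarith [mul_pos hx0 h.1], by linarith [h.2]⟩
    rw [if_pos ⟨hx0, h⟩, indicator_of_mem m]
    have e2 : x + x * τ - x = x * τ := by ring
    have e3 : x + x * τ = x * (1 + τ) := by ring
    have e4 : x ^ (β - 1) * x * x ^ (-β - 1) = x⁻¹ := by
      rw [← Real.rpow_add_one hx0.ne', ← Real.rpow_add hx0, ← Real.rpow_neg_one]
      congr 1; ring
    rw [e2, e3, Real.mul_rpow hx0.le h.1.le, ← e4]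
    ring
  · have m : x + x * τ ∉ Ioo x L := fun m => h ⟨by
      have := m.1
      have h2 : 0 < x * τ := by linarith
      exact (mul_pos_iff_of_pos_left hx0).1 h2, by linarith [m.2]⟩
    rw [if_neg (fun h' => h h'.2), indicator_of_notMem m, mul_zero]

/-- The Marchaud derivative at distance of a function vanishing at `0` is annihilated by the
Abel kernel. -/
lemma marchaud_cancellation (h0 : 0 < β) (h1 : β < 1 / 2) (hP : Measurable P) (h : P 0 = 0)
    (hM : ∀ x ∈ Icc 0 L, ∀ y ∈ Icc 0 L, |P x - P y| ≤ M * |x - y| ^ (1 / 2 : ℝ)) :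
    IntegrableOn (fun x => x ^ (β - 1) * (P x * (L - x) ^ (-β))) (Ioo 0 L) ∧
    IntegrableOn (fun x => x ^ (β - 1) * (β * ∫ s in Ioo x L, (P x - P s) * (s - x) ^ (-β - 1)))
      (Ioo 0 L) ∧
    ∫ x in Ioo 0 L, x ^ (β - 1) * (β * ∫ s in Ioo x L, (P x - P s) * (s - x) ^ (-β - 1)) =
      -∫ x in Ioo 0 L, x ^ (β - 1) * (P x * (L - x) ^ (-β)) := by
  have hD := integrable_frullaniKernel h0 h1 hP hM
  have hA : IntegrableOn (fun x => x ^ (β - 1) * (P x * (L - x) ^ (-β))) (Ioo 0 L) := by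
    have hb := (integrableOn_rpow_mul_rpow (a := β + 1 / 2) (b := 1 - β) (L := L) (by linarith)
      (by linarith)).const_mul M
    refine hb.mono' (Measurable.aestronglyMeasurable (by fun_prop))
      (ae_restrict_of_forall_mem measurableSet_Ioo fun x hx => ?_)
    have hx0 := hx.1
    have hxL : 0 < L - x := by linarith [hx.2]
    have h1 := hM x ⟨hx.1.le, hx.2.le⟩ 0 ⟨le_rfl, hx.1.le.trans hx.2.le⟩
    rw [h, sub_zero, sub_zero, abs_of_pos hx0] at h1
    rw [norm_mul, norm_mul, Real.norm_of_nonneg (by positivity), Real.norm_eq_abs,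
      Real.norm_of_nonneg (r := (L - x) ^ (-β)) (by positivity)]
    have e1 : x ^ (β + 1 / 2 - 1) = x ^ (β - 1) * x ^ (1 / 2 : ℝ) := by
      rw [← Real.rpow_add hx0]; congr 1; ring
    have e2 : 1 - β - 1 = -β := by ring
    rw [e1, e2]
    have : 0 ≤ x ^ (β - 1) * (L - x) ^ (-β) := by positivity
    nlinarith [mul_le_mul_of_nonneg_left h1 this]
  -- Integrating `τ^(-β-1)` over `τ ≥ (L - x)/x` rebuilds the boundary weight `(L - x)^(-β)`; the
  -- factor `1/β` cancels the `β` of the Marchaud integral.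
  have hE : Integrable (fun q : ℝ × ℝ => if 0 < q.2 ∧ L ≤ q.1 * (1 + q.2) then
      q.2 ^ (-β - 1) * (P q.1 / q.1) else 0) ((volume.restrict (Ioo 0 L)).prod volume) ∧
      ∀ x ∈ Ioo 0 L, (∫ τ, if 0 < τ ∧ L ≤ x * (1 + τ) then τ ^ (-β - 1) * (P x / x) else 0) =
        1 / β * (x ^ (β - 1) * (P x * (L - x) ^ (-β))) := by
    have key : ∀ x ∈ Ioo 0 L, ∀ c : ℝ,
        Integrable (fun τ => if 0 < τ ∧ L ≤ x * (1 + τ) then τ ^ (-β - 1) * c else 0) ∧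
        (∫ τ, if 0 < τ ∧ L ≤ x * (1 + τ) then τ ^ (-β - 1) * c else 0) =
          1 / β * (((L - x) / x) ^ (-β) * c) := by
      intro x hx c
      have hx0 := hx.1
      have hxL : 0 < (L - x) / x := div_pos (by linarith [hx.2]) hx0
      have e : (fun τ => if 0 < τ ∧ L ≤ x * (1 + τ) then τ ^ (-β - 1) * c else 0) =
          (Ici ((L - x) / x)).indicator fun τ => τ ^ (-β - 1) * c := by
        funext τ
        by_cases hτ : (L - x) / x ≤ τ
        · have h2 := hτ
          rw [div_le_iff₀ hx0] at h2
          rw [indicator_of_mem (show τ ∈ Ici _ from hτ), if_pos ⟨hxL.trans_le hτ, by linarith⟩]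
        · rw [indicator_of_notMem (show τ ∉ Ici _ from hτ), if_neg]
          rintro ⟨-, h2⟩
          refine hτ ?_
          rw [div_le_iff₀ hx0]; linarith
      rw [e, integrable_indicator_iff measurableSet_Ici, integral_indicator measurableSet_Ici,
        integral_Ici_eq_integral_Ioi, integral_mul_const, integral_Ioi_rpow_of_lt (by linarith) hxL,
        integrableOn_Ici_iff_integrableOn_Ioi]
      refine ⟨(integrableOn_Ioi_rpow_of_lt (by linarith) hxL).mul_const c, ?_⟩
      have e2 : -β - 1 + 1 = -β := by ring
      rw [e2]; field_simp
    have hval : ∀ x ∈ Ioo 0 L, ((L - x) / x) ^ (-β) * (P x / x) =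
        x ^ (β - 1) * (P x * (L - x) ^ (-β)) := fun x hx => by
      have hx0 := hx.1
      rw [Real.div_rpow (by linarith [hx.2]) hx0.le, Real.rpow_sub_one hx0.ne',
        Real.rpow_neg hx0.le]
      have := Real.rpow_pos_of_pos hx0 β
      field_simp
    refine ⟨?_, fun x hx => by rw [(key x hx _).2, hval x hx]⟩
    have hm : Measurable (fun q : ℝ × ℝ => if 0 < q.2 ∧ L ≤ q.1 * (1 + q.2) then
        q.2 ^ (-β - 1) * (P q.1 / q.1) else 0) := by
      refine Measurable.ite ((measurableSet_lt measurable_const measurable_snd).inter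
        (measurableSet_le (g := fun q : ℝ × ℝ => q.1 * (1 + q.2)) measurable_const
          (by fun_prop))) ?_ measurable_const
      have h3 : Measurable fun q : ℝ × ℝ => P q.1 := hP.comp measurable_fst
      exact Measurable.mul (by fun_prop) (h3.div measurable_fst)
    rw [integrable_prod_iff hm.aestronglyMeasurable]
    refine ⟨ae_restrict_of_forall_mem measurableSet_Ioo fun x hx => (key x hx (P x / x)).1, ?_⟩
    refine (hA.norm.const_mul (1 / β)).congr
      (ae_restrict_of_forall_mem measurableSet_Ioo fun x hx => ?_)
    have : ∀ τ, ‖(if 0 < τ ∧ L ≤ x * (1 + τ) then τ ^ (-β - 1) * (P x / x) else 0)‖ =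
        if 0 < τ ∧ L ≤ x * (1 + τ) then τ ^ (-β - 1) * ‖P x / x‖ else 0 := by
      intro τ
      split_ifs with hτ
      · have := hτ.1
        rw [norm_mul, Real.norm_of_nonneg (by positivity)]
      · simp
    simp only [this]
    rw [(key x hx _).2, ← hval x hx, norm_mul]
    have : 0 < (L - x) / x := div_pos (by linarith [hx.2]) hx.1
    rw [Real.norm_of_nonneg (r := ((L - x) / x) ^ (-β)) (by positivity)]
  have hsnd : ∀ x ∈ Ioo 0 L,
      x ^ (β - 1) * (β * ∫ s in Ioo x L, (P x - P s) * (s - x) ^ (-β - 1)) =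
        β * ∫ τ, frullaniKernel β L P (x, τ) := fun x hx => by
    rw [integral_frullaniKernel_snd hx]; ring
  refine ⟨hA, ?_, ?_⟩
  · refine IntegrableOn.congr_fun (f := fun x => β * ∫ τ, frullaniKernel β L P (x, τ)) ?_
      (fun x hx => (hsnd x hx).symm) measurableSet_Ioo
    exact hD.integral_prod_left.const_mul β
  · rw [setIntegral_congr_fun measurableSet_Ioo hsnd, integral_const_mul,
      integral_integral_swap (f := fun x τ => frullaniKernel β L P (x, τ)) hD]
    have e1 : ∀ τ, ∫ x in Ioo 0 L, frullaniKernel β L P (x, τ) =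
        -∫ x in Ioo 0 L, if 0 < τ ∧ L ≤ x * (1 + τ) then τ ^ (-β - 1) * (P x / x) else 0 := by
      intro τ
      by_cases hτ : 0 < τ
      · rw [(integral_frullaniKernel_fst hP h hM hτ).2]
        simp [hτ]
      · simp [frullaniKernel, hτ]
    simp only [e1]
    rw [integral_neg, ← integral_integral_swap
      (f := fun x τ => if 0 < τ ∧ L ≤ x * (1 + τ) then τ ^ (-β - 1) * (P x / x) else 0) hE.1,
      setIntegral_congr_fun measurableSet_Ioo hE.2, integral_const_mul]
    field_simp

end Frullani

end FracBVP

namespace FracBVP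

open MeasureTheory Set

/-! ### The Marchaud derivative as inverse of the right Abel integral -/

section Abel

variable {β T M : ℝ} {p : ℝ → ℝ}

lemma setIntegral_Ioo_add_left (g : ℝ → ℝ) (a c d : ℝ) :
    ∫ y in Ioo (a + c) (a + d), g y = ∫ x in Ioo c d, g (a + x) := by
  rw [← integral_indicator measurableSet_Ioo, ← integral_indicator measurableSet_Ioo,
    ← integral_add_left_eq_self _ a]
  refine integral_congr_ae (Filter.Eventually.of_forall fun x => ?_)
  simp only [indicator, mem_Ioo, add_lt_add_iff_left]

/-- The right-sided Marchaud fractional derivative of order `β` on `[0, T]`. -/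
def marchaud (β T : ℝ) (p : ℝ → ℝ) (y : ℝ) : ℝ :=
  1 / Real.Gamma (1 - β) *
    (p y * (T - y) ^ (-β) + β * ∫ s in Ioo y T, (p y - p s) * (s - y) ^ (-β - 1))

lemma measurable_marchaud (hp : Measurable p) : Measurable (marchaud β T p) := by
  have e : ∀ y, ∫ s in Ioo y T, (p y - p s) * (s - y) ^ (-β - 1) =
      ∫ s, if y < s ∧ s < T then (p y - p s) * (s - y) ^ (-β - 1) else 0 := fun y => by
    rw [← integral_indicator measurableSet_Ioo]
    refine integral_congr_ae (Filter.Eventually.of_forall fun s => ?_)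
    simp only [indicator, mem_Ioo]
  have hm : Measurable (Function.uncurry fun y s : ℝ =>
      if y < s ∧ s < T then (p y - p s) * (s - y) ^ (-β - 1) else 0) := by
    refine Measurable.ite ((measurableSet_lt measurable_fst measurable_snd).inter
      (measurableSet_lt measurable_snd measurable_const)) ?_ measurable_const
    exact ((hp.comp measurable_fst).sub (hp.comp measurable_snd)).mul (by fun_prop)
  have h2 := (hm.stronglyMeasurable.integral_prod_right (ν := volume)).measurable
  unfold marchaud
  simp only [e]
  exact ((hp.mul (by fun_prop)).add (h2.const_mul β)).const_mul _

lemma integral_rpow_sub_right {c y T : ℝ} (hc : -1 < c) (hy : y ≤ T) :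
    IntegrableOn (fun s => (s - y) ^ c) (Ioo y T) ∧
      ∫ s in Ioo y T, (s - y) ^ c = (T - y) ^ (c + 1) / (c + 1) := by
  have h2 : ∫ s in Ioo y T, (s - y) ^ c = (T - y) ^ (c + 1) / (c + 1) := by
    have := setIntegral_Ioo_add_left (fun s => (s - y) ^ c) y 0 (T - y)
    rw [add_zero, add_sub_cancel] at this
    rw [this, ← integral_rpow_Ioo hc (by linarith)]
    simp
  refine ⟨?_, h2⟩
  rcases hy.eq_or_lt with rfl | hy
  · simp
  · by_contra h
    rw [integral_undef h] at h2
    have : 0 < (T - y) ^ (c + 1) / (c + 1) :=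
      div_pos (Real.rpow_pos_of_pos (by linarith) _) (by linarith)
    linarith

/-- Hölder exponent `1/2 > β` makes the difference integral converge, so the only blow-up is the
weight at `T`. -/
lemma marchaud_bound (hT : 0 < T) (h0 : 0 < β) (h1 : β < 1 / 2)
    (hM : ∀ x ∈ Icc 0 T, ∀ y ∈ Icc 0 T, |p x - p y| ≤ M * |x - y| ^ (1 / 2 : ℝ)) :
    ∃ C, ∀ y ∈ Ioo 0 T, |marchaud β T p y| ≤ C * (T - y) ^ (-β) := by
  have hM0 : 0 ≤ M := by
    have := (abs_nonneg _).trans (hM 0 ⟨le_rfl, hT.le⟩ T ⟨hT.le, le_rfl⟩)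
    have h2 : 0 < |0 - T| ^ (1 / 2 : ℝ) := Real.rpow_pos_of_pos (abs_pos.2 (by linarith)) _
    exact nonneg_of_mul_nonneg_left this h2
  have hG := Real.Gamma_pos_of_pos (s := 1 - β) (by linarith)
  have h2 : (0 : ℝ) < 1 / 2 - β := by linarith
  refine ⟨1 / Real.Gamma (1 - β) * ((|p 0| + M * T ^ (1 / 2 : ℝ)) +
    β * (M * (T ^ (1 / 2 : ℝ) / (1 / 2 - β)))), fun y hy => ?_⟩
  have hy0 := hy.1
  have hyT : 0 < T - y := by linarith [hy.2]
  have b1 : |p y| ≤ |p 0| + M * T ^ (1 / 2 : ℝ) := by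
    have h3 := hM y ⟨hy.1.le, hy.2.le⟩ 0 ⟨le_rfl, hT.le⟩
    rw [sub_zero, abs_of_pos hy0] at h3
    have h4 : y ^ (1 / 2 : ℝ) ≤ T ^ (1 / 2 : ℝ) := Real.rpow_le_rpow hy0.le hy.2.le (by norm_num)
    have h5 := abs_sub_abs_le_abs_sub (p y) (p 0)
    nlinarith
  have b2 : |∫ s in Ioo y T, (p y - p s) * (s - y) ^ (-β - 1)| ≤
      M * (T ^ (1 / 2 : ℝ) / (1 / 2 - β)) * (T - y) ^ (-β) := by
    obtain ⟨i1, i2⟩ := integral_rpow_sub_right (c := -β - 1 / 2) (y := y) (T := T) (by linarith)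
      hy.2.le
    have h3 : |∫ s in Ioo y T, (p y - p s) * (s - y) ^ (-β - 1)| ≤
        ∫ s in Ioo y T, M * (s - y) ^ (-β - 1 / 2) := by
      rw [← Real.norm_eq_abs]
      refine norm_integral_le_of_norm_le (i1.const_mul M)
        (ae_restrict_of_forall_mem measurableSet_Ioo fun s hs => ?_)
      have hs0 : 0 < s - y := by linarith [hs.1]
      have h4 := hM y ⟨hy.1.le, hy.2.le⟩ s ⟨by linarith, hs.2.le⟩
      rw [abs_sub_comm y s, abs_of_pos hs0] at h4
      rw [norm_mul, Real.norm_eq_abs, Real.norm_of_nonneg (by positivity)]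
      refine (mul_le_mul_of_nonneg_right h4 (by positivity)).trans_eq ?_
      rw [mul_assoc, ← Real.rpow_add hs0]
      congr 2; ring
    refine h3.trans ?_
    rw [integral_const_mul, i2]
    have e1 : -β - 1 / 2 + 1 = 1 / 2 + -β := by ring
    have e2 : (1 / 2 + -β : ℝ) = 1 / 2 - β := by ring
    rw [e1, Real.rpow_add hyT, e2, mul_assoc, div_mul_eq_mul_div]
    have : (T - y) ^ (1 / 2 : ℝ) ≤ T ^ (1 / 2 : ℝ) :=
      Real.rpow_le_rpow hyT.le (by linarith) (by norm_num)
    gcongr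
  rw [marchaud, abs_mul, abs_of_pos (a := 1 / Real.Gamma (1 - β)) (by positivity), mul_assoc]
  refine mul_le_mul_of_nonneg_left ((abs_add_le _ _).trans ?_) (by positivity)
  rw [add_mul, abs_mul, abs_mul, abs_of_pos h0, abs_of_pos (Real.rpow_pos_of_pos hyT _), mul_assoc β]
  gcongr

/-- After subtracting `p a` and moving the origin to `a`, the constant part contributes `B(β, 1 - β)
= Γ(β) Γ(1 - β)`, which gives `p a`. The two terms in `P` cancel by `marchaud_cancellation`. -/
lemma abel_inversion (h0 : 0 < β) (h1 : β < 1 / 2) (hp : Measurable p)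
    (hM : ∀ x ∈ Icc 0 T, ∀ y ∈ Icc 0 T, |p x - p y| ≤ M * |x - y| ^ (1 / 2 : ℝ))
    {a : ℝ} (ha : a ∈ Ico 0 T) :
    kernelInt (volume.restrict (Icc 0 T)) (rightKernel β) (marchaud β T p) a = p a := by
  set L := T - a with hL
  have hL0 : 0 < L := by rw [hL]; linarith [ha.2]
  have hG1 := Real.Gamma_pos_of_pos (s := 1 - β) (by linarith)
  have hG := Real.Gamma_pos_of_pos h0
  set P : ℝ → ℝ := fun x => p (a + x) - p a with hP
  have hPm : Measurable P := (hp.comp (by fun_prop)).sub measurable_const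
  have hPM : ∀ x ∈ Icc 0 L, ∀ y ∈ Icc 0 L, |P x - P y| ≤ M * |x - y| ^ (1 / 2 : ℝ) := by
    intro x hx y hy
    have := hM (a + x) ⟨by linarith [ha.1, hx.1], by linarith [hx.2]⟩
      (a + y) ⟨by linarith [ha.1, hy.1], by linarith [hy.2]⟩
    simpa [hP] using this
  obtain ⟨i1, i2, i3⟩ := marchaud_cancellation h0 h1 hPm (by simp [hP]) hPM
  have i0 : IntegrableOn (fun x => x ^ (β - 1) * (L - x) ^ (-β)) (Ioo 0 L) ∧
      ∫ x in Ioo 0 L, x ^ (β - 1) * (L - x) ^ (-β) = Real.Gamma β * Real.Gamma (1 - β) := by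
    have hr : 0 < 1 - β := by linarith
    have e : (fun x => x ^ (β - 1) * (L - x) ^ (-β)) =
        fun x => x ^ (β - 1) * (L - x) ^ (1 - β - 1) := by
      funext x; congr 2; ring
    refine ⟨by rw [e]; exact integrableOn_rpow_mul_rpow h0 hr, ?_⟩
    have h2 := (rlKernel_semigroup hr h0 L 0).2
    rw [sub_zero, sub_add_cancel, rlKernel_one_of_pos hL0] at h2
    rw [← setIntegral_eq_integral_of_forall_compl_eq_zero (s := Ioo 0 L)] at h2
    · have h3 : ∫ x in Ioo 0 L, rlKernel (1 - β) (L - x) * rlKernel β (x - 0) =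
          ∫ x in Ioo 0 L, (Real.Gamma β * Real.Gamma (1 - β))⁻¹ *
            (x ^ (β - 1) * (L - x) ^ (-β)) := by
        refine setIntegral_congr_fun measurableSet_Ioo fun x hx => ?_
        rw [sub_zero, rlKernel_of_pos hx.1, rlKernel_of_pos (x := L - x) (by linarith [hx.2])]
        have e3 : 1 - β - 1 = -β := by ring
        rw [e3]
        field_simp
      rw [h3, integral_const_mul] at h2
      field_simp at h2
      linarith
    · intro x hx
      rcases le_or_gt x 0 with h | h
      · rw [rlKernel_of_nonpos (x := x - 0) (by linarith), mul_zero]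
      · have : L ≤ x := by
          by_contra h'
          exact hx ⟨h, not_le.1 h'⟩
        rw [rlKernel_of_nonpos (x := L - x) (by linarith), zero_mul]
  have hT' : a + L = T := by rw [hL]; ring
  have e1 : kernelInt (volume.restrict (Icc 0 T)) (rightKernel β) (marchaud β T p) a =
      ∫ x in Ioo 0 L, rlKernel β x * marchaud β T p (a + x) := by
    have h2 := setIntegral_Ioo_add_left
      (fun y => rlKernel β (y - a) * marchaud β T p y) a 0 L
    rw [add_zero, hT'] at h2
    have h3 : ∀ x, a + x - a = x := fun x => by ring
    simp only [h3] at h2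
    rw [← h2, kernelInt, ← setIntegral_congr_set Ico_ae_eq_Icc,
      setIntegral_eq_of_subset_of_forall_sdiff_eq_zero (s := Ioo a T) measurableSet_Ico]
    · rfl
    · exact fun y hy => ⟨ha.1.trans hy.1.le, hy.2⟩
    · intro y hy
      have : y ≤ a := by
        by_contra h'
        exact hy.2 ⟨not_le.1 h', hy.1.2⟩
      rw [rightKernel, rlKernel_of_nonpos (by linarith), zero_mul]
  have e2 : ∀ x ∈ Ioo 0 L, rlKernel β x * marchaud β T p (a + x) =
      (Real.Gamma β * Real.Gamma (1 - β))⁻¹ * (p a * (x ^ (β - 1) * (L - x) ^ (-β)) +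
        (x ^ (β - 1) * (P x * (L - x) ^ (-β)) +
        x ^ (β - 1) * (β * ∫ s in Ioo x L, (P x - P s) * (s - x) ^ (-β - 1)))) := by
    intro x hx
    have h2 := setIntegral_Ioo_add_left
      (fun s => (p (a + x) - p s) * (s - (a + x)) ^ (-β - 1)) a x L
    rw [hT'] at h2
    have h3 : ∀ s, (p (a + x) - p (a + s)) * (a + s - (a + x)) ^ (-β - 1) =
        (P x - P s) * (s - x) ^ (-β - 1) := fun s => by
      simp only [hP, sub_sub_sub_cancel_right, add_sub_add_left_eq_sub]
    simp only [h3] at h2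
    have e3 : T - (a + x) = L - x := by rw [hL]; ring
    have e4 : p (a + x) = p a + P x := by simp [hP]
    rw [marchaud, h2, e3, rlKernel_of_pos hx.1, e4]
    field_simp
    ring
  have e3 : ∫ x in Ioo 0 L, (p a * (x ^ (β - 1) * (L - x) ^ (-β)) +
        (x ^ (β - 1) * (P x * (L - x) ^ (-β)) +
        x ^ (β - 1) * (β * ∫ s in Ioo x L, (P x - P s) * (s - x) ^ (-β - 1)))) =
      (∫ x in Ioo 0 L, p a * (x ^ (β - 1) * (L - x) ^ (-β))) +
        ((∫ x in Ioo 0 L, x ^ (β - 1) * (P x * (L - x) ^ (-β))) + ∫ x in Ioo 0 L,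
          x ^ (β - 1) * (β * ∫ s in Ioo x L, (P x - P s) * (s - x) ^ (-β - 1))) := by
    rw [← integral_add i1 i2]
    exact integral_add (i0.1.const_mul _) (i1.add i2)
  rw [e1, setIntegral_congr_fun measurableSet_Ioo e2, integral_const_mul, e3, i3,
    integral_const_mul, i0.2]
  field_simp
  ring

end Abel

/-! ### Hölder regularity of the weighted fractional integral -/

section Holder

variable {β T D : ℝ} {d : ℝ → ℝ}

/-- Half an order of the kernel is traded for half a power of the increment. When both arguments are
positive, with `A = y - x` and `B = s - y`, it follows from `(A/(A+B))^β ≥ A/(A+B)` and `B/(A+B) ≤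
(B/A)^(1/2)`. -/
lemma rlKernel_sub_le (h0 : 0 < β) (h1 : β < 1 / 2) {x s y : ℝ} (hys : y < s) :
    |rlKernel (1 - β) (s - x) - rlKernel (1 - β) (y - x)| ≤
      Real.Gamma (1 / 2 - β) / Real.Gamma (1 - β) * (s - y) ^ (1 / 2 : ℝ) *
        (rlKernel (1 / 2 - β) (s - x) + rlKernel (1 / 2 - β) (y - x)) := by
  have hG := Real.Gamma_pos_of_pos (s := 1 - β) (by linarith)
  have hG2 := Real.Gamma_pos_of_pos (s := 1 / 2 - β) (by linarith)
  have hδ : 0 < s - y := by linarith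
  rcases le_or_gt s x with h | h
  · rw [rlKernel_of_nonpos (x := s - x) (by linarith), rlKernel_of_nonpos (x := y - x) (by linarith),
      rlKernel_of_nonpos (x := s - x) (by linarith), rlKernel_of_nonpos (x := y - x) (by linarith)]
    simp
  have hs : 0 < s - x := by linarith
  have e3 : 1 - β - 1 = -β := by ring
  have e4 : 1 / 2 - β - 1 = -β - 1 / 2 := by ring
  rcases le_or_gt y x with h' | h'
  · rw [rlKernel_of_nonpos (x := y - x) (by linarith), rlKernel_of_nonpos (x := y - x) (by linarith),
      sub_zero, add_zero, abs_of_nonneg (rlKernel_nonneg (by linarith) _), rlKernel_of_pos hs,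
      rlKernel_of_pos hs, e3, e4]
    have : (s - x) ^ (1 / 2 : ℝ) ≤ (s - y) ^ (1 / 2 : ℝ) :=
      Real.rpow_le_rpow hs.le (by linarith) (by norm_num)
    have e5 : (s - x) ^ (-β) = (s - x) ^ (1 / 2 : ℝ) * (s - x) ^ (-β - 1 / 2) := by
      rw [← Real.rpow_add hs]; congr 1; ring
    rw [e5]
    generalize Real.Gamma (1 / 2 - β) = g₂ at *
    have hw : 0 ≤ (s - x) ^ (-β - 1 / 2) := by positivity
    generalize (s - x) ^ (-β - 1 / 2) = w at *
    calc (s - x) ^ (1 / 2 : ℝ) * w / Real.Gamma (1 - β)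
        ≤ (s - y) ^ (1 / 2 : ℝ) * w / Real.Gamma (1 - β) := by gcongr
      _ = _ := by field_simp
  · have hy : 0 < y - x := by linarith
    rw [rlKernel_of_pos hs, rlKernel_of_pos hs, rlKernel_of_pos hy, rlKernel_of_pos hy, e3, e4]
    have hmono : (s - x) ^ (-β) ≤ (y - x) ^ (-β) :=
      Real.rpow_le_rpow_of_nonpos hy (by linarith) (by linarith)
    have key : (y - x) ^ (-β) - (s - x) ^ (-β) ≤
        (s - y) ^ (1 / 2 : ℝ) * (y - x) ^ (-β - 1 / 2) := by
      set A := y - x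
      set B := s - y
      have e5 : s - x = A + B := by simp only [A, B]; ring
      have hAB : 0 < A + B := by linarith
      have e6 : (y - x) ^ (-β - 1 / 2) = A ^ (-β) * (A ^ (1 / 2 : ℝ))⁻¹ := by
        rw [← Real.rpow_neg hy.le, ← Real.rpow_add hy]; rfl
      have hq : (A / (A + B)) ^ (1 : ℝ) ≤ (A / (A + B)) ^ β :=
        Real.rpow_le_rpow_of_exponent_ge (by positivity) (by rw [div_le_one hAB]; linarith)
          (by linarith)
      have e7 : (A + B) ^ (-β) = A ^ (-β) * (A / (A + B)) ^ β := by
        rw [Real.div_rpow hy.le hAB.le, Real.rpow_neg hAB.le, Real.rpow_neg hy.le]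
        have := Real.rpow_pos_of_pos hy β
        have := Real.rpow_pos_of_pos hAB β
        field_simp
      have hAβ : 0 < A ^ (-β) := Real.rpow_pos_of_pos hy _
      rw [e5, e6, e7]
      have hsq : 1 - A / (A + B) ≤ B ^ (1 / 2 : ℝ) * (A ^ (1 / 2 : ℝ))⁻¹ := by
        have e8 : 1 - A / (A + B) = B / (A + B) := by field_simp; ring
        have hb : 0 < B ^ (1 / 2 : ℝ) := Real.rpow_pos_of_pos hδ _
        have ha : 0 < A ^ (1 / 2 : ℝ) := Real.rpow_pos_of_pos hy _
        have hA2 : A ^ (1 / 2 : ℝ) * A ^ (1 / 2 : ℝ) = A := by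
          rw [← Real.rpow_add hy]; norm_num
        have hB2 : B ^ (1 / 2 : ℝ) * B ^ (1 / 2 : ℝ) = B := by
          rw [← Real.rpow_add hδ]; norm_num
        rw [e8, ← div_eq_mul_inv, div_le_div_iff₀ hAB ha]
        nlinarith [sq_nonneg (B ^ (1 / 2 : ℝ) - A ^ (1 / 2 : ℝ)), mul_pos hb ha,
          mul_pos hb hδ, mul_pos hb hy, mul_pos (mul_pos hb ha) hb, mul_pos (mul_pos hb ha) ha]
      rw [Real.rpow_one] at hq
      nlinarith
    have key2 : 0 ≤ (s - y) ^ (1 / 2 : ℝ) * (s - x) ^ (-β - 1 / 2) := by positivity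
    rw [← sub_div, abs_div, abs_of_pos hG, abs_of_nonpos (by linarith)]
    generalize Real.Gamma (1 / 2 - β) = g₂ at *
    generalize Real.Gamma (1 - β) = g₁ at *
    have e8 : g₂ / g₁ * (s - y) ^ (1 / 2 : ℝ) *
        ((s - x) ^ (-β - 1 / 2) / g₂ + (y - x) ^ (-β - 1 / 2) / g₂) =
        ((s - y) ^ (1 / 2 : ℝ) * (s - x) ^ (-β - 1 / 2) +
          (s - y) ^ (1 / 2 : ℝ) * (y - x) ^ (-β - 1 / 2)) / g₁ := by
      rw [← add_div, ← mul_add]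
      generalize (s - x) ^ (-β - 1 / 2) + (y - x) ^ (-β - 1 / 2) = w
      field_simp
    rw [e8]
    gcongr
    linarith

/-- Functions dominated by `x^(-β)` have integrable products with Riemann–Liouville kernels. -/
lemma integrable_rlKernel_mul_of_bound {γ : ℝ} (hγ : 0 < γ) (h1 : β < 1) (hd : Measurable d)
    (hD : ∀ x ∈ Ioo 0 T, |d x| ≤ D * x ^ (-β)) {t : ℝ} (ht : t ∈ Icc 0 T) :
    Integrable (fun x => rlKernel γ (t - x) * d x) (volume.restrict (Icc 0 T)) ∧
      ∫ x in Icc 0 T, rlKernel γ (t - x) * |d x| ≤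
        D * Real.Gamma (1 - β) * rlKernel (γ + (1 - β)) t := by
  have hr : 0 < 1 - β := by linarith
  have hG := Real.Gamma_pos_of_pos hr
  obtain ⟨i1, i2⟩ := rlKernel_integral_restrict (T := T) (t := t) (r := 0) hγ hr ht
    ⟨le_rfl, ht.1.trans ht.2⟩
  have hb : ∀ᵐ x ∂volume.restrict (Icc 0 T), rlKernel γ (t - x) * |d x| ≤
      D * Real.Gamma (1 - β) * (rlKernel γ (t - x) * rlKernel (1 - β) (x - 0)) := by
    filter_upwards [ae_mem_Ioo T] with x hx
    have h2 := hD x hx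
    have e : x ^ (-β) = Real.Gamma (1 - β) * rlKernel (1 - β) (x - 0) := by
      rw [sub_zero, rlKernel_of_pos hx.1]
      have : 1 - β - 1 = -β := by ring
      rw [this]; field_simp
    rw [e] at h2
    have := mul_le_mul_of_nonneg_left h2 (rlKernel_nonneg hγ (t - x))
    linarith
  have hmeas : AEStronglyMeasurable (fun x => rlKernel γ (t - x) * d x)
      (volume.restrict (Icc 0 T)) := Measurable.aestronglyMeasurable (by fun_prop)
  have h_int : Integrable (fun x => rlKernel γ (t - x) * d x) (volume.restrict (Icc 0 T)) := by
    refine (i1.const_mul (D * Real.Gamma (1 - β))).mono' hmeas ?_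
    filter_upwards [hb] with x hx
    rw [norm_mul, Real.norm_of_nonneg (rlKernel_nonneg hγ _), Real.norm_eq_abs]
    exact hx
  refine ⟨h_int, ?_⟩
  have h3 : Integrable (fun x => rlKernel γ (t - x) * |d x|) (volume.restrict (Icc 0 T)) := by
    refine h_int.norm.congr (Filter.Eventually.of_forall fun x => ?_)
    simp only [norm_mul, Real.norm_eq_abs, abs_of_nonneg (rlKernel_nonneg hγ (t - x))]
  refine (integral_mono_ae h3 (i1.const_mul _) hb).trans_eq ?_
  rw [integral_const_mul, i2, sub_zero]

/-- By `rlKernel_sub_le` the unweighted integral has increments of size `|s - y|^(1/2)` times the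
powers `s^(1/2-2β)` and `y^(1/2-2β)`, possibly singular at `0`; the weight with exponent `2β`
absorbs them. The increment of the weight is compensated by the decay `s^(1-2β)` of the integral. -/
lemma holder_weighted_integral (h0 : 0 < β) (h1 : β < 1 / 2) (hd : Measurable d)
    (hD : ∀ x ∈ Ioo 0 T, |d x| ≤ D * x ^ (-β)) (hD0 : 0 ≤ D) :
    ∃ M, ∀ s ∈ Icc 0 T, ∀ y ∈ Icc 0 T,
      |s ^ (2 * β) * kernelInt (volume.restrict (Icc 0 T)) (leftKernel (1 - β)) d s -
        y ^ (2 * β) * kernelInt (volume.restrict (Icc 0 T)) (leftKernel (1 - β)) d y| ≤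
        M * |s - y| ^ (1 / 2 : ℝ) := by
  set q := kernelInt (volume.restrict (Icc 0 T)) (leftKernel (1 - β)) d with hq
  have hr : 0 < 1 - β := by linarith
  have hG := Real.Gamma_pos_of_pos hr
  have hG2 := Real.Gamma_pos_of_pos (s := 1 / 2 - β) (by linarith)
  set K := D * Real.Gamma (1 - β) with hK
  have hK0 : 0 ≤ K := by positivity
  set c₁ := (Real.Gamma (2 - 2 * β))⁻¹ with hc₁
  have hc₁0 : 0 < c₁ := inv_pos.2 (Real.Gamma_pos_of_pos (by linarith))
  set c₂ := (Real.Gamma (3 / 2 - 2 * β))⁻¹ with hc₂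
  have hc₂0 : 0 < c₂ := inv_pos.2 (Real.Gamma_pos_of_pos (by linarith))
  set R := Real.Gamma (1 / 2 - β) / Real.Gamma (1 - β) with hR
  have hR0 : 0 < R := by positivity
  have hqb : ∀ s ∈ Icc 0 T, 0 < s → |q s| ≤ K * (s ^ (1 - 2 * β) * c₁) := fun s hs hs0 => by
    obtain ⟨i1, i2⟩ := integrable_rlKernel_mul_of_bound hr (by linarith) hd hD hs
    have h2 : |q s| ≤ ∫ x in Icc 0 T, rlKernel (1 - β) (s - x) * |d x| := by
      rw [← Real.norm_eq_abs]
      refine (norm_integral_le_integral_norm _).trans_eq ?_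
      refine integral_congr_ae (Filter.Eventually.of_forall fun x => ?_)
      simp only [norm_mul, Real.norm_eq_abs, leftKernel,
        abs_of_nonneg (rlKernel_nonneg hr (s - x))]
    refine h2.trans (i2.trans_eq ?_)
    rw [rlKernel_of_pos hs0, hc₁]
    have e : 1 - β + (1 - β) - 1 = 1 - 2 * β := by ring
    have e2 : 1 - β + (1 - β) = 2 - 2 * β := by ring
    rw [e, e2, div_eq_mul_inv]
  have hhalf : ∀ s ∈ Icc 0 T, 0 < s →
      Integrable (fun x => rlKernel (1 / 2 - β) (s - x) * |d x|) (volume.restrict (Icc 0 T)) ∧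
      ∫ x in Icc 0 T, rlKernel (1 / 2 - β) (s - x) * |d x| ≤
        K * (s ^ (1 / 2 - 2 * β) * c₂) := fun s hs hs0 => by
    have hr2 : 0 < 1 / 2 - β := by linarith
    obtain ⟨i1, i2⟩ := integrable_rlKernel_mul_of_bound hr2 (by linarith) hd hD hs
    refine ⟨i1.norm.congr (Filter.Eventually.of_forall fun x => ?_), i2.trans_eq ?_⟩
    · simp only [norm_mul, Real.norm_eq_abs, abs_of_nonneg (rlKernel_nonneg hr2 (s - x))]
    rw [rlKernel_of_pos hs0, hc₂]
    have e : 1 / 2 - β + (1 - β) - 1 = 1 / 2 - 2 * β := by ring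
    have e2 : 1 / 2 - β + (1 - β) = 3 / 2 - 2 * β := by ring
    rw [e, e2, div_eq_mul_inv]
  set M := T ^ (1 / 2 : ℝ) * (R * K * c₂ * 2 + K * c₁) with hM
  have hM0 : 0 ≤ M := by
    rcases le_or_gt 0 T with h | h
    · positivity
    -- For negative `T` the real power `T ^ (1/2)` carries the factor `cos(π/2) = 0`.
    · rw [hM, Real.rpow_def_of_neg h]
      have : Real.cos (1 / 2 * Real.pi) = 0 := by
        rw [one_div, inv_mul_eq_div]; exact Real.cos_pi_div_two
      rw [this]; simp
  refine ⟨M, ?_⟩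
  have main : ∀ s ∈ Icc 0 T, ∀ y ∈ Icc 0 T, y < s →
      |s ^ (2 * β) * q s - y ^ (2 * β) * q y| ≤ M * |s - y| ^ (1 / 2 : ℝ) := by
    intro s hs y hy hys
    have hs0 : 0 < s := hy.1.trans_lt hys
    have hδ : 0 < s - y := by linarith
    rw [abs_of_pos hδ]
    have hT0 : 0 < T := hs0.trans_le hs.2
    have hsT : s ^ (1 / 2 : ℝ) ≤ T ^ (1 / 2 : ℝ) := Real.rpow_le_rpow hs0.le hs.2 (by norm_num)
    have hδ2 : s - y = (s - y) ^ (1 / 2 : ℝ) * (s - y) ^ (1 / 2 : ℝ) := by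
      rw [← Real.rpow_add hδ]; norm_num
    have hδs : (s - y) ^ (1 / 2 : ℝ) ≤ T ^ (1 / 2 : ℝ) :=
      Real.rpow_le_rpow hδ.le (by linarith [hs.2, hy.1]) (by norm_num)
    have hδp : 0 < (s - y) ^ (1 / 2 : ℝ) := Real.rpow_pos_of_pos hδ _
    -- the increment of the weight
    have b1 : (s ^ (2 * β) - y ^ (2 * β)) * |q s| ≤ K * c₁ * (T ^ (1 / 2 : ℝ)
        * (s - y) ^ (1 / 2 : ℝ)) := by
      have hys1 : (y / s) ^ (1 : ℝ) ≤ (y / s) ^ (2 * β) := by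
        rcases hy.1.eq_or_lt with h | h
        · rw [← h]; simp [Real.zero_rpow (show 2 * β ≠ 0 by positivity)]
        · exact Real.rpow_le_rpow_of_exponent_ge (by positivity)
            (by rw [div_le_one hs0]; exact hys.le) (by linarith)
      rw [Real.rpow_one, Real.div_rpow hy.1 hs0.le] at hys1
      have hw : 0 ≤ s ^ (2 * β) - y ^ (2 * β) := by
        have := Real.rpow_le_rpow hy.1 hys.le (show 0 ≤ 2 * β by linarith)
        linarith
      have hsβ := Real.rpow_pos_of_pos hs0 (2 * β)
      have e : s ^ (2 * β) * s ^ (1 - 2 * β) = s := by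
        rw [← Real.rpow_add hs0]; simp
      have h3 : (s ^ (2 * β) - y ^ (2 * β)) * s ^ (1 - 2 * β) ≤ s - y := by
        rw [div_le_div_iff₀ hs0 hsβ] at hys1
        have hp := Real.rpow_pos_of_pos hs0 (1 - 2 * β)
        have h4 : y * (s ^ (2 * β) * s ^ (1 - 2 * β)) ≤ y ^ (2 * β) * s * s ^ (1 - 2 * β) := by
          nlinarith
        rw [e] at h4
        have h5 : y ≤ y ^ (2 * β) * s ^ (1 - 2 * β) := by
          have : s * y ≤ s * (y ^ (2 * β) * s ^ (1 - 2 * β)) := by linarith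
          exact le_of_mul_le_mul_left this hs0
        rw [sub_mul, e]
        linarith
      calc (s ^ (2 * β) - y ^ (2 * β)) * |q s|
          ≤ (s ^ (2 * β) - y ^ (2 * β)) * (K * (s ^ (1 - 2 * β) * c₁)) :=
            mul_le_mul_of_nonneg_left (hqb s hs hs0) hw
        _ = K * c₁ * ((s ^ (2 * β) - y ^ (2 * β)) * s ^ (1 - 2 * β)) := by ring
        _ ≤ K * c₁ * (s - y) := by gcongr
        _ ≤ _ := by
          gcongr
          calc s - y = (s - y) ^ (1 / 2 : ℝ) * (s - y) ^ (1 / 2 : ℝ) := hδ2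
            _ ≤ _ := by gcongr
    -- the increment of the integral
    have b2 : y ^ (2 * β) * |q s - q y| ≤ R * K * c₂ * 2 * (T ^ (1 / 2 : ℝ)
        * (s - y) ^ (1 / 2 : ℝ)) := by
      rcases hy.1.eq_or_lt with h | hy0
      · rw [← h, Real.zero_rpow (by positivity), zero_mul]
        positivity
      obtain ⟨j1, j2⟩ := hhalf s hs hs0
      obtain ⟨k1, k2⟩ := hhalf y hy hy0
      have i1 := (integrable_rlKernel_mul_of_bound hr (by linarith) hd hD hs).1
      have i2 := (integrable_rlKernel_mul_of_bound hr (by linarith) hd hD hy).1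
      have h2 : |q s - q y| ≤ ∫ x in Icc 0 T, R * (s - y) ^ (1 / 2 : ℝ) *
          (rlKernel (1 / 2 - β) (s - x) * |d x| + rlKernel (1 / 2 - β) (y - x) * |d x|) := by
        have e : q s - q y = ∫ x in Icc 0 T, (rlKernel (1 - β) (s - x) * d x -
            rlKernel (1 - β) (y - x) * d x) := (integral_sub i1 i2).symm
        rw [e, ← Real.norm_eq_abs]
        refine norm_integral_le_of_norm_le (show Integrable (fun x => R * (s - y) ^ (1 / 2 : ℝ) *
          (rlKernel (1 / 2 - β) (s - x) * |d x| + rlKernel (1 / 2 - β) (y - x) * |d x|)) _ from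
          (j1.add k1).const_mul _)
          (Filter.Eventually.of_forall fun x => ?_)
        rw [← sub_mul, norm_mul, Real.norm_eq_abs, Real.norm_eq_abs, ← add_mul, ← mul_assoc]
        exact mul_le_mul_of_nonneg_right (rlKernel_sub_le h0 h1 hys) (abs_nonneg _)
      rw [integral_const_mul, integral_add j1 k1] at h2
      have h3 : |q s - q y| ≤ R * (s - y) ^ (1 / 2 : ℝ) *
          (K * (s ^ (1 / 2 - 2 * β) * c₂) + K * (y ^ (1 / 2 - 2 * β) * c₂)) :=
        h2.trans (by gcongr)
      have hyβ := Real.rpow_pos_of_pos hy0 (2 * β)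
      have f1 : y ^ (2 * β) * s ^ (1 / 2 - 2 * β) ≤ T ^ (1 / 2 : ℝ) := by
        have : y ^ (2 * β) ≤ s ^ (2 * β) := Real.rpow_le_rpow hy.1 hys.le (by linarith)
        calc y ^ (2 * β) * s ^ (1 / 2 - 2 * β) ≤ s ^ (2 * β) * s ^ (1 / 2 - 2 * β) := by gcongr
          _ = s ^ (1 / 2 : ℝ) := by rw [← Real.rpow_add hs0]; congr 1; ring
          _ ≤ _ := hsT
      have f2 : y ^ (2 * β) * y ^ (1 / 2 - 2 * β) ≤ T ^ (1 / 2 : ℝ) := by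
        have e : y ^ (2 * β) * y ^ (1 / 2 - 2 * β) = y ^ (1 / 2 : ℝ) := by
          rw [← Real.rpow_add hy0]; congr 1; ring
        rw [e]
        exact Real.rpow_le_rpow hy0.le hy.2 (by norm_num)
      calc y ^ (2 * β) * |q s - q y| ≤ y ^ (2 * β) * (R * (s - y) ^ (1 / 2 : ℝ) *
          (K * (s ^ (1 / 2 - 2 * β) * c₂) + K * (y ^ (1 / 2 - 2 * β) * c₂))) := by gcongr
        _ = R * K * c₂ * (s - y) ^ (1 / 2 : ℝ) * (y ^ (2 * β) * s ^ (1 / 2 - 2 * β) +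
            y ^ (2 * β) * y ^ (1 / 2 - 2 * β)) := by ring
        _ ≤ R * K * c₂ * (s - y) ^ (1 / 2 : ℝ) * (T ^ (1 / 2 : ℝ) + T ^ (1 / 2 : ℝ)) := by gcongr
        _ = _ := by ring
    have e : s ^ (2 * β) * q s - y ^ (2 * β) * q y =
        y ^ (2 * β) * (q s - q y) + (s ^ (2 * β) - y ^ (2 * β)) * q s := by ring
    have hw : 0 ≤ s ^ (2 * β) - y ^ (2 * β) := by
      have := Real.rpow_le_rpow hy.1 hys.le (show 0 ≤ 2 * β by linarith)
      linarith
    rw [e]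
    refine (abs_add_le _ _).trans ?_
    rw [abs_mul, abs_mul, abs_of_nonneg hw, abs_of_nonneg (Real.rpow_nonneg hy.1 _)]
    calc _ ≤ _ := add_le_add b2 b1
      _ = _ := by rw [hM]; ring
  intro s hs y hy
  rcases lt_trichotomy y s with h | h | h
  · exact main s hs y hy h
  · rw [h]; simp
  · rw [abs_sub_comm, abs_sub_comm s y]
    exact main y hy s hs h

end Holder

end FracBVP

namespace FracBVP

open MeasureTheory Set

/-! ### The two-sided Abel equation -/

section TwoSided

variable {β T C : ℝ} {v : ℝ → ℝ}

lemma integrable_rlKernel_left_mul (h0 : 0 < β) (h1 : β < 1 / 2) (hv : Measurable v)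
    (hC : ∀ y ∈ Ioo 0 T, |v y| ≤ C * (y ^ (-β) * (T - y) ^ (-β))) (hC0 : 0 ≤ C)
    {t : ℝ} (ht : t ∈ Ioo 0 T) :
    Integrable (fun y => rlKernel (2 * β) (t - y) * v y) (volume.restrict (Icc 0 T)) := by
  have h2 : 0 < 2 * β := by linarith
  have hr : 0 < 1 - β := by linarith
  have hG := Real.Gamma_pos_of_pos hr
  refine ((rlKernel_semigroup h2 hr t 0).1.integrableOn.const_mul
    (C * (T - t) ^ (-β) * Real.Gamma (1 - β))).mono'
    (Measurable.aestronglyMeasurable (((measurable_rlKernel _).comp (by fun_prop)).mul hv)) ?_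
  filter_upwards [ae_mem_Ioo T] with y hy
  rcases le_or_gt t y with h | h
  · rw [rlKernel_of_nonpos (x := t - y) (by linarith)]; simp
  · have e : 1 - β - 1 = -β := by ring
    rw [norm_mul, Real.norm_of_nonneg (rlKernel_nonneg h2 _), sub_zero,
      rlKernel_of_pos (γ := 1 - β) hy.1, e, Real.norm_eq_abs]
    have h3 : (T - y) ^ (-β) ≤ (T - t) ^ (-β) :=
      Real.rpow_le_rpow_of_nonpos (by linarith [ht.2]) (by linarith) (by linarith)
    have h4 := Real.rpow_nonneg hy.1.le (-β)
    calc rlKernel (2 * β) (t - y) * |v y|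
        ≤ rlKernel (2 * β) (t - y) * (C * (y ^ (-β) * (T - t) ^ (-β))) :=
          mul_le_mul_of_nonneg_left ((hC y hy).trans (by gcongr)) (rlKernel_nonneg h2 _)
      _ = _ := by field_simp

lemma integrable_rlKernel_right_mul (h0 : 0 < β) (h1 : β < 1 / 2) (hv : Measurable v)
    (hC : ∀ y ∈ Ioo 0 T, |v y| ≤ C * (y ^ (-β) * (T - y) ^ (-β))) (hC0 : 0 ≤ C)
    {t : ℝ} (ht : t ∈ Ioo 0 T) :
    Integrable (fun y => rlKernel (2 * β) (y - t) * v y) (volume.restrict (Icc 0 T)) := by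
  have hm : Measurable (fun y => v (T - y)) := hv.comp (by fun_prop)
  have h := integrable_rlKernel_left_mul (T := T) (t := T - t) h0 h1 hm
    (fun y hy => by
      have := hC (T - y) ⟨by linarith [hy.2], by linarith [hy.1]⟩
      rwa [sub_sub_cancel, mul_comm ((T - y) ^ (-β))] at this) hC0
    ⟨by linarith [ht.2], by linarith [ht.1]⟩
  have h2 := (Measure.measurePreserving_sub_left volume T).restrict_preimage
    (measurableSet_Icc (a := (0 : ℝ)) (b := T))
  have e : (fun x => T - x) ⁻¹' Icc 0 T = Icc 0 T := by ext x; simp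
  rw [e] at h2
  have h3 := (h2.integrable_comp h.aestronglyMeasurable).2 h
  refine h3.congr (Filter.Eventually.of_forall fun y => ?_)
  simp only [Function.comp, sub_sub_cancel]
  congr 2; ring

/-- The squared bound is a Beta integrand with both exponents `-2β > -1`. -/
lemma memLp_two_of_bound (h1 : β < 1 / 2) (hv : Measurable v)
    (hC : ∀ y ∈ Ioo 0 T, |v y| ≤ C * (y ^ (-β) * (T - y) ^ (-β))) :
    MemLp v 2 (volume.restrict (Icc 0 T)) := by
  rw [memLp_two_iff_integrable_sq hv.aestronglyMeasurable]
  have h2 : 0 < 1 - 2 * β := by linarith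
  have h := (integrableOn_rpow_mul_rpow (L := T) h2 h2).const_mul (C ^ 2)
  rw [← restrict_Ioo_eq_restrict_Icc]
  refine h.mono' (by fun_prop) (ae_restrict_of_forall_mem measurableSet_Ioo fun y hy => ?_)
  have hTy : 0 < T - y := by linarith [hy.2]
  have e : ∀ x : ℝ, 0 < x → x ^ (1 - 2 * β - 1) = (x ^ (-β)) ^ 2 := fun x hx => by
    rw [← Real.rpow_two, ← Real.rpow_mul hx.le]; congr 1; ring
  rw [e y hy.1, e _ hTy, Real.norm_eq_abs, abs_pow, ← mul_pow, ← mul_pow]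
  exact pow_le_pow_left₀ (abs_nonneg _) (hC y hy) 2

variable {p : ℝ → ℝ} {M : ℝ}

lemma marchaud_weighted_bound (hT : 0 < T) (h0 : 0 < β) (h1 : β < 1 / 2)
    (hM : ∀ x ∈ Icc 0 T, ∀ y ∈ Icc 0 T, |p x - p y| ≤ M * |x - y| ^ (1 / 2 : ℝ)) :
    ∃ C, 0 ≤ C ∧
      ∀ y ∈ Ioo 0 T, |y ^ (-β) * marchaud β T p y| ≤ C * (y ^ (-β) * (T - y) ^ (-β)) := by
  obtain ⟨C, hC⟩ := marchaud_bound hT h0 h1 hM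
  refine ⟨|C|, abs_nonneg _, fun y hy => ?_⟩
  have hy' := Real.rpow_pos_of_pos hy.1 (-β)
  have hTy : 0 < T - y := by linarith [hy.2]
  rw [abs_mul, abs_of_pos hy']
  have h2 : C * (T - y) ^ (-β) ≤ |C| * (T - y) ^ (-β) := by
    gcongr; exact le_abs_self C
  calc _ ≤ y ^ (-β) * (|C| * (T - y) ^ (-β)) :=
        mul_le_mul_of_nonneg_left ((hC y hy).trans h2) hy'.le
    _ = _ := by ring

/-- The sum of the two order-`2β` integrals has the Riesz kernel, which `rlKernel_factorisation`
writes as left Abel integral, weight of exponent `-2β`, right Abel integral, up to the outer powers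
`t^β` and `y^β`. The factor `y^(-β)` in the density cancels the inner power, and `abel_inversion`
undoes the right Abel integral. What remains is a left Abel equation for `p`. -/
lemma leftRL_add_rightRL_marchaud (hT : 0 < T) (h0 : 0 < β) (h1 : β < 1 / 2) (hp : Measurable p)
    (hM : ∀ x ∈ Icc 0 T, ∀ y ∈ Icc 0 T, |p x - p y| ≤ M * |x - y| ^ (1 / 2 : ℝ))
    {t : ℝ} (ht : t ∈ Ioo 0 T) :
    leftRL β 0 (leftRL β 0 fun y => y ^ (-β) * marchaud β T p y) t +
        rightRL β T (rightRL β T fun y => y ^ (-β) * marchaud β T p y) t =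
      Real.Gamma β * Real.Gamma (1 - β) / Real.Gamma (2 * β) * t ^ β *
        ∫ s in Icc 0 T, rlKernel β (t - s) * rlKernel (1 - 2 * β) s * p s := by
  set m := marchaud β T p with hm
  set v : ℝ → ℝ := fun y => y ^ (-β) * m y with hv
  have hmm : Measurable m := measurable_marchaud hp
  have hvm : Measurable v := Measurable.mul (by fun_prop) hmm
  obtain ⟨C, hC0, hC⟩ := marchaud_weighted_bound hT h0 h1 hM
  have iL := integrable_rlKernel_left_mul h0 h1 hvm hC hC0 ht
  have iR := integrable_rlKernel_right_mul h0 h1 hvm hC hC0 ht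
  have ht' : t ∈ Icc 0 T := ⟨ht.1.le, ht.2.le⟩
  have hG1 := Real.Gamma_pos_of_pos h0
  have hG2 := Real.Gamma_pos_of_pos (s := 1 - β) (by linarith)
  have hG3 := Real.Gamma_pos_of_pos (s := 2 * β) (by linarith)
  have e2 : β + β = 2 * β := by ring
  rw [leftRL_comp h0 h0 ht' hvm.aestronglyMeasurable (by rwa [e2]),
    rightRL_comp h0 h0 ht' hvm.aestronglyMeasurable (by rwa [e2]), e2, ← integral_add iL iR]
  set κ₃ : ℝ → ℝ := fun r =>
    (t ^ (-β) * r ^ (-β) * |t - r| ^ (2 * β - 1)) / (Real.Gamma β * Real.Gamma (1 - β)) with hκ₃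
  have hne : ∀ᵐ r ∂volume.restrict (Icc 0 T), r ∈ Ioo 0 T ∧ t ≠ r := by
    have : ∀ᵐ r ∂volume.restrict (Icc 0 T), r ≠ t := Measure.ae_ne _ t
    filter_upwards [ae_mem_Ioo T, this] with r h2 h3
    exact ⟨h2, h3.symm⟩
  have hκm : (fun r => κ₃ r * m r) =ᵐ[volume.restrict (Icc 0 T)] fun r =>
      (t ^ (-β) * Real.Gamma (2 * β) / (Real.Gamma β * Real.Gamma (1 - β))) *
        (rlKernel (2 * β) (t - r) * v r + rlKernel (2 * β) (r - t) * v r) := by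
    filter_upwards [hne] with r hr
    simp only [hκ₃, hv]
    rw [← rlKernel_add_swap (by linarith) hr.2]
    field_simp
  have hκi : Integrable (fun r => κ₃ r * m r) (volume.restrict (Icc 0 T)) :=
    (((iL.add iR).const_mul _).congr hκm.symm)
  have hfac : ∀ᵐ r ∂volume.restrict (Icc 0 T),
      Integrable (fun s => rlKernel β (t - s) * rlKernel (1 - 2 * β) s * rightKernel β s r)
        (volume.restrict (Icc 0 T)) ∧
      ∫ s in Icc 0 T, rlKernel β (t - s) * rlKernel (1 - 2 * β) s * rightKernel β s r = κ₃ r := by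
    filter_upwards [hne] with r hr
    obtain ⟨f1, f2⟩ := rlKernel_factorisation h0 h1 ht.1 hr.1.1 hr.2
    have e : (fun s => rlKernel β (t - s) * rlKernel (1 - 2 * β) s * rightKernel β s r) =
        fun s => rlKernel (1 - 2 * β) s * (rlKernel β (t - s) * rlKernel β (r - s)) := by
      funext s; simp only [rightKernel]; ring
    rw [e]
    refine ⟨f1.integrableOn, ?_⟩
    rw [setIntegral_eq_integral_of_forall_compl_eq_zero, f2]
    intro s hs
    rcases le_or_gt s 0 with h | h
    · rw [rlKernel_of_nonpos h, zero_mul]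
    · have : T < s := by
        by_contra h'
        exact hs ⟨h.le, not_lt.1 h'⟩
      rw [rlKernel_of_nonpos (x := t - s) (by linarith [ht.2])]; ring
  have key := (kernelInt_comp (μ := volume.restrict (Icc 0 T)) (t := t)
    (κ₁ := fun t s => rlKernel β (t - s) * rlKernel (1 - 2 * β) s) (κ₂ := rightKernel β) (κ₃ := κ₃)
    (((measurable_rlKernel β).comp (measurable_fst.sub measurable_snd)).mul
      ((measurable_rlKernel _).comp measurable_snd)) (measurable_rightKernel β)
    hmm.aestronglyMeasurable
    (fun s => mul_nonneg (rlKernel_nonneg h0 _) (rlKernel_nonneg (by linarith) _))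
    (fun s r => rlKernel_nonneg h0 _) (hfac.mono fun _ h => h.1) (hfac.mono fun _ h => h.2) hκi).2
  have hinv : kernelInt (volume.restrict (Icc 0 T)) (rightKernel β) m
      =ᵐ[volume.restrict (Icc 0 T)] p := by
    filter_upwards [ae_mem_Ioo T] with s hs
    exact abel_inversion h0 h1 hp hM ⟨hs.1.le, hs.2⟩
  rw [kernelInt_congr_ae hinv, integral_congr_ae hκm, integral_const_mul, kernelInt] at key
  rw [key]
  have htt : t ^ β * t ^ (-β) = 1 := by rw [← Real.rpow_add ht.1]; simp
  generalize (∫ r in Icc 0 T, (rlKernel (2 * β) (t - r) * v r + rlKernel (2 * β) (r - t) * v r)) = I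
  calc I = (t ^ β * t ^ (-β)) * I := by rw [htt, one_mul]
    _ = _ := by field_simp

/-- Differences do not see constants, so the shift `a` acts only through the boundary weight. It is
the free parameter later used to fix the mean. -/
lemma marchaud_const_sub (a : ℝ) (y : ℝ) :
    marchaud β T (fun s => a - p s) y =
      a * (1 / Real.Gamma (1 - β) * (T - y) ^ (-β)) - marchaud β T p y := by
  have e : ∀ s, (a - p y - (a - p s)) * (s - y) ^ (-β - 1) =
      -((p y - p s) * (s - y) ^ (-β - 1)) := fun s => by ring
  simp only [marchaud, e, integral_neg]
  ring

end TwoSided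

/-! ### Solvability of the linear two-sided equation -/

section Solve

variable {β T : ℝ} {h : ℝ → ℝ}

/-- The derivative of `t ↦ t^(-β) ∫₀^t h`. -/
def weightedPrimitiveDeriv (β : ℝ) (h : ℝ → ℝ) (x : ℝ) : ℝ :=
  x ^ (-β) * h x - β * x ^ (-β - 1) * ∫ s in (0 : ℝ)..x, h s

lemma measurable_weightedPrimitiveDeriv (hh : Continuous h) :
    Measurable (weightedPrimitiveDeriv β h) := by
  have hH : Continuous fun x => ∫ s in (0 : ℝ)..x, h s :=
    intervalIntegral.continuous_primitive (fun a b => hh.intervalIntegrable a b) 0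
  unfold weightedPrimitiveDeriv
  have := hH.measurable
  have := hh.measurable
  fun_prop

lemma abs_primitive_le {B : ℝ} (hB : ∀ x ∈ Icc 0 T, |h x| ≤ B) {x : ℝ} (hx : x ∈ Icc 0 T) :
    |∫ s in (0 : ℝ)..x, h s| ≤ B * x := by
  have := intervalIntegral.norm_integral_le_of_norm_le_const (a := 0) (b := x) (f := h) (C := B)
    fun s hs => by
      rw [uIoc_of_le hx.1] at hs
      exact hB s ⟨hs.1.le, hs.2.trans hx.2⟩
  rwa [sub_zero, abs_of_nonneg hx.1] at this

/-- The primitive is at most `B x`, which absorbs one power of the singular factor `x^(-β-1)`. -/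
lemma abs_weightedPrimitiveDeriv_le (h0 : 0 < β) {B : ℝ} (hB : ∀ x ∈ Icc 0 T, |h x| ≤ B)
    {x : ℝ} (hx : x ∈ Ioo 0 T) :
    |weightedPrimitiveDeriv β h x| ≤ (1 + β) * B * x ^ (-β) := by
  have hx' : x ∈ Icc 0 T := ⟨hx.1.le, hx.2.le⟩
  have h2 := abs_primitive_le hB hx'
  have h3 := hB x hx'
  have p1 := Real.rpow_pos_of_pos hx.1 (-β)
  have p2 := Real.rpow_pos_of_pos hx.1 (-β - 1)
  have e : x ^ (-β - 1) * x = x ^ (-β) := by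
    rw [Real.rpow_sub_one hx.1.ne']; field_simp [hx.1.ne']
  refine (abs_sub _ _).trans ?_
  rw [abs_mul, abs_mul, abs_mul, abs_of_pos p1, abs_of_pos p2, abs_of_pos h0]
  calc _ ≤ x ^ (-β) * B + β * x ^ (-β - 1) * (B * x) := by gcongr
    _ = x ^ (-β) * B + β * B * (x ^ (-β - 1) * x) := by ring
    _ = _ := by rw [e]; ring

/-- Only the endpoint `0` is delicate: the weighted primitive is `O(x^(1-β))` there, hence
continuous with value `0`. -/
lemma integral_weightedPrimitiveDeriv (h0 : 0 < β) (h1 : β < 1) (hh : Continuous h)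
    {t : ℝ} (ht : 0 < t) :
    ∫ x in (0 : ℝ)..t, weightedPrimitiveDeriv β h x = t ^ (-β) * ∫ s in (0 : ℝ)..t, h s := by
  obtain ⟨B, hB⟩ := isCompact_Icc.exists_bound_of_continuousOn (s := Icc 0 t) hh.continuousOn
  have hd : ∀ x, 0 < x → HasDerivAt (fun x => x ^ (-β) * ∫ s in (0 : ℝ)..x, h s)
      (weightedPrimitiveDeriv β h x) x := fun x hx => by
    have d1 : HasDerivAt (fun x : ℝ => x ^ (-β)) (-β * x ^ (-β - 1)) x :=
      Real.hasDerivAt_rpow_const (Or.inl hx.ne')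
    have d2 : HasDerivAt (fun x => ∫ s in (0 : ℝ)..x, h s) (h x) x :=
      (hh.integral_hasStrictDerivAt 0 x).hasDerivAt
    have e : weightedPrimitiveDeriv β h x =
        -β * x ^ (-β - 1) * (∫ s in (0 : ℝ)..x, h s) + x ^ (-β) * h x := by
      unfold weightedPrimitiveDeriv; ring
    rw [e]
    exact d1.mul d2
  have hc : ContinuousOn (fun x => x ^ (-β) * ∫ s in (0 : ℝ)..x, h s) (Icc 0 t) := by
    intro x hx
    rcases hx.1.eq_or_lt with rfl | hx0
    · have hlim : Filter.Tendsto (fun x : ℝ => B * x ^ (1 - β)) (nhdsWithin 0 (Icc 0 t))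
          (nhds 0) := by
        have : ContinuousAt (fun x : ℝ => B * x ^ (1 - β)) 0 :=
          continuousAt_const.mul (Real.continuousAt_rpow_const _ _ (Or.inr (by linarith)))
        have h2 := this.tendsto
        rw [Real.zero_rpow (by linarith), mul_zero] at h2
        exact h2.mono_left nhdsWithin_le_nhds
      rw [ContinuousWithinAt, intervalIntegral.integral_same, mul_zero]
      refine squeeze_zero_norm' ?_ hlim
      filter_upwards [self_mem_nhdsWithin] with y hy
      have h3 := abs_primitive_le hB hy
      rcases hy.1.eq_or_lt with rfl | hy0
      · simp [Real.zero_rpow (show 1 - β ≠ 0 by linarith)]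
      · have p1 := Real.rpow_pos_of_pos hy0 (-β)
        rw [norm_mul, Real.norm_of_nonneg p1.le, Real.norm_eq_abs]
        calc _ ≤ y ^ (-β) * (B * y) := by gcongr
          _ = B * y ^ (1 - β) := by
            rw [sub_eq_add_neg, Real.rpow_add hy0, Real.rpow_one]; ring
    · exact (hd x hx0).continuousAt.continuousWithinAt
  have hi : IntervalIntegrable (weightedPrimitiveDeriv β h) volume 0 t := by
    rw [intervalIntegrable_iff_integrableOn_Ioo_of_le ht.le]
    refine ((integrableOn_rpow (a := -β) (L := t) (by linarith)).const_mul ((1 + β) * B)).mono'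
      (measurable_weightedPrimitiveDeriv hh).aestronglyMeasurable
      (ae_restrict_of_forall_mem measurableSet_Ioo fun x hx => ?_)
    exact abs_weightedPrimitiveDeriv_le h0 hB hx
  rw [intervalIntegral.integral_eq_sub_of_hasDerivAt_of_le ht.le hc (fun x hx => hd x hx.1) hi]
  simp

/-- With `d` the derivative of `t^(-β) ∫₀ᵗ h`, the left Abel equation is solved by the order-`(1-β)`
integral `q` of `d`, since orders add to `1`. Dividing `q` by `rlKernel (1 - 2β)` produces the
weight `s^(2β)`, so `holder_weighted_integral` applies. -/
lemma exists_abel_density (hT : 0 < T) (h0 : 0 < β) (h1 : β < 1 / 2) (hh : Continuous h) :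
    ∃ (p : ℝ → ℝ) (M : ℝ), Measurable p ∧
      (∀ x ∈ Icc 0 T, ∀ y ∈ Icc 0 T, |p x - p y| ≤ M * |x - y| ^ (1 / 2 : ℝ)) ∧
      ∀ t ∈ Ioo 0 T,
        Integrable (fun s => rlKernel β (t - s) * rlKernel (1 - 2 * β) s * p s)
          (volume.restrict (Icc 0 T)) ∧
        ∫ s in Icc 0 T, rlKernel β (t - s) * rlKernel (1 - 2 * β) s * p s =
          t ^ (-β) * ∫ s in (0 : ℝ)..t, h s := by
  set d := weightedPrimitiveDeriv β h with hd
  have hdm : Measurable d := measurable_weightedPrimitiveDeriv hh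
  obtain ⟨B, hB⟩ := isCompact_Icc.exists_bound_of_continuousOn (s := Icc 0 T) hh.continuousOn
  have hB0 : 0 ≤ B := (norm_nonneg _).trans (hB 0 ⟨le_rfl, hT.le⟩)
  have hdB : ∀ x ∈ Ioo 0 T, |d x| ≤ (1 + β) * B * x ^ (-β) := fun x hx =>
    abs_weightedPrimitiveDeriv_le h0 hB hx
  obtain ⟨M, hM⟩ := holder_weighted_integral h0 h1 hdm hdB (by positivity)
  set q := kernelInt (volume.restrict (Icc 0 T)) (leftKernel (1 - β)) d with hq
  have hr : 0 < 1 - β := by linarith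
  have hqm : Measurable q := by
    have : Measurable (Function.uncurry fun t s : ℝ => leftKernel (1 - β) t s * d s) :=
      (measurable_leftKernel (1 - β)).mul (hdm.comp measurable_snd)
    exact (this.stronglyMeasurable.integral_prod_right
      (ν := volume.restrict (Icc 0 T))).measurable
  have hG := Real.Gamma_pos_of_pos (s := 1 - 2 * β) (by linarith)
  refine ⟨fun s => Real.Gamma (1 - 2 * β) * (s ^ (2 * β) * q s), Real.Gamma (1 - 2 * β) * M,
    (Measurable.mul (by fun_prop) hqm).const_mul _, fun x hx y hy => ?_, fun t ht => ?_⟩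
  · rw [← mul_sub, abs_mul, abs_of_pos hG, mul_assoc]
    exact mul_le_mul_of_nonneg_left (hM x hx y hy) hG.le
  have ht' : t ∈ Icc 0 T := ⟨ht.1.le, ht.2.le⟩
  have e : (fun s => rlKernel β (t - s) * rlKernel (1 - 2 * β) s *
      (Real.Gamma (1 - 2 * β) * (s ^ (2 * β) * q s))) =ᵐ[volume.restrict (Icc 0 T)]
      fun s => leftKernel β t s * q s := by
    filter_upwards [ae_mem_Ioo T] with s hs
    have e1 : s ^ (1 - 2 * β - 1) * s ^ (2 * β) = 1 := by
      rw [← Real.rpow_add hs.1]; simp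
    rw [leftKernel, rlKernel_of_pos (γ := 1 - 2 * β) hs.1]
    calc _ = rlKernel β (t - s) * (s ^ (1 - 2 * β - 1) * s ^ (2 * β)) * q s := by field_simp
      _ = _ := by rw [e1, mul_one]
  have hs : ∀ r ∈ Icc 0 T, _ := fun r (hr' : r ∈ Icc 0 T) =>
    rlKernel_integral_restrict (T := T) h0 hr ht' hr'
  have h3 := (integrable_rlKernel_mul_of_bound one_pos (by linarith) hdm hdB ht').1
  obtain ⟨k1, k2⟩ := kernelInt_comp (μ := volume.restrict (Icc 0 T)) (t := t)
    (κ₁ := leftKernel β) (κ₂ := leftKernel (1 - β)) (κ₃ := fun r => rlKernel 1 (t - r))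
    (measurable_leftKernel β) (measurable_leftKernel _) hdm.aestronglyMeasurable
    (fun s => rlKernel_nonneg h0 _) (fun s r => rlKernel_nonneg hr _)
    (ae_restrict_of_forall_mem measurableSet_Icc fun r hr' => (hs r hr').1)
    (ae_restrict_of_forall_mem measurableSet_Icc fun r hr' => by
      simpa [leftKernel] using (hs r hr').2) h3
  refine ⟨?_, ?_⟩
  · refine Integrable.congr (k1.integral_prod_left.congr ?_) e.symm
    refine Filter.Eventually.of_forall fun s => ?_
    simp only [hq, kernelInt, integral_const_mul]
  · rw [integral_congr_ae e]
    have e4 : ∫ r in Icc 0 T, rlKernel 1 (t - r) * d r = ∫ r in (0 : ℝ)..t, d r := by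
      rw [← leftRL_one, leftRL_eq_kernelInt one_pos ht']; rfl
    rw [← integral_weightedPrimitiveDeriv h0 (by linarith) hh ht.1, ← e4, ← k2]
    rfl

/-- A constant `p` is mapped by the reduced equation to a constant, because `t^β` cancels the
`t^(-β)` from the semigroup identity. Hence `p₃ = a - c⁻¹ p` still solves the equation, with `A = c
a / Γ(1 - β)`, for every `a`. -/
lemma exists_twoSided_solution (hT : 0 < T) (h0 : 0 < β) (h1 : β < 1 / 2) (hh : Continuous h) :
    ∃ v : ℝ → ℝ, MemLp v 2 (volume.restrict (Icc 0 T)) ∧ ∫ s in Icc 0 T, v s = 0 ∧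
      ∃ A : ℝ, ∀ t ∈ Ioo 0 T,
        leftRL β 0 (leftRL β 0 v) t + rightRL β T (rightRL β T v) t =
          A - ∫ s in (0 : ℝ)..t, h s := by
  obtain ⟨p, M, hp, hM, hpt⟩ := exists_abel_density hT h0 h1 hh
  have hr : 0 < 1 - β := by linarith
  have hG1 := Real.Gamma_pos_of_pos h0
  have hG2 := Real.Gamma_pos_of_pos hr
  have hG3 := Real.Gamma_pos_of_pos (s := 2 * β) (by linarith)
  set c := Real.Gamma β * Real.Gamma (1 - β) / Real.Gamma (2 * β) with hc
  have hc0 : 0 < c := by positivity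
  obtain ⟨w1, w2⟩ := rlKernel_integral_restrict (T := T) (t := T) (r := 0) hr hr ⟨hT.le, le_rfl⟩
    ⟨le_rfl, hT.le⟩
  have hw : (fun y => y ^ (-β) * (1 / Real.Gamma (1 - β) * (T - y) ^ (-β)))
      =ᵐ[volume.restrict (Icc 0 T)] fun y => Real.Gamma (1 - β) *
        (rlKernel (1 - β) (T - y) * rlKernel (1 - β) (y - 0)) := by
    filter_upwards [ae_mem_Ioo T] with y hy
    have e : 1 - β - 1 = -β := by ring
    rw [sub_zero, rlKernel_of_pos hy.1, rlKernel_of_pos (x := T - y) (by linarith [hy.2]), e]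
    field_simp
  have wi : Integrable (fun y => y ^ (-β) * (1 / Real.Gamma (1 - β) * (T - y) ^ (-β)))
      (volume.restrict (Icc 0 T)) := (w1.const_mul _).congr hw.symm
  have wpos : 0 < ∫ y in Icc 0 T, y ^ (-β) * (1 / Real.Gamma (1 - β) * (T - y) ^ (-β)) := by
    rw [integral_congr_ae hw, integral_const_mul, w2, sub_zero, rlKernel_of_pos hT]
    have := Real.Gamma_pos_of_pos (s := 1 - β + (1 - β)) (by linarith)
    positivity
  set p₂ : ℝ → ℝ := fun s => c⁻¹ * p s with hp₂
  have hp₂m : Measurable p₂ := hp.const_mul _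
  have hM₂ : ∀ x ∈ Icc 0 T, ∀ y ∈ Icc 0 T, |p₂ x - p₂ y| ≤ c⁻¹ * M * |x - y| ^ (1 / 2 : ℝ) := by
    intro x hx y hy
    rw [← mul_sub, abs_mul, abs_of_pos (inv_pos.2 hc0), mul_assoc]
    exact mul_le_mul_of_nonneg_left (hM x hx y hy) (inv_pos.2 hc0).le
  have vi : Integrable (fun y => y ^ (-β) * marchaud β T p₂ y) (volume.restrict (Icc 0 T)) := by
    obtain ⟨C, -, hC⟩ := marchaud_weighted_bound hT h0 h1 hM₂
    exact memLp_two_integrable (memLp_two_of_bound h1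
      (Measurable.mul (by fun_prop) (measurable_marchaud hp₂m)) hC)
  -- The unique shift making the density of mean zero; the denominator is the positive integral of
  -- the constant solution.
  set a := (∫ y in Icc 0 T, y ^ (-β) * marchaud β T p₂ y) /
    ∫ y in Icc 0 T, y ^ (-β) * (1 / Real.Gamma (1 - β) * (T - y) ^ (-β)) with ha
  set p₃ : ℝ → ℝ := fun s => a - p₂ s with hp₃
  have hp₃m : Measurable p₃ := measurable_const.sub hp₂m
  have hM₃ : ∀ x ∈ Icc 0 T, ∀ y ∈ Icc 0 T, |p₃ x - p₃ y| ≤ c⁻¹ * M * |x - y| ^ (1 / 2 : ℝ) := by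
    intro x hx y hy
    have := hM₂ x hx y hy
    rwa [show p₃ x - p₃ y = -(p₂ x - p₂ y) by simp only [hp₃]; ring, abs_neg]
  refine ⟨fun y => y ^ (-β) * marchaud β T p₃ y, ?_, ?_,
    c * a * (Real.Gamma (1 - β))⁻¹, fun t ht => ?_⟩
  · obtain ⟨C, -, hC⟩ := marchaud_weighted_bound hT h0 h1 hM₃
    exact memLp_two_of_bound h1 (Measurable.mul (by fun_prop) (measurable_marchaud hp₃m)) hC
  · have e : ∀ y, y ^ (-β) * marchaud β T p₃ y =
        a * (y ^ (-β) * (1 / Real.Gamma (1 - β) * (T - y) ^ (-β))) -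
          y ^ (-β) * marchaud β T p₂ y := fun y => by
      rw [hp₃, marchaud_const_sub]; ring
    simp only [e]
    rw [integral_sub (wi.const_mul a) vi, integral_const_mul, ha, div_mul_cancel₀ _ wpos.ne',
      sub_self]
  · rw [leftRL_add_rightRL_marchaud hT h0 h1 hp₃m hM₃ ht]
    obtain ⟨i1, i2⟩ := hpt t ht
    obtain ⟨j1, j2⟩ := rlKernel_integral_restrict (T := T) (t := t) (r := 0) h0
      (show 0 < 1 - 2 * β by linarith) ⟨ht.1.le, ht.2.le⟩ ⟨le_rfl, hT.le⟩
    simp only [sub_zero] at j1 j2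
    have e : ∀ s, rlKernel β (t - s) * rlKernel (1 - 2 * β) s * p₃ s =
        a * (rlKernel β (t - s) * rlKernel (1 - 2 * β) s) -
          c⁻¹ * (rlKernel β (t - s) * rlKernel (1 - 2 * β) s * p s) := fun s => by
      simp only [hp₃, hp₂]; ring
    simp only [e]
    rw [integral_sub (j1.const_mul a) (i1.const_mul _), integral_const_mul, integral_const_mul,
      i2, j2, rlKernel_of_pos ht.1]
    have e3 : β + (1 - 2 * β) - 1 = -β := by ring
    have e4 : β + (1 - 2 * β) = 1 - β := by ring
    rw [e3, e4]
    have htt : t ^ β * t ^ (-β) = 1 := by rw [← Real.rpow_add ht.1]; simp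
    generalize (∫ s in (0 : ℝ)..t, h s) = H
    calc c * t ^ β * (a * (t ^ (-β) / Real.Gamma (1 - β)) - c⁻¹ * (t ^ (-β) * H))
        = (t ^ β * t ^ (-β)) * (c * a * (Real.Gamma (1 - β))⁻¹ - (c * c⁻¹) * H) := by ring
      _ = _ := by rw [htt, mul_inv_cancel₀ hc0.ne', one_mul, one_mul]

lemma ae_deriv_primitive {v : ℝ → ℝ} (hT : 0 < T)
    (hv : Integrable v (volume.restrict (Icc 0 T))) :
    deriv (fun t => ∫ s in (0 : ℝ)..t, v s) =ᵐ[volume.restrict (Icc 0 T)] v := by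
  have hi : IntervalIntegrable v volume 0 T :=
    intervalIntegrable_of_restrict_Icc hv ⟨le_rfl, hT.le⟩ ⟨hT.le, le_rfl⟩
  have h2 := hi.ae_hasDerivAt_integral
  rw [Filter.EventuallyEq, ae_restrict_iff' measurableSet_Icc]
  filter_upwards [h2] with t h3 ht
  rw [← uIcc_of_le hT.le] at ht
  exact (h3 ht 0 left_mem_uIcc).deriv

/-- Phrased with the derivative of the primitive, as required by the flux. For `β > 0` only its
almost-everywhere class enters. For `β = 0` the integrals are the identity and pointwise values
matter: the equation is `2v = A - ∫₀ᵗ h`, the solution is continuous, and `A` is the average of the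
primitive of `h`. -/
lemma exists_solution_linear (hT : 0 < T) (h0 : 0 ≤ β) (h1 : β < 1 / 2) (hh : Continuous h) :
    ∃ v : ℝ → ℝ, MemLp v 2 (volume.restrict (Icc 0 T)) ∧ ∫ s in Icc 0 T, v s = 0 ∧
      ∃ A : ℝ, ∀ t ∈ Ioo 0 T,
        leftRL β 0 (leftRL β 0 (deriv fun t => ∫ s in (0 : ℝ)..t, v s)) t +
          rightRL β T (rightRL β T (deriv fun t => ∫ s in (0 : ℝ)..t, v s)) t =
          A - ∫ s in (0 : ℝ)..t, h s := by
  rcases h0.eq_or_lt with rfl | h0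
  · have hH : Continuous fun x => ∫ s in (0 : ℝ)..x, h s :=
      intervalIntegral.continuous_primitive (fun a b => hh.intervalIntegrable a b) 0
    set A := (∫ t in Icc 0 T, ∫ s in (0 : ℝ)..t, h s) / T with hA
    set v : ℝ → ℝ := fun t => (A - ∫ s in (0 : ℝ)..t, h s) / 2 with hv
    have hvc : Continuous v := (continuous_const.sub hH).div_const 2
    refine ⟨v, memLp_of_continuousOn hvc.continuousOn 2, ?_, A, fun t ht => ?_⟩
    · have hHi : Integrable (fun x => ∫ s in (0 : ℝ)..x, h s) (volume.restrict (Icc 0 T)) :=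
        memLp_two_integrable (memLp_of_continuousOn hH.continuousOn 2)
      rw [hv, integral_div, integral_sub (integrable_const _) hHi]
      simp [hT.le, hA]
      field_simp
      simp
    · have : deriv (fun t => ∫ s in (0 : ℝ)..t, v s) = v := by
        funext t
        exact (hvc.integral_hasStrictDerivAt 0 t).hasDerivAt.deriv
      rw [this]
      simp only [leftRL, rightRL, if_true, hv]
      ring
  · obtain ⟨v, hv, hv0, A, hA⟩ := exists_twoSided_solution hT h0 h1 hh
    refine ⟨v, hv, hv0, A, fun t ht => ?_⟩
    have ht' : t ∈ Icc 0 T := ⟨ht.1.le, ht.2.le⟩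
    have e := ae_deriv_primitive hT (memLp_two_integrable hv)
    rw [← hA t ht, leftRL_eq_kernelInt h0 ht', rightRL_eq_kernelInt h0 ht',
      leftRL_eq_kernelInt h0 ht', rightRL_eq_kernelInt h0 ht',
      kernelInt_congr_ae (leftRL_congr_ae h0.le e), kernelInt_congr_ae (rightRL_congr_ae h0.le e)]

end Solve

end FracBVP

namespace FracBVP

open MeasureTheory Set

/-! ### From the Euler–Lagrange identity to the fractional equation -/

section Conclusion

variable {α T : ℝ}

lemma exists_admissible {f : ℝ → ℝ} {μ : ℝ} (hf : Continuous f)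
    (hκ : 0 < kappa α T) (h : ENNReal.ofReal μ < muStar α T f) :
    ∃ γ : ℝ, 0 < γ ∧ kappa α T * μ * maxPotential f γ < γ ^ 2 := by
  simp only [muStar, ENNReal.mul_iSup, lt_iSup_iff] at h
  obtain ⟨γ, hγ, h⟩ := h
  refine ⟨γ, hγ, ?_⟩
  rcases (maxPotential_nonneg hf hγ.le).eq_or_lt with h0 | h0
  -- The case covered by the convention `γ² / 0 = +∞`.
  · rw [← h0, mul_zero]; positivity
  · rw [← ENNReal.ofReal_div_of_pos h0, ← ENNReal.ofReal_mul (by positivity),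
      ENNReal.ofReal_lt_ofReal_iff (by positivity), one_div, ← div_eq_inv_mul, div_div,
      lt_div_iff₀ (by positivity)] at h
    linarith

lemma kappa_pos (hT : 0 < T) (h0 : 1 / 2 < α) (h1 : α ≤ 1) : 0 < kappa α T := by
  have hc := cos_pi_mul_pos (β := 1 - α) (by linarith) (by linarith)
  have he := embConst_pos hT h0
  rw [kappa_eq hT h0, abs_cos_eq h0 h1]
  positivity

/-- Adjointness moves both fractional integrals from `w` onto `v`; the weak form of the flux
appears. -/
lemma polarForm_pairMap (v w : L2 T) :
    polarForm (pairMap α T v) (pairMap α T w) =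
      inner ℝ (leftOp (1 - α) T (leftOp (1 - α) T v) + rightOp (1 - α) T (rightOp (1 - α) T v))
        w := by
  change inner ℝ (leftOp (1 - α) T v) (rightOp (1 - α) T w) +
    inner ℝ (leftOp (1 - α) T w) (rightOp (1 - α) T v) = _
  rw [← inner_leftOp, inner_leftOp _ _ w, inner_add_left]
  exact congrArg _ (real_inner_comm _ _)

/-- The constant `A` is invisible to `w`, which has mean zero; for the same reason the adjoint of
the primitive acts on `w` as minus the primitive. -/
lemma polarForm_pairMap_of_solution (hT : 0 < T) (h0 : 0 < α) (h1 : α ≤ 1) {h : ℝ → ℝ}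
    (hh : Continuous h) {v : L2 T} {A : ℝ}
    (hv : (leftOp (1 - α) T (leftOp (1 - α) T v) + rightOp (1 - α) T (rightOp (1 - α) T v) : L2 T)
      =ᵐ[volume.restrict (Icc 0 T)] fun t => A - ∫ s in (0 : ℝ)..t, h s)
    {w : L2 T} (hw : w ∈ smoothDeriv T) :
    polarForm (pairMap α T v) (pairMap α T w) =
      ∫ t in Icc 0 T, h t * leftRL α 0 (pairMap α T w).fst t := by
  set g : L2 T := (memLp_of_continuousOn (T := T) hh.continuousOn 2).toLp with hg
  have hgh : g =ᵐ[volume.restrict (Icc 0 T)] h := MemLp.coeFn_toLp _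
  have hw0 := integral_Icc_smoothDeriv hT hw
  have e1 : leftOp (1 - α) T (leftOp (1 - α) T v) + rightOp (1 - α) T (rightOp (1 - α) T v) =
      A • oneL2 T - leftOp 1 T g := by
    refine Lp.ext (hv.trans ?_)
    filter_upwards [Lp.coeFn_sub (A • oneL2 T) (leftOp 1 T g), Lp.coeFn_smul A (oneL2 T),
      oneL2_coeFn T, leftOp_coeFn zero_le_one g, leftRL_congr_ae zero_le_one hgh]
      with t k1 k2 k3 k4 k5
    rw [k1, Pi.sub_apply, k2, Pi.smul_apply, k3, k4, k5, leftRL_one]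
    simp
  rw [polarForm_pairMap, e1, inner_sub_left, real_inner_smul_left, inner_oneL2, hw0, mul_zero,
    zero_sub, inner_leftOp, rightOp_one_eq_neg hT hw0, inner_neg_right, neg_neg, L2.inner_def]
  refine integral_congr_ae ?_
  filter_upwards [hgh, leftOp_coeFn zero_le_one w, ae_restrict_mem measurableSet_Icc]
    with t k1 k2 ht
  have k3 : leftRL α 0 (pairMap α T w).fst t = ∫ s in (0 : ℝ)..t, w s :=
    leftRL_leftOp h0 h1 ht w
  rw [k1, k2, k3, leftRL_one]
  simp [mul_comm]

lemma ae_leftOp_add_rightOp {β A : ℝ} {H v : ℝ → ℝ} (hβ : 0 ≤ β) {V : L2 T}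
    (hV : V =ᵐ[volume.restrict (Icc 0 T)] v)
    (h : ∀ t ∈ Ioo 0 T,
      leftRL β 0 (leftRL β 0 v) t + rightRL β T (rightRL β T v) t = A - H t) :
    (leftOp β T (leftOp β T V) + rightOp β T (rightOp β T V) : L2 T)
      =ᵐ[volume.restrict (Icc 0 T)] fun t => A - H t := by
  have eL := (leftOp_coeFn hβ V).trans (leftRL_congr_ae hβ hV)
  have eR := (rightOp_coeFn hβ V).trans (rightRL_congr_ae hβ hV)
  filter_upwards [Lp.coeFn_add (leftOp β T (leftOp β T V)) (rightOp β T (rightOp β T V)),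
    leftOp_coeFn hβ (leftOp β T V), leftRL_congr_ae hβ eL,
    rightOp_coeFn hβ (rightOp β T V), rightRL_congr_ae hβ eR, ae_mem_Ioo T]
    with t k1 k2 k3 k4 k5 k6
  rw [k1, Pi.add_apply, k2, k3, k4, k5, h t k6]

lemma rightRL_neg (γ b : ℝ) (u : ℝ → ℝ) (t : ℝ) :
    rightRL γ b (fun s => -u s) t = -rightRL γ b u t := by
  unfold rightRL
  split_ifs
  · rfl
  · simp

lemma flux_eq (u : ℝ → ℝ) (t : ℝ) :
    flux α T u t = leftRL (1 - α) 0 (leftRL (1 - α) 0 (deriv u)) t +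
      rightRL (1 - α) T (rightRL (1 - α) T (deriv u)) t := by
  have : rightCaputo α T u = fun s => -rightRL (1 - α) T (deriv u) s := rfl
  rw [flux, this, rightRL_neg, sub_neg_eq_add]
  rfl

/-- The flux identity holds at every interior point, not merely almost everywhere, so the flux
inherits a classical derivative from the primitive of a continuous function. -/
lemma isSolution_of_flux_eq (hT : 0 < T) {g h v : ℝ → ℝ} {A : ℝ} (hh : Continuous h)
    (hv : Integrable v (volume.restrict (Icc 0 T))) (hv0 : ∫ s in Icc 0 T, v s = 0)
    (hflux : ∀ t ∈ Ioo 0 T, flux α T (fun t => ∫ s in (0 : ℝ)..t, v s) t =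
      A - ∫ s in (0 : ℝ)..t, h s)
    (hgh : ∀ t ∈ Ioo 0 T, h t = g (∫ s in (0 : ℝ)..t, v s)) :
    IsSolution α T g (fun t => ∫ s in (0 : ℝ)..t, v s) := by
  have hi : IntervalIntegrable v volume 0 T :=
    intervalIntegrable_of_restrict_Icc hv ⟨le_rfl, hT.le⟩ ⟨hT.le, le_rfl⟩
  have hd : ∀ t ∈ Ioo 0 T, HasDerivAt (flux α T fun t => ∫ s in (0 : ℝ)..t, v s) (-h t) t := by
    intro t ht
    refine ((hh.integral_hasStrictDerivAt 0 t).hasDerivAt.const_sub A).congr_of_eventuallyEq ?_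
    filter_upwards [Ioo_mem_nhds ht.1 ht.2] with s hs using hflux s hs
  exact
    { ac := hi.absolutelyContinuousOnInterval_intervalIntegral left_mem_uIcc
      differentiable := (ae_mem_Ioo T).mono fun t ht => (hd t ht).differentiableAt
      equation := (ae_mem_Ioo T).mono fun t ht => by
        rw [(hd t ht).deriv, hgh t ht, neg_add_cancel]
      left_bc := intervalIntegral.integral_same
      right_bc := by
        rw [intervalIntegral.integral_of_le hT.le, ← integral_Icc_eq_integral_Ioc, hv0] }

end Conclusion

end FracBVP

end

/-! ### Regularity of the minimiser and conclusion -/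

theorem theorem3p2 (T : ℝ) (hT : 0 < T) (α : ℝ) (hα : 1 / 2 < α) (hα' : α ≤ 1)
    (f : ℝ → ℝ) (hf : Continuous f) (μ : ℝ) (hμ : 0 < μ)
    (hμ' : ENNReal.ofReal μ < FracBVP.muStar α T f) :
    ∃ (u : ℝ → ℝ) (e : WithLp 2 (FracBVP.L2 T × FracBVP.L2 T)),
      -- `u` belongs to `E₀^α` (it is a representative of the element `e`)
      e ∈ FracBVP.E0 α T ∧
      e.fst =ᵐ[MeasureTheory.volume.restrict (Set.Icc 0 T)] u ∧
      -- `u` solves the parametric problem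
      FracBVP.IsSolution α T (fun x => μ * f x) u ∧
      -- `u` is a local minimum of the energy on `E₀^α`
      IsLocalMinOn (FracBVP.energy α T μ f) (FracBVP.E0 α T) e ∧
      -- `u` lies in the sublevel set `{Φ < |cos(πα)| γ² / c²}` for an admissible `γ`
      ∃ γ : ℝ, 0 < γ ∧
        FracBVP.kappa α T * μ * FracBVP.maxPotential f γ < γ ^ 2 ∧
        FracBVP.Phi α T e < |Real.cos (Real.pi * α)| / FracBVP.embConst α T ^ 2 * γ ^ 2 := by
  open FracBVP MeasureTheory Set in
  have hα0 : 0 < α := by linarith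
  obtain ⟨γ, hγ, hκ⟩ := exists_admissible hf (kappa_pos hT hα hα') hμ'
  obtain ⟨y, hy, hyr, hmin⟩ := exists_minimizer hT hα hα' hf hμ hγ hκ
  -- The nonlinear term is frozen at the minimiser and extended continuously beyond `[0, T]`, as the
  -- linear problem takes data continuous on the whole line.
  set h : ℝ → ℝ := fun t => μ * f (IccExtend hT.le ((Icc 0 T).domRestrict (leftRL α 0 y.fst)) t)
    with hh
  have hhc : Continuous h := continuous_const.mul (hf.comp
    (continuousOn_iff_continuous_domRestrict.1 (continuousOn_leftRL hT hα hα' hy)).Icc_extend')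
  have hht : ∀ t ∈ Icc 0 T, h t = μ * f (leftRL α 0 y.fst t) := fun t ht => by
    simp only [hh, IccExtend_of_mem hT.le _ ht]; rfl
  obtain ⟨v, hv, hv0, A, hA⟩ :=
    exists_solution_linear (β := 1 - α) hT (by linarith) (by linarith) hhc
  have hvi := memLp_two_integrable hv
  set u : ℝ → ℝ := fun t => ∫ s in (0 : ℝ)..t, v s with hu
  set V : L2 T := hv.toLp with hV
  have hVv : V =ᵐ[volume.restrict (Icc 0 T)] v := MemLp.coeFn_toLp _
  have hVu : V =ᵐ[volume.restrict (Icc 0 T)] deriv u := hVv.trans (ae_deriv_primitive hT hvi).symm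
  have hV0 : ∫ t in Icc 0 T, V t = 0 := by rw [integral_congr_ae hVv, hv0]
  have hVA := ae_leftOp_add_rightOp (H := fun t => ∫ s in (0 : ℝ)..t, h s) (by linarith) hVu hA
  -- The minimiser and the explicit linear solution have the same polar form against all smooth
  -- derivatives, so coercivity identifies their left Caputo derivatives.
  have hfst : y.fst = leftOp (1 - α) T V := by
    refine fst_eq_of_polarForm_eq hα hα' hy
      (pairMap_mem_derivPairs_of_integral_eq_zero hT hV0) fun w hw => ?_
    rw [euler_lagrange hT hα hf hy hyr hmin (pairMap_mem_derivPairs hw),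
      polarForm_pairMap_of_solution hT hα0 hα' hhc hVA hw, ← integral_const_mul]
    refine setIntegral_congr_fun measurableSet_Icc fun t ht => ?_
    simp only [hht t ht, mul_assoc]
  have hyu : ∀ t ∈ Icc 0 T, leftRL α 0 y.fst t = u t := fun t ht => by
    rw [hfst, leftRL_leftOp hα0 hα' ht, ← leftRL_one, leftRL_eq_kernelInt one_pos ht,
      kernelInt_congr_ae hVv, ← leftRL_eq_kernelInt one_pos ht, leftRL_one]
  refine ⟨u, toSpace α T y, toSpace_mem_E0 hT hα0.le hα' hy, ?_, ?_,
    isLocalMinOn_energy hT hα hα' hy hyr hmin, γ, hγ, hκ, ?_⟩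
  · filter_upwards [leftOp_coeFn hα0.le y.fst, ae_restrict_mem measurableSet_Icc] with t k ht
    exact k.trans (hyu t ht)
  · refine isSolution_of_flux_eq (A := A) hT hhc hvi hv0 (fun t ht => ?_) (fun t ht => ?_)
    · rw [flux_eq]; exact hA t ht
    · have ht' : t ∈ Icc 0 T := ⟨ht.1.le, ht.2.le⟩
      rw [hht t ht', hyu t ht']
  · rw [Phi_toSpace hT hα0.le hα' hy]
    exact hyr
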